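/- Let $n\ge 0$. Let $\mathcal D_n$ be the set of Dyck words of length $2n$, i.e. words over $\{0,1\}$ with $n$ zeros and $n$ ones in which each prefix has at least as many $0$s as $1$s. For a word $u$, let $|u|_1$ be its number of $1$s. For $\sigma,\tau,\pi\in\mathcal D_n$, let $t^{\pi}_{\sigma,\tau}$ be the number of triangular fully packed loop configurations with left, right and bottom boundaries $\sigma,\tau,\pi$, defined as follows. Let $\mathcal T^n$ be the square-grid graph on the points $(x,y)\in\mathbb Z^2$ with $x\ge y\ge 0$ and $x+y\le 4n-2$, together with $2n$ vertical external edges attached below the vertices $(2i-2,0)$, $1\le i\le 2n$. Let $L_i=(i-1,i-1)$ and $R_i=(2n-2+i,2n-i)$ for $1\le i\le 2n$, so that $L_{2n}=R_1$ is the apex. A configuration is a set of edges of $\mathcal T^n$, containing all external edges, such that - each vertex other than the $L_i$ and $R_i$ has degree $2$; - for each $i<2n$ the edge to the right of $L_i$ is present, and for each $i\le 2n$ the edge below $L_i$ is present if and only if $\sigma_i=0$; - for each $i>1$ the edge to the left of $R_i$ is present, and for each $i\le 2n$ the edge below $R_i$ is present if and only if $\tau_i=1$; - each $L_i$ with $\sigma_i=1$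 is joined by a path of the configuration to some $R_j$ with $\tau_j=0$ (for the apex this is a path of length $0$); - the $i$-th and $j$-th external edges are joined by a path whenever $i$ and $j$ are matched in the noncrossing matching of $\pi$ ($0$s opening, $1$s closing). Closed paths are allowed. Let $\sigma,\tau,\pi\in\mathcal D_n$ and let $u,v$ be words over $\{0,1\}$. 1. If $\sigma=u0^b1v$ and $\pi=u10^bv$ for some $b\ge 0$, then $t^{\pi}_{\sigma,\tau}=0$ unless $\tau=0^{n-k}10^k1^{n-1}$ for some $k\in\{0,\dots,b\}$, and in this case $t^{\pi}_{\sigma,\tau}=\binom{2n-|u|_1-2-k}{b-k}$. 2. If $\sigma=u01^av$ and $\pi=u1^a0v$ for some $a\ge 0$, then $t^{\pi}_{\sigma,\tau}=0$ unless $\tau=0^{n-1}1^k01^{n-k}$ for some $k\in\{0,\dots,a\}$, and in this case $t^{\pi}_{\sigma,\tau}=\binom{2n-|u|_1-2}{a-k}$. -/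

import Mathlib

/-- A `01`-word is a list over `Fin 2`. `IsDyck w` says that the word `w` (of any length) has as
many `0`s as `1`s and that each of its prefixes has at least as many `0`s as `1`s. -/
def IsDyck (w : List (Fin 2)) : Prop :=
  w.count 0 = w.count 1 ∧ ∀ p : List (Fin 2), p <+: w → p.count 1 ≤ p.count 0

/-- The set `𝒟ₙ` of Dyck words of length `2n`. -/
def dyckWords (n : ℕ) : Set (List (Fin 2)) :=
  {w | w.length = 2 * n ∧ IsDyck w}

/-- The positions `i < j` (counted from `0`) are paired in the noncrossing matching of the Dyck
word `π`: there is a `0` at position `i`, a `1` at position `j`, and the factor strictly between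
them is a Dyck word. -/
def IsMatched (π : List (Fin 2)) (i j : ℕ) : Prop :=
  ∃ p w s : List (Fin 2), π = p ++ 0 :: (w ++ 1 :: s) ∧ IsDyck w ∧
    i = p.length ∧ j = p.length + 1 + w.length

/-- The vertices of the triangle `𝒯ⁿ`: `x ≥ y ≥ 0` and `x + y ≤ 4n - 2`. -/
def InTriangle (n : ℕ) (p : ℤ × ℤ) : Prop :=
  0 ≤ p.2 ∧ p.2 ≤ p.1 ∧ p.1 + p.2 ≤ 4 * (n : ℤ) - 2

/-- The left boundary vertex number `i`, for `i = 0, …, 2n - 1`, from bottom to top. -/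
def leftVertex (i : ℕ) : ℤ × ℤ := ((i : ℤ), (i : ℤ))

/-- The right boundary vertex number `i`, for `i = 0, …, 2n - 1`, from top to bottom.
Number `0` is the apex of the triangle, which is also the last left boundary vertex. -/
def rightVertex (n i : ℕ) : ℤ × ℤ := (2 * (n : ℤ) - 1 + i, 2 * (n : ℤ) - 1 - i)

/-- The bottom vertex to which the external edge number `i` is attached. -/
def bottomVertex (i : ℕ) : ℤ × ℤ := (2 * (i : ℤ), 0)

/-- The free end of the external edge number `i` (an auxiliary point below the triangle). -/
def externalEnd (i : ℕ) : ℤ × ℤ := (2 * (i : ℤ), -1)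

/-- The graph `𝒯ⁿ`: the square grid on the vertices of the triangle, together with `2n` vertical
external edges below every second vertex of the bottom row. -/
def triangleGraph (n : ℕ) : SimpleGraph (ℤ × ℤ) :=
  SimpleGraph.fromRel fun p q =>
    (InTriangle n p ∧ InTriangle n q ∧ (q = p + (1, 0) ∨ q = p + (0, 1))) ∨
      ∃ i : ℕ, i < 2 * n ∧ p = externalEnd i ∧ q = bottomVertex i

/-- `IsTFPL n σ τ π f`: the subgraph `f` of the triangle is a TFPL configuration with left
boundary `σ`, right boundary `τ` and bottom boundary `π`. Letters are numbered from `0`. -/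
structure IsTFPL (n : ℕ) (σ τ π : List (Fin 2)) (f : SimpleGraph (ℤ × ℤ)) : Prop where
  /-- `f` consists of edges of the triangle. -/
  le_triangle : f ≤ triangleGraph n
  /-- All external edges belong to `f`. -/
  external : ∀ i < 2 * n, f.Adj (externalEnd i) (bottomVertex i)
  /-- Each vertex off the left and right boundaries has degree two. -/
  degree_two : ∀ p : ℤ × ℤ, InTriangle n p → (∀ i < 2 * n, p ≠ leftVertex i) →
    (∀ i < 2 * n, p ≠ rightVertex n i) → (f.neighborSet p).ncard = 2
  /-- The edge to the right of a left boundary vertex (other than the apex) belongs to `f`. -/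
  left_horizontal : ∀ i, i + 1 < 2 * n → f.Adj (leftVertex i) (leftVertex i + (1, 0))
  /-- The edge below the left boundary vertex `i` belongs to `f` if and only if `σᵢ = 0`. -/
  left_vertical : ∀ i < 2 * n, f.Adj (leftVertex i) (leftVertex i - (0, 1)) ↔ σ[i]? = some 0
  /-- The edge to the left of a right boundary vertex (other than the apex) belongs to `f`. -/
  right_horizontal : ∀ i, 0 < i → i < 2 * n → f.Adj (rightVertex n i) (rightVertex n i - (1, 0))
  /-- The edge below the right boundary vertex `i` belongs to `f` if and only if `τᵢ = 1`. -/
  right_vertical : ∀ i < 2 * n,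
    f.Adj (rightVertex n i) (rightVertex n i - (0, 1)) ↔ τ[i]? = some 1
  /-- A path that starts at a left boundary vertex with letter `1` ends at a right boundary vertex
  with letter `0`. -/
  crossing : ∀ i < 2 * n, σ[i]? = some 1 →
    ∃ j < 2 * n, τ[j]? = some 0 ∧ f.Reachable (leftVertex i) (rightVertex n j)
  /-- The paths between the external edges realize the matching `π`. -/
  bottom : ∀ i j, IsMatched π i j → f.Reachable (externalEnd i) (externalEnd j)

/-- The set of TFPL configurations with boundary data `σ, τ, π`. -/
def tfplSet (n : ℕ) (σ τ π : List (Fin 2)) : Set (SimpleGraph (ℤ × ℤ)) :=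
  {f | IsTFPL n σ τ π f}

/-- The number `t^π_{σ,τ}` of TFPL configurations with boundary data `σ, τ, π`. -/
noncomputable def tfplNumber (n : ℕ) (σ τ π : List (Fin 2)) : ℕ :=
  (tfplSet n σ τ π).ncard

/-- There are finitely many TFPL configurations, so that `tfplNumber` is a genuine count. -/
theorem tfplSet_finite (n : ℕ) (σ τ π : List (Fin 2)) : (tfplSet n σ τ π).Finite := by
  let B : Set (ℤ × ℤ) := Set.Icc ((-1 : ℤ), (-1 : ℤ)) (4 * (n : ℤ), 4 * (n : ℤ))
  have hB : B.Finite := Set.finite_Icc _ _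
  have hrel : ∀ p q, (triangleGraph n).Adj p q → p ∈ B ∧ q ∈ B := by
    intro p q h
    simp only [triangleGraph, SimpleGraph.fromRel_adj, InTriangle, externalEnd, bottomVertex] at h
    simp only [B, Set.mem_Icc, Prod.le_def]
    rcases h.2 with (h | ⟨i, hi, rfl, rfl⟩) | (h | ⟨i, hi, rfl, rfl⟩)
    · obtain ⟨h1, h2, -⟩ := h
      omega
    · simp only
      omega
    · obtain ⟨h1, h2, -⟩ := h
      omega
    · simp only
      omega
  let g : SimpleGraph (ℤ × ℤ) → Set ((ℤ × ℤ) × (ℤ × ℤ)) := fun f => {e | f.Adj e.1 e.2}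
  refine Set.Finite.of_finite_image (f := g) ?_ ?_
  · refine ((hB.prod hB).finite_subsets).subset ?_
    rintro _ ⟨f, hf, rfl⟩ e he
    exact hrel _ _ (hf.le_triangle he)
  · intro f _ f' _ h
    ext a b
    exact Set.ext_iff.1 h (a, b)

/-!
A configuration is oriented so that its paths lead from the left boundary to the right boundary and
from the opening to the closing external edges (`exists_orientation`). The vertices `(x, y)` of the
triangle with `x + y` even are its lattice points, those with `x + y` odd its cells. Every edge
joins a lattice point to a cell, so an oriented configuration is given by two directions `d` and `e`
at each lattice point, those of the outgoing and of the incoming edge, such that each of `d` and `e`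
assigns every cell to exactly one lattice point: a tangle (`IsTangle`).

The condition on the paths is turned into a condition on the orientation. Faces have heights that
change by one when a strand is crossed, and the level of a strand, the height of the face on one of
its sides, is constant along the strand (`IsTangle.inLevel_eq`). By levels, the strands of a tangle
realize the noncrossing matching of `π` and lead from the left to the right boundary as soon as no
strand leads from an external edge to one further left (`IsTangle.reaches_matched`,
`IsTangle.reaches_right`). So the configurations are the graphs of the tangles with this property
(`IsTFPL.exists_isTangle`, `IsTangle.isTFPL`).

A tangle is read column by column, from left to right. The cells between two consecutive columns
are split between them, and the words `σ` and `π` leave almost no freedom where they agree. In the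
columns of the run in which they differ, exactly one strand runs back to the left. The state of a
strip records the row of this strand and the position of one cell by which the outgoing edges
deviate from the forced pattern. The columns and their possible transitions form a column model
(`ColumnModel`), given by `oneRunModel` and `zeroRunModel` in the two cases. Every tangle of a
configuration follows the model (`OneRun.continues`, `ZeroRun.continues`), every sequence of states
gives such a tangle (`IsChain.isTangle`, `OneRun.noReturn`, `ZeroRun.noReturn`), and different
sequences give different configurations (`OneRun.eq_of_columns`, `ZeroRun.eq_of_columns`). Hence
`tfplNumber` counts sequences of states (`ColumnModel.tfplNumber_eq`).

The last state determines `τ`, which leaves the words listed in the theorem, with `k` read off the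
state. The sequences with a given last state are counted by solving the recursion of the transfer
matrix (`ncard_pathSet`, `OneRun.ncard_isChain`, `ZeroRun.ncard_isChain`). For the words `u 0^b 1 v`
and `u 1 0^b v` the result is a sum of products of binomial coefficients, evaluated by the identity
of Vandermonde.
-/

/-! ### Orienting a graph whose vertices have degree at most two -/

open Relation

section Orientation

variable {V : Type*} {f : SimpleGraph V}

/-- `DartNext f x y`: the directed edge `y` continues the directed edge `x` without turning
back. -/
def DartNext (f : SimpleGraph V) (x y : V × V) : Prop :=
  f.Adj x.1 x.2 ∧ f.Adj y.1 y.2 ∧ y.1 = x.2 ∧ y.2 ≠ x.1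

/-- Every vertex has at most two neighbours. -/
def DegreeLeTwo (f : SimpleGraph V) : Prop :=
  ∀ v a b c, f.Adj v a → f.Adj v b → f.Adj v c → a = b ∨ a = c ∨ b = c

theorem DartNext.reverse {x y : V × V} (h : DartNext f x y) : DartNext f y.swap x.swap := by
  obtain ⟨h1, h2, h3, h4⟩ := h
  exact ⟨h2.symm, h1.symm, h3.symm, fun h => h4 h.symm⟩

theorem DartNext.right_unique (hdeg : DegreeLeTwo f) {x y y' : V × V}
    (h : DartNext f x y) (h' : DartNext f x y') : y = y' := by
  obtain ⟨a, b⟩ := x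
  obtain ⟨c, d⟩ := y
  obtain ⟨c', d'⟩ := y'
  obtain ⟨h1, h2, h3, h4⟩ := h
  obtain ⟨h1', h2', h3', h4'⟩ := h'
  simp only at *
  subst h3 h3'
  rcases hdeg _ _ _ _ h1.symm h2 h2' with h | h | h
  · exact absurd h.symm h4
  · exact absurd h.symm h4'
  · rw [h]

theorem DartNext.left_unique (hdeg : DegreeLeTwo f) {x x' y : V × V}
    (h : DartNext f x y) (h' : DartNext f x' y) : x = x' := by
  have := h.reverse.right_unique hdeg h'.reverse
  simpa using congrArg Prod.swap this

theorem rightUnique_dartNext (hdeg : DegreeLeTwo f) : Relator.RightUnique (DartNext f) :=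
  fun _ _ _ h h' => h.right_unique hdeg h'

theorem rightUnique_swap_dartNext (hdeg : DegreeLeTwo f) :
    Relator.RightUnique (Function.swap (DartNext f)) :=
  fun _ _ _ h h' => DartNext.left_unique hdeg h h'

/-- No directed edge leads to its own reversal: the two halves of such a walk would be reversals
of each other, so that it would turn back in the middle. -/
theorem not_reflTransGen_dartNext_swap (hdeg : DegreeLeTwo f) {x : V × V} (hx : f.Adj x.1 x.2) :
    ¬ ReflTransGen (DartNext f) x x.swap := by
  have key : ∀ N : ℕ, ∀ g : ℕ → V × V, f.Adj (g 0).1 (g 0).2 → g N = (g 0).swap →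
      (∀ i < N, DartNext f (g i) (g (i + 1))) → False := by
    intro N
    induction N using Nat.strong_induction_on with
    | _ N ih =>
      intro g h0 hN hs
      match N, ih, hN, hs with
      | 0, _, hN, _ =>
        have h := congrArg Prod.fst hN
        simp only [Prod.fst_swap] at h
        exact f.loopless.irrefl (g 0).1 (by rw [← h] at h0; exact h0)
      | 1, _, hN, hs =>
        have h := (hs 0 (by omega)).2.2.2
        simp only [zero_add, hN] at h
        exact h rfl
      | N + 2, ih, hN, hs =>
        have h1 := hs 0 (by omega)
        have h2 := (hs (N + 1) (by omega)).reverse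
        rw [show N + 1 + 1 = N + 2 from rfl, hN, Prod.swap_swap] at h2
        have h3 := h1.right_unique hdeg h2
        refine ih N (by omega) (fun i => g (i + 1)) h1.2.1 ?_ (fun i hi => hs (i + 1) (by omega))
        simp only [zero_add] at h3 ⊢
        rw [h3, Prod.swap_swap]
  intro h
  have hseq : ∀ y, ReflTransGen (DartNext f) x y → ∃ (N : ℕ) (g : ℕ → V × V), g 0 = x ∧ g N = y ∧
      ∀ i < N, DartNext f (g i) (g (i + 1)) := by
    intro y hy
    induction hy with
    | refl => exact ⟨0, fun _ => x, rfl, rfl, by simp⟩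
    | @tail b c _ hbc ih =>
      obtain ⟨N, g, h0, hN, hs⟩ := ih
      refine ⟨N + 1, fun i => if i ≤ N then g i else c, by simp [h0], by simp, ?_⟩
      intro i hi
      rcases Nat.lt_succ_iff_lt_or_eq.1 hi with h | rfl
      · simp only [if_pos h.le, if_pos (Nat.succ_le_of_lt h)]
        exact hs i h
      · simp only [le_refl, if_true, if_neg (Nat.not_succ_le_self i), hN]
        exact hbc
  obtain ⟨N, g, h0, hN, hs⟩ := hseq _ h
  exact key N g (by rw [h0]; exact hx) (by rw [h0, hN]) hs

/-- A vertex reachable from `s`, a vertex with at most one neighbour, is the head of a directed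
edge on the walk that leaves `s`. -/
theorem exists_dart_of_reachable {s t : V}
    (hs : ∀ a b, f.Adj s a → f.Adj s b → a = b) (h : f.Reachable s t) (hst : t ≠ s) :
    ∃ b x, f.Adj s b ∧ ReflTransGen (DartNext f) (s, b) x ∧ f.Adj x.1 x.2 ∧ x.2 = t := by
  rw [SimpleGraph.reachable_iff_reflTransGen] at h
  induction h with
  | refl => exact absurd rfl hst
  | @tail v w _ hvw ih =>
    by_cases hv : v = s
    · subst hv
      exact ⟨w, (v, w), hvw, .refl, hvw, rfl⟩
    · obtain ⟨b, x, hb, hx, hx', rfl⟩ := ih hv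
      by_cases hw : w = x.1
      · subst hw
        -- the walk steps back to the tail of `x`, which is `s` or the head of the previous edge
        rcases ReflTransGen.cases_tail hx with h | ⟨y, hy, hyx⟩
        · rw [h] at hst
          exact absurd rfl hst
        · exact ⟨b, y, hb, hy, hyx.1, hyx.2.2.1.symm⟩
      · exact ⟨b, (x.2, w), hb, hx.tail ⟨hx', hvw, rfl, hw⟩, hvw, rfl⟩

theorem not_dartNext_of_end {t : V} (ht : ∀ a b, f.Adj t a → f.Adj t b → a = b) {x y : V × V}
    (hx : x.2 = t) : ¬ DartNext f x y := by
  rintro ⟨h1, h2, h3, h4⟩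
  subst hx
  rw [h3] at h2
  exact h4 (ht _ _ h2 h1.symm)

theorem not_dartNext_of_start {s : V} (hs : ∀ a b, f.Adj s a → f.Adj s b → a = b) {x y : V × V}
    (hy : y.1 = s) : ¬ DartNext f x y :=
  fun h => not_dartNext_of_end (f := f) hs (x := y.swap) (y := x.swap) (by simpa using hy) h.reverse

theorem reflTransGen_eq_of_terminal {α : Type*} {r : α → α → Prop} (hr : Relator.RightUnique r)
    {x y z : α} (hy : ReflTransGen r x y) (hz : ReflTransGen r x z) (hy' : ∀ w, ¬ r y w)
    (hz' : ∀ w, ¬ r z w) : y = z := by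
  rcases ReflTransGen.total_of_right_unique hr hy hz with h | h
  · rcases ReflTransGen.cases_head h with h | ⟨w, hw, _⟩
    · exact h
    · exact absurd hw (hy' w)
  · rcases ReflTransGen.cases_head h with h | ⟨w, hw, _⟩
    · exact h.symm
    · exact absurd hw (hz' w)

/-- A component has at most one endpoint besides `s`. -/
theorem end_unique_of_reachable (hdeg : DegreeLeTwo f) {s t t' : V}
    (hs : ∀ a b, f.Adj s a → f.Adj s b → a = b) (ht : ∀ a b, f.Adj t a → f.Adj t b → a = b)
    (ht' : ∀ a b, f.Adj t' a → f.Adj t' b → a = b) (h : f.Reachable s t) (h' : f.Reachable s t')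
    (hst : t ≠ s) (hst' : t' ≠ s) : t = t' := by
  obtain ⟨b, x, hb, hx, hxa, rfl⟩ := exists_dart_of_reachable hs h hst
  obtain ⟨b', x', hb', hx', hxa', rfl⟩ := exists_dart_of_reachable hs h' hst'
  obtain rfl := hs _ _ hb hb'
  rw [reflTransGen_eq_of_terminal (rightUnique_dartNext hdeg) hx hx'
    (fun _ => not_dartNext_of_end ht rfl) (fun _ => not_dartNext_of_end ht' rfl)]

theorem eqvGen_dartNext (hdeg : DegreeLeTwo f) {x y : V × V} (h : EqvGen (DartNext f) x y) :
    ReflTransGen (DartNext f) x y ∨ ReflTransGen (DartNext f) y x := by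
  induction h with
  | rel x y h => exact Or.inl (.single h)
  | refl x => exact Or.inl .refl
  | symm x y _ ih => exact ih.symm
  | trans x y z _ _ ih1 ih2 =>
    rcases ih1 with h1 | h1 <;> rcases ih2 with h2 | h2
    · exact Or.inl (h1.trans h2)
    · have := ReflTransGen.total_of_right_unique (rightUnique_swap_dartNext hdeg)
        (reflTransGen_swap.2 h1) (reflTransGen_swap.2 h2)
      exact this.symm.imp reflTransGen_swap.1 reflTransGen_swap.1
    · exact ReflTransGen.total_of_right_unique (rightUnique_dartNext hdeg) h1 h2
    · exact Or.inr (h2.trans h1)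

theorem eqvGen_dartNext_reverse {x y : V × V} (h : EqvGen (DartNext f) x y) :
    EqvGen (DartNext f) x.swap y.swap := by
  induction h with
  | rel x y h => exact .symm _ _ (.rel _ _ h.reverse)
  | refl x => exact .refl _
  | symm x y _ ih => exact .symm _ _ ih
  | trans x y z _ _ ih1 ih2 => exact .trans _ _ _ ih1 ih2

theorem not_eqvGen_dartNext_swap (hdeg : DegreeLeTwo f) {x : V × V} (hx : f.Adj x.1 x.2) :
    ¬ EqvGen (DartNext f) x x.swap := by
  intro h
  rcases eqvGen_dartNext hdeg h with h | h
  · exact not_reflTransGen_dartNext_swap hdeg hx h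
  · exact not_reflTransGen_dartNext_swap hdeg (x := x.swap) hx.symm (by simpa using h)

/-- A graph with degrees at most two can be oriented along its paths and cycles. If its endpoints
are divided into starts and ends, such that every start is joined to an end and there are at
least as many starts as ends, then the orientation can be chosen to lead from the starts to the
ends. -/
theorem exists_orientation (hdeg : DegreeLeTwo f) (St En : Finset V) (hdisj : Disjoint St En)
    (hS : ∀ s ∈ St, ∀ a b, f.Adj s a → f.Adj s b → a = b)
    (hE : ∀ s ∈ En, ∀ a b, f.Adj s a → f.Adj s b → a = b)
    (hreach : ∀ s ∈ St, ∃ t ∈ En, f.Reachable s t) (hcard : En.card ≤ St.card) :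
    ∃ O : V → V → Prop, (∀ a b, O a b → f.Adj a b) ∧ (∀ a b, f.Adj a b → (O a b ↔ ¬ O b a)) ∧
      (∀ a b c, f.Adj a b → f.Adj b c → c ≠ a → (O a b ↔ O b c)) ∧
      (∀ s ∈ St, ∀ b, f.Adj s b → O s b) ∧ (∀ t ∈ En, ∀ b, f.Adj b t → O b t) := by
  classical
  set E := EqvGen.setoid (DartNext f) with hEdef
  let cl : V × V → Quotient E := fun x => Quotient.mk E x
  have hcl : ∀ x y, cl x = cl y ↔ EqvGen (DartNext f) x y := fun x y => Quotient.eq (r := E)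
  let P : V × V → Prop := fun x => ∃ s ∈ St, ∃ b, f.Adj s b ∧ EqvGen (DartNext f) (s, b) x
  have hne : ∀ s ∈ St, ∀ t ∈ En, t ≠ s := fun s hs t ht h =>
    Finset.disjoint_left.1 hdisj hs (h ▸ ht)
  -- a component that contains a start is not left through a start
  have hP : ∀ x, P x → ¬ P x.swap := by
    rintro x ⟨s, hs, b, hb, h⟩ ⟨s', hs', b', hb', h'⟩
    have h2 := eqvGen_dartNext_reverse h'
    rw [Prod.swap_swap] at h2
    have h3 := h.trans _ _ _ (h2.symm _ _)
    obtain ⟨t, ht, hst⟩ := hreach s hs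
    obtain ⟨c, y, hc, hy, hya, hyt⟩ := exists_dart_of_reachable (hS s hs) hst (hne s hs t ht)
    obtain rfl := hS s hs _ _ hb hc
    rcases eqvGen_dartNext hdeg h3 with h4 | h4
    · have := reflTransGen_eq_of_terminal (rightUnique_dartNext hdeg) hy h4
        (fun _ => not_dartNext_of_end (hE t ht) hyt)
        (fun _ => not_dartNext_of_end (hS s' hs') rfl)
      rw [this] at hyt
      exact hne s' hs' t ht hyt.symm
    · rcases ReflTransGen.cases_tail h4 with h5 | ⟨y, _, hy⟩
      · have h6 : s = b' := congrArg Prod.fst h5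
        have h7 : b = s' := congrArg Prod.snd h5
        rw [← h5] at h4
        have := reflTransGen_eq_of_terminal (rightUnique_dartNext hdeg) hy (.refl)
          (fun _ => not_dartNext_of_end (hE t ht) hyt)
          (fun _ => not_dartNext_of_end (hS s' hs') h7)
        rw [this] at hyt
        exact hne s' hs' t ht (hyt.symm.trans h7)
      · exact not_dartNext_of_start (hS s hs) rfl hy
  obtain ⟨lt, hlt⟩ : ∃ r : Quotient E → Quotient E → Prop, IsWellOrder _ r :=
    ⟨WellOrderingRel, inferInstance⟩
  let Q : V × V → Prop := fun x => P x ∨ (¬ P x.swap ∧ lt (cl x) (cl x.swap))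
  have hPe : ∀ x y, EqvGen (DartNext f) x y → (P x ↔ P y) := by
    intro x y h
    constructor
    · rintro ⟨s, hs, b, hb, h1⟩; exact ⟨s, hs, b, hb, h1.trans _ _ _ h⟩
    · rintro ⟨s, hs, b, hb, h1⟩; exact ⟨s, hs, b, hb, h1.trans _ _ _ (h.symm _ _)⟩
  have hQe : ∀ x y, EqvGen (DartNext f) x y → (Q x ↔ Q y) := by
    intro x y h
    have h' := eqvGen_dartNext_reverse h
    simp only [Q, hPe x y h, hPe _ _ h', (hcl x y).2 h, (hcl _ _).2 h']
  have hQs : ∀ x : V × V, f.Adj x.1 x.2 → (Q x ↔ ¬ Q x.swap) := by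
    intro x hx
    have h1 := hP x
    have h2 : cl x ≠ cl x.swap := fun h => not_eqvGen_dartNext_swap hdeg hx ((hcl _ _).1 h)
    have h3 := (hlt.toTrichotomous).trichotomous (cl x) (cl x.swap)
    have h4 : lt (cl x) (cl x.swap) → ¬ lt (cl x.swap) (cl x) := fun a b => asymm_of lt a b
    simp only [Q, Prod.swap_swap]
    generalize lt (cl x) (cl x.swap) = u at *
    generalize lt (cl x.swap) (cl x) = v at *
    generalize P x = p at *
    generalize P x.swap = q at *
    by_cases u <;> by_cases v <;> by_cases p <;> by_cases q <;> simp_all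
  refine ⟨fun a b => f.Adj a b ∧ Q (a, b), fun a b h => h.1, ?_, ?_, ?_, ?_⟩
  · intro a b h
    have := hQs (a, b) h
    simp only [Prod.swap_prod_mk] at this
    simp only [h, h.symm, true_and]
    exact this
  · intro a b c h1 h2 h3
    have := hQe (a, b) (b, c) (.rel _ _ ⟨h1, h2, rfl, h3⟩)
    simp only [h1, h2, true_and, this]
  · intro s hs b hb
    exact ⟨hb, Or.inl ⟨s, hs, b, hb, .refl _⟩⟩
  · choose! T hT hTr using hreach
    have hinj : Set.InjOn T St := by
      intro s hs s' hs' h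
      obtain ⟨b, x, hb, hx, hxa, hxt⟩ :=
        exists_dart_of_reachable (hS s hs) (hTr s hs) (hne s hs _ (hT s hs))
      obtain ⟨b', x', hb', hx', hxa', hxt'⟩ :=
        exists_dart_of_reachable (hS s' hs') (hTr s' hs') (hne s' hs' _ (hT s' hs'))
      have hxx : x = x' := by
        have h1 : x.2 = x'.2 := by rw [hxt, hxt', h]
        have h2 : x.1 = x'.1 := by
          refine hE (T s) (hT s hs) _ _ ?_ ?_
          · rw [← hxt]; exact hxa.symm
          · rw [← hxt, h1]; exact hxa'.symm
        exact Prod.ext h2 h1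
      subst hxx
      have := reflTransGen_eq_of_terminal (rightUnique_swap_dartNext hdeg)
        (reflTransGen_swap.2 hx) (reflTransGen_swap.2 hx')
        (fun _ => not_dartNext_of_start (hS s hs) rfl)
        (fun _ => not_dartNext_of_start (hS s' hs') rfl)
      exact congrArg Prod.fst this
    have hsurj := Finset.surj_on_of_inj_on_of_card_le (s := St) (t := En) (fun a _ => T a)
      (fun a ha => hT a ha) (fun a b ha hb h => hinj ha hb h) hcard
    intro t ht b hb
    obtain ⟨s, hs, rfl⟩ := hsurj t ht
    obtain ⟨c, x, hc, hx, hxa, hxt⟩ :=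
      exists_dart_of_reachable (hS s hs) (hTr s hs) (hne s hs _ (hT s hs))
    have h2 : x.1 = b := by
      refine hE (T s) (hT s hs) _ _ ?_ hb.symm
      rw [← hxt]; exact hxa.symm
    have hx' : x = (b, T s) := Prod.ext h2 hxt
    refine ⟨hb, Or.inl ⟨s, hs, c, hc, ?_⟩⟩
    rw [← hx']
    exact hx.rec (.refl _) (fun _ h ih => ih.trans _ _ _ (.rel _ _ h))

end Orientation

/-! ### Tangles -/

/-- The four directions in which an edge can leave a vertex `(x, y)` with `x + y` even, named
after the position of the adjacent cell in the rotated coordinates of `latticePoint`. -/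
inductive Dir
  | sw | nw | se | ne
  deriving DecidableEq

open Dir

/-- The vertex `(x, y)` of the square grid with `x + y = 2 X` and `x - y = 2 Y`. The vertices of
the triangle of this kind are those with `0 ≤ Y ≤ X ≤ 2n - 1`: the diagonal `X = Y` carries the
external edges, the row `Y = 0` is the left boundary and the column `X = 2n - 1` the right one. -/
def latticePoint (X Y : ℕ) : ℤ × ℤ := ((X : ℤ) + Y, (X : ℤ) - Y)

/-- The vector along which an edge of direction `a` leaves a lattice point. -/
def Dir.offset : Dir → ℤ × ℤ
  | sw => (-1, 0)
  | nw => (0, -1)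
  | se => (0, 1)
  | ne => (1, 0)

/-- The cell in row `y` of the strip to the left of column `X` is used by column `X`. -/
def usesLeft (d : ℕ → ℕ → Dir) (X y : ℕ) : Prop := d X y = nw ∨ d X (y + 1) = sw

/-- The cell in row `y` of the strip to the right of column `X` is used by column `X`. -/
def usesRight (d : ℕ → ℕ → Dir) (X y : ℕ) : Prop := d X y = ne ∨ d X (y + 1) = se

theorem usesLeft_of_nw {d : ℕ → ℕ → Dir} {X y : ℕ} (h : d X y = nw) : usesLeft d X y := Or.inl h

theorem usesLeft_of_sw {d : ℕ → ℕ → Dir} {X y : ℕ} (h : d X (y + 1) = sw) : usesLeft d X y :=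
  Or.inr h

/-- `d` assigns to each lattice point one of the adjacent cells (the vertices `(x, y)` with
`x + y` odd) in such a way that each cell is assigned to exactly one lattice point. -/
structure IsDimer (M : ℕ) (d : ℕ → ℕ → Dir) : Prop where
  cell : ∀ X y, y ≤ X → X < M → (usesRight d X y ↔ ¬ usesLeft d (X + 1) y)
  left_excl : ∀ X y, y < X → X ≤ M → ¬ (d X y = nw ∧ d X (y + 1) = sw)
  right_excl : ∀ X y, y ≤ X → X < M → ¬ (d X y = ne ∧ d X (y + 1) = se)

/-- An oriented configuration, seen from the lattice points: `d` is the direction of the outgoing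
edge and `e` that of the incoming edge. Words are Boolean functions, with `true` for the letter
`1`. At a left boundary vertex with letter `1` there is no incoming edge, which is encoded by
`e = sw`, and at a right boundary vertex with letter `0` there is no outgoing edge, which is
encoded by `d = ne`; both directions point out of the triangle there. The external edges are those
of direction `nw` at the points `(X, X)`. -/
structure IsTangle (M : ℕ) (s t p : ℕ → Bool) (d e : ℕ → ℕ → Dir) : Prop where
  out_outside : ∀ X Y, X < Y ∨ M < X → d X Y = ne
  in_outside : ∀ X Y, X < Y ∨ M < X → e X Y = sw
  out_dimer : IsDimer M d
  in_dimer : IsDimer M e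
  disjoint : ∀ X Y, Y ≤ X → X ≤ M → d X Y ≠ e X Y
  out_diag : ∀ X, X ≤ M → (d X X = nw ↔ p X = true)
  in_diag : ∀ X, X ≤ M → (e X X = nw ↔ p X = false)
  out_row : ∀ X, X ≤ M → d X 0 ≠ sw ∧ d X 0 ≠ se ∧ (s X = true → d X 0 = ne)
  in_row : ∀ X, X ≤ M → e X 0 ≠ se ∧ (e X 0 = sw ↔ s X = true)
  out_col : ∀ Y, Y ≤ M → d M Y ≠ se ∧ (d M Y = ne ↔ t Y = false)
  in_col : ∀ Y, Y ≤ M → e M Y ≠ ne ∧ e M Y ≠ se ∧ (t Y = false → e M Y = sw)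

/-- The number of letters `0` among the first `k` letters of a word. -/
def zerosBefore (p : ℕ → Bool) : ℕ → ℕ
  | 0 => 0
  | k + 1 => zerosBefore p k + if p k then 0 else 1

/-- The number of `0`s minus the number of `1`s among the first `k` letters of a word. -/
def wordHeight (p : ℕ → Bool) : ℕ → ℤ
  | 0 => 0
  | k + 1 => wordHeight p k + if p k then -1 else 1

/-- The edge of direction `a` at `(X, Y)` lies in the triangle, or is an external edge. -/
def Dir.IsReal (M X Y : ℕ) (a : Dir) : Prop :=
  Y ≤ X ∧ X ≤ M ∧ (a = ne ∨ a = se → X < M) ∧ (a = sw ∨ a = se → 0 < Y)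

/-- Distinct lattice points are assigned distinct cells. -/
theorem IsDimer.injective {M : ℕ} {d : ℕ → ℕ → Dir} (hd : IsDimer M d) {X Y X' Y' : ℕ}
    (h : (d X Y).IsReal M X Y) (h' : (d X' Y').IsReal M X' Y')
    (heq : latticePoint X Y + (d X Y).offset = latticePoint X' Y' + (d X' Y').offset) :
    X = X' ∧ Y = Y' := by
  obtain ⟨h1, h2, h3, h4⟩ := h
  obtain ⟨h1', h2', h3', h4'⟩ := h'
  have key : ∀ X Y X' Y', Y ≤ X → X ≤ M → (d X Y = ne ∨ d X Y = se → X < M) →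
      (d X Y = sw ∨ d X Y = se → 0 < Y) → Y' ≤ X' → X' ≤ M →
      (d X' Y' = ne ∨ d X' Y' = se → X' < M) → (d X' Y' = sw ∨ d X' Y' = se → 0 < Y') →
      latticePoint X Y + (d X Y).offset = latticePoint X' Y' + (d X' Y').offset →
      (X < X' ∨ (X = X' ∧ Y < Y')) → False := by
    intro X Y X' Y' h1 h2 h3 h4 h1' h2' h3' h4' heq hlt
    rcases ha : d X Y with _ | _ | _ | _ <;> rcases hb : d X' Y' with _ | _ | _ | _ <;>
      simp only [ha, hb, latticePoint, Dir.offset, Prod.ext_iff, Prod.fst_add, Prod.snd_add,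
        reduceCtorEq, or_false, or_true, false_imp_iff, true_imp_iff]
        at heq h3 h4 h3' h4' <;> try omega
    all_goals first
      | (obtain rfl : X = X' := by omega
         obtain rfl : Y' = Y + 1 := by omega
         first
          | exact hd.left_excl X Y (by omega) h2 ⟨ha, hb⟩
          | exact hd.right_excl X Y (by omega) h3 ⟨ha, hb⟩)
      | (obtain rfl : X' = X + 1 := by omega
         first
          | (obtain rfl : Y = Y' := by omega
             exact (hd.cell X Y h1 h3).1 (Or.inl ha) (Or.inl hb))
          | (obtain rfl : Y' = Y + 1 := by omega
             exact (hd.cell X Y h1 h3).1 (Or.inl ha) (Or.inr hb))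
          | (obtain ⟨y, rfl⟩ : ∃ y, Y = y + 1 := ⟨Y - 1, by omega⟩
             obtain rfl : Y' = y := by omega
             exact (hd.cell X Y' (by omega) h3).1 (Or.inr ha) (Or.inl hb))
          | (obtain ⟨y, rfl⟩ : ∃ y, Y = y + 1 := ⟨Y - 1, by omega⟩
             obtain rfl : Y' = y + 1 := by omega
             exact (hd.cell X y (by omega) h3).1 (Or.inr ha) (Or.inr hb)))
  rcases lt_trichotomy X X' with h | h | h
  · exact (key X Y X' Y' h1 h2 h3 h4 h1' h2' h3' h4' heq (Or.inl h)).elim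
  · rcases lt_trichotomy Y Y' with h5 | h5 | h5
    · exact (key X Y X' Y' h1 h2 h3 h4 h1' h2' h3' h4' heq (Or.inr ⟨h, h5⟩)).elim
    · exact ⟨h, h5⟩
    · exact (key X' Y' X Y h1' h2' h3' h4' h1 h2 h3 h4 heq.symm (Or.inr ⟨h.symm, h5⟩)).elim
  · exact (key X' Y' X Y h1' h2' h3' h4' h1 h2 h3 h4 heq.symm (Or.inl h)).elim

/-- Each cell is assigned to some lattice point. -/
theorem IsDimer.exists_point {M : ℕ} {d : ℕ → ℕ → Dir} (hd : IsDimer M d)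
    (hout : ∀ X, d X (X + 1) ≠ se) {S y : ℕ} (hy : y < S) (hS : S ≤ M) :
    ∃ X Y, (d X Y).IsReal M X Y ∧
      latticePoint X Y + (d X Y).offset = ((S : ℤ) + y, (S : ℤ) - 1 - y) := by
  obtain ⟨X, rfl⟩ : ∃ X, S = X + 1 := ⟨S - 1, by omega⟩
  have h := hd.cell X y (by omega) (by omega)
  by_cases hl : usesLeft d (X + 1) y
  · rcases hl with hl | hl
    · refine ⟨X + 1, y, ⟨by omega, hS, by simp [hl], by simp [hl]⟩, ?_⟩
      simp only [hl, latticePoint, Dir.offset, Prod.ext_iff, Prod.fst_add, Prod.snd_add]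
      push_cast; omega
    · refine ⟨X + 1, y + 1, ⟨by omega, hS, by simp [hl], by simp⟩, ?_⟩
      simp only [hl, latticePoint, Dir.offset, Prod.ext_iff, Prod.fst_add, Prod.snd_add]
      push_cast; omega
  · rcases h.2 hl with hr | hr
    · refine ⟨X, y, ⟨by omega, by omega, fun _ => by omega, by simp [hr]⟩, ?_⟩
      simp only [hr, latticePoint, Dir.offset, Prod.ext_iff, Prod.fst_add, Prod.snd_add]
      push_cast; omega
    · have : y ≠ X := by rintro rfl; exact hout _ hr
      refine ⟨X, y + 1, ⟨by omega, by omega, fun _ => by omega, by simp⟩, ?_⟩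
      simp only [hr, latticePoint, Dir.offset, Prod.ext_iff, Prod.fst_add, Prod.snd_add]
      push_cast; omega

/-! ### Words and matchings -/

/-- The Dyck condition for a word of length `N`, in terms of heights. -/
def IsBallot (p : ℕ → Bool) (N : ℕ) : Prop :=
  wordHeight p N = 0 ∧ ∀ k ≤ N, 0 ≤ wordHeight p k

/-- The letters `i` and `j` are an opening letter and the closing letter matched with it. -/
def Matched (p : ℕ → Bool) (i j : ℕ) : Prop :=
  i < j ∧ p i = false ∧ p j = true ∧ wordHeight p (i + 1) = wordHeight p j ∧
    ∀ k, i + 1 ≤ k → k ≤ j → wordHeight p (i + 1) ≤ wordHeight p k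

theorem wordHeight_succ_of_one {p : ℕ → Bool} {k : ℕ} (h : p k = true) :
    wordHeight p (k + 1) = wordHeight p k - 1 := by
  simp [wordHeight, h]; ring

theorem wordHeight_succ_of_zero {p : ℕ → Bool} {k : ℕ} (h : p k = false) :
    wordHeight p (k + 1) = wordHeight p k + 1 := by
  simp [wordHeight, h]

theorem wordHeight_eq (p : ℕ → Bool) (k : ℕ) :
    wordHeight p k = 2 * (zerosBefore p k : ℤ) - k := by
  induction k with
  | zero => simp [wordHeight, zerosBefore]
  | succ k ih =>
    cases h : p k <;> simp [wordHeight, zerosBefore, h, ih] <;> ring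

/-- The matching opening letter is found at the last place before `j` where the height was smaller.
-/
theorem exists_matched_of_one {p : ℕ → Bool} {N j : ℕ} (hp : IsBallot p N) (hj : j < N)
    (hpj : p j = true) : ∃ i, Matched p i j := by
  have h1 := wordHeight_succ_of_one hpj
  have h2 := hp.2 (j + 1) (by omega)
  set i := Nat.findGreatest (fun k => wordHeight p k < wordHeight p j) j with hi
  have h0 : wordHeight p 0 < wordHeight p j := by simp only [wordHeight]; omega
  have hi1 : wordHeight p i < wordHeight p j :=
    Nat.findGreatest_spec (P := fun k => wordHeight p k < wordHeight p j) (Nat.zero_le j) h0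
  have hij : i ≤ j := Nat.findGreatest_le j
  have hi2 : ∀ k, i < k → k ≤ j → wordHeight p j ≤ wordHeight p k := fun k h h' =>
    not_lt.1 (Nat.findGreatest_is_greatest h h')
  have hne : i ≠ j := by
    intro h
    rw [h] at hi1
    omega
  have h3 := hi2 (i + 1) (by omega) (by omega)
  cases hpi : p i with
  | true =>
    have := wordHeight_succ_of_one hpi
    omega
  | false =>
    have h4 := wordHeight_succ_of_zero hpi
    exact ⟨i, by omega, hpi, hpj, by omega, fun k hk hk' => by
      have := hi2 k (by omega) hk'; omega⟩

theorem exists_matched_of_zero {p : ℕ → Bool} {N i : ℕ} (hp : IsBallot p N) (hi : i < N)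
    (hpi : p i = false) : ∃ j < N, Matched p i j := by
  have h1 := wordHeight_succ_of_zero hpi
  have h2 := hp.2 i (by omega)
  have hex : ∃ k, i + 1 ≤ k ∧ wordHeight p k < wordHeight p (i + 1) :=
    ⟨N, by omega, by rw [hp.1]; omega⟩
  classical
  obtain ⟨h3, h4⟩ := Nat.find_spec hex
  have h5 : ∀ k, i + 1 ≤ k → k < Nat.find hex → wordHeight p (i + 1) ≤ wordHeight p k :=
    fun k hk hk' => by
      by_contra hlt
      exact Nat.find_min hex hk' ⟨hk, by omega⟩
  have h6 : Nat.find hex ≤ N := Nat.find_min' hex ⟨by omega, by rw [hp.1]; omega⟩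
  have h7 : Nat.find hex ≠ i + 1 := by
    intro h
    rw [h] at h4
    omega
  obtain ⟨j, hj⟩ : ∃ j, Nat.find hex = j + 1 := ⟨Nat.find hex - 1, by omega⟩
  rw [hj] at h3 h4 h5 h6 h7
  have h8 := h5 j (by omega) (by omega)
  cases hpj : p j with
  | false =>
    have := wordHeight_succ_of_zero hpj
    omega
  | true =>
    have h9 := wordHeight_succ_of_one hpj
    exact ⟨j, by omega, by omega, hpi, hpj, by omega, fun k hk hk' => h5 k hk (by omega)⟩

/-! ### The level of a strand -/

section Level

open Classical in
/-- The indicator of a proposition, as an integer. -/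
noncomputable def ind (P : Prop) : ℤ := if P then 1 else 0

theorem ind_true {P : Prop} (h : P) : ind P = 1 := by simp [ind, h]

theorem ind_false {P : Prop} (h : ¬ P) : ind P = 0 := by simp [ind, h]

/-- Whether a direction leads to a cell of smaller `Y` coordinate. -/
def Dir.down : Dir → ℤ
  | sw => 1
  | se => 1
  | nw => 0
  | ne => 0

variable {M : ℕ} {s t p : ℕ → Bool} {d e : ℕ → ℕ → Dir}

/-- The height of the face between the points `(X - 1, Y)` and `(X, Y)`. The faces below the
triangle have the heights of the word `p`, and crossing a strand changes the height by one;
so the cells of the strip to the left of column `X` that lie beyond row `Y` are counted, with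
a sign for the direction in which they are traversed. -/
noncomputable def faceHeight (p : ℕ → Bool) (d e : ℕ → ℕ → Dir) (X Y : ℕ) : ℤ :=
  wordHeight p X - ∑ y ∈ Finset.Ico Y X, (ind (usesLeft e X y) - ind (usesLeft d X y))

theorem IsDimer.ind_usesLeft_succ (hd : IsDimer M d) {X Y : ℕ} (hY : Y < X) (hX : X < M) :
    ind (usesLeft d (X + 1) Y) - ind (usesLeft d X Y) = (d X Y).down - (d X (Y + 1)).down := by
  have h1 := hd.cell X Y hY.le hX
  have h2 := hd.left_excl X Y hY hX.le
  have h3 := hd.right_excl X Y hY.le hX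
  have h4 : ind (usesLeft d (X + 1) Y) = 1 - ind (usesRight d X Y) := by
    by_cases h : usesLeft d (X + 1) Y
    · rw [ind_true h, ind_false (fun h' => h1.1 h' h)]; rfl
    · rw [ind_false h, ind_true (h1.2 h)]; rfl
  rw [h4]
  rcases ha : d X Y with _ | _ | _ | _ <;> rcases hb : d X (Y + 1) with _ | _ | _ | _ <;>
    simp_all [usesLeft, usesRight, ind, Dir.down]

theorem faceHeight_row (X Y : ℕ) (hY : Y < X) :
    faceHeight p d e X Y =
      faceHeight p d e X (Y + 1) - (ind (usesLeft e X Y) - ind (usesLeft d X Y)) := by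
  simp only [faceHeight]
  rw [Finset.sum_eq_sum_Ico_succ_bot hY]
  ring

theorem faceHeight_diag (X : ℕ) : faceHeight p d e X X = wordHeight p X := by
  simp [faceHeight]

theorem IsTangle.faceHeight_succ (h : IsTangle M s t p d e) {X Y : ℕ} (hY : Y ≤ X)
    (hX : X < M) :
    faceHeight p d e (X + 1) Y = faceHeight p d e X Y - (e X Y).down + (d X Y).down := by
  obtain ⟨k, hk⟩ : ∃ k, Y + k = X := ⟨X - Y, by omega⟩
  induction k generalizing Y with
  | zero =>
    obtain rfl : Y = X := by omega
    rw [faceHeight_diag, faceHeight_row _ _ (Nat.lt_succ_self Y), faceHeight_diag]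
    have h1 := h.out_dimer.cell Y Y le_rfl hX
    have h2 := h.in_dimer.cell Y Y le_rfl hX
    have h3 := h.out_diag Y hX.le
    have h4 := h.in_diag Y hX.le
    have h5 := h.out_outside Y (Y + 1) (Or.inl (Nat.lt_succ_self Y))
    have h6 := h.in_outside Y (Y + 1) (Or.inl (Nat.lt_succ_self Y))
    simp only [usesRight, h5, h6, reduceCtorEq, or_false] at h1 h2
    have h7 : ind (usesLeft d (Y + 1) Y) = if d Y Y = ne then 0 else 1 := by
      split_ifs with hh
      · exact ind_false (h1.1 hh)
      · exact ind_true (not_not.1 fun h' => hh (h1.2 h'))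
    have h8 : ind (usesLeft e (Y + 1) Y) = if e Y Y = ne then 0 else 1 := by
      split_ifs with hh
      · exact ind_false (h2.1 hh)
      · exact ind_true (not_not.1 fun h' => hh (h2.2 h'))
    have h9 := h.disjoint Y Y le_rfl hX.le
    rw [h7, h8]
    cases hp : p Y <;> rcases ha : d Y Y with _ | _ | _ | _ <;>
      rcases hb : e Y Y with _ | _ | _ | _ <;>
      simp_all [wordHeight, Dir.down] <;> ring
  | succ k ih =>
    have ih := ih (Y := Y + 1) (by omega) (by omega)
    have h1 := h.out_dimer.ind_usesLeft_succ (show Y < X by omega) hX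
    have h2 := h.in_dimer.ind_usesLeft_succ (show Y < X by omega) hX
    rw [faceHeight_row X Y (by omega), faceHeight_row (X + 1) Y (by omega), ih]
    linarith

/-- The level of the strand through `(X, Y)`, read off the incoming edge: the height of the face
on the side of the external edges. -/
noncomputable def inLevel (p : ℕ → Bool) (d e : ℕ → ℕ → Dir) (X Y : ℕ) : ℤ :=
  match e X Y with
  | sw => faceHeight p d e X Y
  | nw => faceHeight p d e X Y + 1
  | ne => faceHeight p d e (X + 1) Y
  | se => faceHeight p d e (X + 1) Y + 1

/-- The level of the strand through `(X, Y)`, read off the outgoing edge. -/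
noncomputable def outLevel (p : ℕ → Bool) (d e : ℕ → ℕ → Dir) (X Y : ℕ) : ℤ :=
  match d X Y with
  | nw => faceHeight p d e X Y
  | sw => faceHeight p d e X Y + 1
  | se => faceHeight p d e (X + 1) Y
  | ne => faceHeight p d e (X + 1) Y + 1

/-- The two edges of a strand at a lattice point give the same level. -/
theorem IsTangle.inLevel_eq_outLevel (h : IsTangle M s t p d e) {X Y : ℕ} (hY : Y ≤ X)
    (hX : X ≤ M) (hne : X = M → d X Y ≠ ne) : inLevel p d e X Y = outLevel p d e X Y := by
  have h1 := h.disjoint X Y hY hX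
  rcases hX.lt_or_eq with hX' | rfl
  · have h2 := h.faceHeight_succ hY hX'
    rcases ha : d X Y with _ | _ | _ | _ <;> rcases hb : e X Y with _ | _ | _ | _ <;>
      simp_all [inLevel, outLevel, Dir.down]
  · have h2 := hne rfl
    have h3 := (h.out_col Y hY).1
    have h4 := h.in_col Y hY
    rcases ha : d X Y with _ | _ | _ | _ <;> rcases hb : e X Y with _ | _ | _ | _ <;>
      simp_all [inLevel, outLevel]

/-- One step along a strand: the cell entered from the point `P` is left to the point `Q`. -/
def TangleStep (M : ℕ) (d e : ℕ → ℕ → Dir) (P Q : ℕ × ℕ) : Prop :=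
  (d P.1 P.2).IsReal M P.1 P.2 ∧ (e Q.1 Q.2).IsReal M Q.1 Q.2 ∧
    latticePoint P.1 P.2 + (d P.1 P.2).offset = latticePoint Q.1 Q.2 + (e Q.1 Q.2).offset

theorem TangleStep.left_unique (h : IsTangle M s t p d e) {P P' Q : ℕ × ℕ}
    (h1 : TangleStep M d e P Q) (h2 : TangleStep M d e P' Q) : P = P' := by
  obtain ⟨h3, h4⟩ := h.out_dimer.injective h1.1 h2.1 (h1.2.2.trans h2.2.2.symm)
  exact Prod.ext h3 h4

/-- The edge into a cell and the edge out of it give the same level. -/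
theorem TangleStep.outLevel_eq (h : IsTangle M s t p d e) {P Q : ℕ × ℕ}
    (hs : TangleStep M d e P Q) : outLevel p d e P.1 P.2 = inLevel p d e Q.1 Q.2 := by
  obtain ⟨X, Y⟩ := P
  obtain ⟨X', Y'⟩ := Q
  obtain ⟨⟨h1, h2, h3, h4⟩, ⟨h1', h2', h3', h4'⟩, heq⟩ := hs
  have hdis := h.disjoint X Y h1 h2
  simp only at *
  have hrow := faceHeight_row (p := p) (d := d) (e := e)
  have hdc := h.out_dimer.cell
  have hec := h.in_dimer.cell
  rcases ha : d X Y with _ | _ | _ | _ <;> rcases hb : e X' Y' with _ | _ | _ | _ <;>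
    simp only [ha, hb, latticePoint, Dir.offset, Prod.ext_iff, Prod.fst_add, Prod.snd_add,
      reduceCtorEq, or_false, or_true, false_imp_iff, true_imp_iff, outLevel, inLevel]
      at heq h3 h4 h3' h4' ⊢
  -- outgoing `sw`: the cell lies in the strip left of column `X`, in row `Y - 1`
  · obtain rfl : X = X' := by omega
    obtain rfl : Y = Y' := by omega
    exact absurd (ha.trans hb.symm) hdis
  · obtain rfl : X = X' := by omega
    obtain rfl : Y = Y' + 1 := by omega
    rw [hrow X Y' (by omega), ind_true (usesLeft_of_nw hb), ind_true (usesLeft_of_sw ha)]; ring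
  · obtain rfl : X = X' + 1 := by omega
    obtain rfl : Y = Y' := by omega
    rfl
  · obtain rfl : X = X' + 1 := by omega
    obtain rfl : Y = Y' + 1 := by omega
    rw [hrow (X' + 1) Y' (by omega), ind_true (usesLeft_of_sw ha),
      ind_false ((hec X' Y' (by omega) (by omega)).1 (Or.inl hb))]; ring
  -- outgoing `nw`: the strip left of column `X`, row `Y`
  · obtain rfl : X = X' := by omega
    obtain rfl : Y' = Y + 1 := by omega
    rw [hrow X Y (by omega), ind_true (usesLeft_of_nw ha), ind_true (usesLeft_of_sw hb)]; ring
  · obtain rfl : X = X' := by omega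
    obtain rfl : Y = Y' := by omega
    exact absurd (ha.trans hb.symm) hdis
  · obtain rfl : X = X' + 1 := by omega
    obtain rfl : Y' = Y + 1 := by omega
    rw [hrow (X' + 1) Y (by omega), ind_true (usesLeft_of_nw ha),
      ind_false ((hec X' Y (by omega) (by omega)).1 (Or.inr hb))]; ring
  · obtain rfl : X = X' + 1 := by omega
    obtain rfl : Y = Y' := by omega
    rfl
  -- outgoing `se`: the strip right of column `X`, row `Y - 1`
  · obtain rfl : X' = X + 1 := by omega
    obtain rfl : Y = Y' := by omega
    rfl
  · obtain rfl : X' = X + 1 := by omega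
    obtain rfl : Y = Y' + 1 := by omega
    rw [hrow (X + 1) Y' (by omega), ind_true (usesLeft_of_nw hb),
      ind_false ((hdc X Y' (by omega) (by omega)).1 (Or.inr ha))]; ring
  · obtain rfl : X = X' := by omega
    obtain rfl : Y = Y' := by omega
    exact absurd (ha.trans hb.symm) hdis
  · obtain rfl : X = X' := by omega
    obtain rfl : Y = Y' + 1 := by omega
    rw [hrow (X + 1) Y' (by omega),
      ind_false ((hdc X Y' (by omega) (by omega)).1 (Or.inr ha)),
      ind_false ((hec X Y' (by omega) (by omega)).1 (Or.inl hb))]; ring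
  -- outgoing `ne`: the strip right of column `X`, row `Y`
  · obtain rfl : X' = X + 1 := by omega
    obtain rfl : Y' = Y + 1 := by omega
    rw [hrow (X + 1) Y (by omega), ind_true (usesLeft_of_sw hb),
      ind_false ((hdc X Y (by omega) (by omega)).1 (Or.inl ha))]; ring
  · obtain rfl : X' = X + 1 := by omega
    obtain rfl : Y = Y' := by omega
    rfl
  · obtain rfl : X = X' := by omega
    obtain rfl : Y' = Y + 1 := by omega
    rw [hrow (X + 1) Y (by omega),
      ind_false ((hdc X Y (by omega) (by omega)).1 (Or.inl ha)),
      ind_false ((hec X Y (by omega) (by omega)).1 (Or.inr hb))]; ring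
  · obtain rfl : X = X' := by omega
    obtain rfl : Y = Y' := by omega
    exact absurd (ha.trans hb.symm) hdis

/-- The level does not change along a strand. -/
theorem IsTangle.inLevel_eq (h : IsTangle M s t p d e) {P Q : ℕ × ℕ}
    (hs : Relation.ReflTransGen (TangleStep M d e) P Q) :
    inLevel p d e P.1 P.2 = inLevel p d e Q.1 Q.2 := by
  induction hs with
  | refl => rfl
  | @tail Q R _ hQR ih =>
    rw [ih, ← hQR.outLevel_eq h]
    refine h.inLevel_eq_outLevel hQR.1.1 hQR.1.2.1 fun hM hne => ?_
    have := hQR.1.2.2.1 (Or.inl hne)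
    omega

/-- The height of the faces along the left boundary starts at `0` and drops by one at each letter
`1` of `s`. -/
theorem IsTangle.faceHeight_zero_nonpos (h : IsTangle M s t p d e) {X : ℕ} (hX : X ≤ M) :
    faceHeight p d e X 0 ≤ 0 := by
  induction X with
  | zero => simp [faceHeight, wordHeight]
  | succ X ih =>
    have h1 := ih (by omega)
    rw [h.faceHeight_succ (Nat.zero_le X) (by omega)]
    have h2 := h.out_row X (by omega)
    rcases ha : d X 0 with _ | _ | _ | _ <;> rcases hb : e X 0 with _ | _ | _ | _ <;>
      simp_all [Dir.down] <;> omega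

end Level

/-! ### Following the strands -/

/-- An injective relation on a finite set, followed from a point without predecessor, reaches a
point without successor. -/
theorem exists_terminal {α : Type*} {r : α → α → Prop} {S : Set α} (hS : S.Finite)
    (hr : ∀ a b c, r a c → r b c → a = b) (hclosed : ∀ a b, r a b → b ∈ S) {a : α} (ha : a ∈ S)
    (hpre : ∀ b, ¬ r b a) : ∃ b ∈ S, ReflTransGen r a b ∧ ∀ c, ¬ r b c := by
  by_contra hcon
  push Not at hcon
  have hstep : ∀ b : {b // b ∈ S ∧ ReflTransGen r a b}, ∃ c : {b // b ∈ S ∧ ReflTransGen r a b},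
      r b c := by
    rintro ⟨b, hb, hab⟩
    obtain ⟨c, hc⟩ := hcon b hb hab
    exact ⟨⟨c, hclosed _ _ hc, hab.tail hc⟩, hc⟩
  choose g hg using hstep
  let x : ℕ → {b // b ∈ S ∧ ReflTransGen r a b} := fun k => g^[k] ⟨a, ha, .refl⟩
  have hx : ∀ k, r (x k) (x (k + 1)) := fun k => by
    simp only [x, Function.iterate_succ_apply']
    exact hg _
  have key : ∀ i k, (x i : α) = x (i + k + 1) → False := by
    intro i
    induction i with
    | zero =>
      intro k h
      apply hpre (x (0 + k))
      have := hx (0 + k)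
      rw [← h] at this
      exact this
    | succ i ih =>
      intro k h
      refine ih k (hr _ _ _ (hx i) ?_)
      rw [h]
      have := hx (i + k + 1)
      rwa [show i + 1 + k + 1 = i + k + 1 + 1 by ring]
  have hfin : Finite S := hS
  obtain ⟨i, j, hij, h⟩ := Finite.exists_ne_map_eq_of_infinite (fun k : ℕ => (⟨x k, (x k).2.1⟩ : S))
  have h' : (x i : α) = x j := by simpa using congrArg Subtype.val h
  rcases Nat.lt_or_gt_of_ne hij with hlt | hlt
  · exact key i (j - i - 1) (by rw [show i + (j - i - 1) + 1 = j by omega]; exact h')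
  · exact key j (i - j - 1) (by rw [show j + (i - j - 1) + 1 = i by omega]; exact h'.symm)

section Connect

variable {M : ℕ} {s t p : ℕ → Bool} {d e : ℕ → ℕ → Dir}

theorem IsTangle.out_isReal (h : IsTangle M s t p d e) {X Y : ℕ} (hY : Y ≤ X) (hX : X ≤ M)
    (hne : X = M → d X Y ≠ ne) : (d X Y).IsReal M X Y := by
  refine ⟨hY, hX, ?_, ?_⟩
  · rintro (h1 | h1)
    · by_contra h2
      exact hne (by omega) h1
    · by_contra h2
      obtain rfl : X = M := by omega
      exact (h.out_col Y hY).1 h1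
  · rintro (h1 | h1) <;> by_contra h2
    · obtain rfl : Y = 0 := by omega
      exact (h.out_row X hX).1 h1
    · obtain rfl : Y = 0 := by omega
      exact (h.out_row X hX).2.1 h1

/-- A strand can only end at an external edge with letter `1`, or at a right boundary vertex with
letter `0`. -/
theorem IsTangle.terminal (h : IsTangle M s t p d e) {P : ℕ × ℕ} (hY : P.2 ≤ P.1) (hX : P.1 ≤ M)
    (hP : ∀ Q, ¬ TangleStep M d e P Q) :
    (P.1 = P.2 ∧ p P.1 = true) ∨ (P.1 = M ∧ t P.2 = false) := by
  obtain ⟨X, Y⟩ := P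
  simp only at *
  by_contra hcon
  push Not at hcon
  obtain ⟨h1, h2⟩ := hcon
  have hne : X = M → d X Y ≠ ne := by
    rintro rfl h3
    exact h2 rfl ((h.out_col Y hY).2.1 h3)
  have hreal := h.out_isReal hY hX hne
  have hse : ∀ X, e X (X + 1) ≠ se := fun X => by rw [h.in_outside X (X + 1) (by simp)]; simp
  have hfin : ∀ S y : ℕ, y < S → S ≤ M →
      latticePoint X Y + (d X Y).offset = ((S : ℤ) + y, (S : ℤ) - 1 - y) → False := by
    intro S y hy hS heq
    obtain ⟨X', Y', hr, heq'⟩ := h.in_dimer.exists_point hse hy hS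
    exact hP (X', Y') ⟨hreal, hr, by rw [heq, heq']⟩
  obtain ⟨-, -, h3, h4⟩ := hreal
  rcases ha : d X Y with _ | _ | _ | _ <;>
    simp only [ha, reduceCtorEq, or_false, or_true, false_imp_iff, true_imp_iff] at h3 h4
  · refine hfin X (Y - 1) (by omega) hX ?_
    simp only [ha, latticePoint, Dir.offset, Prod.ext_iff, Prod.fst_add, Prod.snd_add]
    omega
  · refine hfin X Y (lt_of_le_of_ne hY ?_) hX ?_
    · rintro rfl
      exact h1 rfl ((h.out_diag Y hX).1 ha)
    · simp only [ha, latticePoint, Dir.offset, Prod.ext_iff, Prod.fst_add, Prod.snd_add]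
      omega
  · refine hfin (X + 1) (Y - 1) (by omega) (by omega) ?_
    simp only [ha, latticePoint, Dir.offset, Prod.ext_iff, Prod.fst_add, Prod.snd_add]
    omega
  · refine hfin (X + 1) Y (by omega) (by omega) ?_
    simp only [ha, latticePoint, Dir.offset, Prod.ext_iff, Prod.fst_add, Prod.snd_add]
    omega

/-- The strand of an external edge with letter `0` starts there. -/
theorem IsTangle.no_pred_diag (h : IsTangle M s t p d e) {i : ℕ} (hi : i ≤ M)
    (hp : p i = false) (Q : ℕ × ℕ) : ¬ TangleStep M d e Q (i, i) := by
  rintro ⟨⟨h1, h2, h3, h4⟩, -, heq⟩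
  obtain ⟨X, Y⟩ := Q
  have he := (h.in_diag i hi).2 hp
  have hdis := h.disjoint i i le_rfl hi
  simp only at *
  rcases ha : d X Y with _ | _ | _ | _ <;>
    simp only [ha, he, latticePoint, Dir.offset, Prod.ext_iff, Prod.fst_add, Prod.snd_add,
      reduceCtorEq, or_false, or_true, false_imp_iff, true_imp_iff] at h3 h4 heq <;> try omega
  obtain rfl : X = i := by omega
  obtain rfl : Y = X := by omega
  exact hdis (ha.trans he.symm)

theorem IsTangle.no_pred_row (h : IsTangle M s t p d e) {i : ℕ} (hi : i ≤ M)
    (hs : s i = true) (Q : ℕ × ℕ) : ¬ TangleStep M d e Q (i, 0) := by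
  rintro ⟨-, h1, -⟩
  have := h1.2.2.2 (Or.inl ((h.in_row i hi).2.2 hs))
  simp at this

theorem IsTangle.exists_end (h : IsTangle M s t p d e) {P : ℕ × ℕ} (hY : P.2 ≤ P.1) (hX : P.1 ≤ M)
    (hP : ∀ Q, ¬ TangleStep M d e Q P) :
    ∃ Q : ℕ × ℕ, Q.2 ≤ Q.1 ∧ Q.1 ≤ M ∧ ReflTransGen (TangleStep M d e) P Q ∧
      ((Q.1 = Q.2 ∧ p Q.1 = true) ∨ (Q.1 = M ∧ t Q.2 = false)) := by
  have hfin : {Q : ℕ × ℕ | Q.2 ≤ Q.1 ∧ Q.1 ≤ M}.Finite := by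
    refine ((Set.finite_Iic M).prod (Set.finite_Iic M)).subset ?_
    rintro ⟨a, b⟩ ⟨h1, h2⟩
    simp only [Set.mem_prod, Set.mem_Iic] at *
    omega
  obtain ⟨Q, hQ, hPQ, hter⟩ := exists_terminal (r := TangleStep M d e) hfin
    (fun a b c h1 h2 => h1.left_unique h h2) (fun a b hab => ⟨hab.2.1.1, hab.2.1.2.1⟩)
    (a := P) ⟨hY, hX⟩ hP
  exact ⟨Q, hQ.1, hQ.2, hPQ, h.terminal hQ.1 hQ.2 hter⟩

/-- The level of a strand that ends at a right boundary vertex is not positive. -/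
theorem IsTangle.inLevel_right_nonpos (h : IsTangle M s t p d e) (hp : IsBallot p (M + 1))
    (hpM : p M = true) {Y : ℕ} (hY : Y ≤ M) (ht : t Y = false) : inLevel p d e M Y ≤ 0 := by
  have he : ∀ k, k ≤ M → e M (M - k) = sw := by
    intro k hk
    have hcol := h.in_col (M - k) (by omega)
    induction k with
    | zero =>
      have h1 := h.in_diag M le_rfl
      simp only [Nat.sub_zero] at *
      rcases ha : e M M with _ | _ | _ | _ <;> simp_all
    | succ k ih =>
      have h1 := ih (by omega) (h.in_col (M - k) (by omega))
      have h2 := h.in_dimer.left_excl M (M - (k + 1)) (by omega) le_rfl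
      rw [show M - (k + 1) + 1 = M - k by omega] at h2
      rcases ha : e M (M - (k + 1)) with _ | _ | _ | _ <;> simp_all
  have he' : ∀ y, y ≤ M → e M y = sw := fun y hy => by
    have := he (M - y) (by omega)
    rwa [show M - (M - y) = y by omega] at this
  have hne := (h.out_col Y hY).2.2 ht
  have hYM : Y < M := by
    rcases hY.lt_or_eq with h1 | rfl
    · exact h1
    · have := (h.out_diag Y le_rfl).2 hpM
      rw [hne] at this
      cases this
  have hH : wordHeight p M = 1 := by
    have := hp.1
    rw [wordHeight_succ_of_one hpM] at this
    omega
  simp only [inLevel, he' Y hY, faceHeight, hH]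
  have hsum : ind (usesLeft e M Y) - ind (usesLeft d M Y) ≤
      ∑ y ∈ Finset.Ico Y M, (ind (usesLeft e M y) - ind (usesLeft d M y)) := by
    refine Finset.single_le_sum (f := fun y => ind (usesLeft e M y) - ind (usesLeft d M y)) ?_
      (Finset.mem_Ico.2 ⟨le_rfl, hYM⟩)
    intro y hy
    have := Finset.mem_Ico.1 hy
    rw [ind_true (usesLeft_of_sw (he' (y + 1) (by omega)))]
    by_cases hh : usesLeft d M y
    · rw [ind_true hh]; rfl
    · rw [ind_false hh]; norm_num
  rw [ind_true (usesLeft_of_sw (he' (Y + 1) (by omega))), ind_false] at hsum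
  · omega
  · rintro (h1 | h1)
    · rw [hne] at h1; cases h1
    · exact h.disjoint M (Y + 1) (by omega) le_rfl (h1.trans (he' (Y + 1) (by omega)).symm)

theorem IsTangle.inLevel_start (h : IsTangle M s t p d e) {i : ℕ} (hi : i ≤ M)
    (hp : p i = false) : inLevel p d e i i = wordHeight p (i + 1) := by
  simp only [inLevel, (h.in_diag i hi).2 hp, faceHeight_diag, wordHeight_succ_of_zero hp]

theorem IsTangle.inLevel_end (h : IsTangle M s t p d e) {i : ℕ} (hi : i ≤ M)
    (hp : p i = true) : inLevel p d e i i = wordHeight p i := by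
  have h1 := (h.out_diag i hi).2 hp
  rw [h.inLevel_eq_outLevel le_rfl hi (by simp [h1])]
  simp only [outLevel, h1, faceHeight_diag]

theorem IsTangle.reflTransGen_left_unique (h : IsTangle M s t p d e) {P P' Q : ℕ × ℕ}
    (h1 : ReflTransGen (TangleStep M d e) P Q) (h2 : ReflTransGen (TangleStep M d e) P' Q)
    (hP : ∀ R, ¬ TangleStep M d e R P) (hP' : ∀ R, ¬ TangleStep M d e R P') : P = P' :=
  reflTransGen_eq_of_terminal (r := Function.swap (TangleStep M d e))
    (fun _ _ _ h1 h2 => TangleStep.left_unique h h1 h2) (reflTransGen_swap.2 h1)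
    (reflTransGen_swap.2 h2) hP hP'

/-- No strand leads from an external edge to an external edge further left. -/
def NoReturn (M : ℕ) (p : ℕ → Bool) (d e : ℕ → ℕ → Dir) : Prop :=
  ∀ i j, i ≤ M → j ≤ M → p i = false → p j = true →
    ReflTransGen (TangleStep M d e) (i, i) (j, j) → i < j

/-- If no strand leads from an external edge to an external edge further left, then the strands
realize the noncrossing matching: by levels, each strand ends at a letter of the right height, and
the first such letter to the right is the matched one; later ones are taken by other strands. -/
theorem IsTangle.reaches_matched (h : IsTangle M s t p d e) (hp : IsBallot p (M + 1))
    (hpM : p M = true)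
    (hmono : NoReturn M p d e) {i j : ℕ} (hj : j ≤ M)
    (hij : Matched p i j) : ReflTransGen (TangleStep M d e) (i, i) (j, j) := by
  obtain ⟨k, hk⟩ : ∃ k, i + k = M := ⟨M - i, by have := hij.1; omega⟩
  induction k using Nat.strong_induction_on generalizing i j with
  | _ k ih =>
    obtain ⟨h1, h2, h3, h4, h5⟩ := hij
    obtain ⟨⟨a, b⟩, hQ1, hQ2, hPQ, hend⟩ :=
      h.exists_end (P := (i, i)) le_rfl (by simp only; omega) (h.no_pred_diag (by omega) h2)
    have hlev := h.inLevel_eq hPQ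
    simp only at hQ1 hQ2 hlev hend
    rw [h.inLevel_start (by omega) h2] at hlev
    have hpos : 1 ≤ wordHeight p (i + 1) := by
      have := hp.2 i (by omega)
      rw [wordHeight_succ_of_zero h2]; omega
    rcases hend with ⟨rfl, hpa⟩ | ⟨rfl, ht⟩
    · have hia := hmono i a (by omega) hQ2 h2 hpa hPQ
      rw [h.inLevel_end hQ2 hpa] at hlev
      rcases lt_trichotomy a j with haj | rfl | haj
      · have h6 := wordHeight_succ_of_one hpa
        have h7 := h5 (a + 1) (by omega) (by omega)
        omega
      · exact hPQ
      · obtain ⟨i', h6⟩ := exists_matched_of_one hp (by omega) hpa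
        have h8 := wordHeight_succ_of_one h3
        have h9 : j < i' := by
          by_contra hcon
          have := h6.2.2.2.2 (j + 1) (by omega) (by omega)
          have := h6.2.2.2.1
          omega
        have h10 := ih (M - i') (by omega) hQ2 h6 (by have := h6.1; omega)
        have h11 := h.reflTransGen_left_unique hPQ h10 (h.no_pred_diag (by omega) h2)
          (h.no_pred_diag (by have := h6.1; omega) h6.2.1)
        have := congrArg Prod.fst h11
        simp only at this
        omega
    · have := h.inLevel_right_nonpos hp hpM hQ1 ht
      omega

/-- A strand that starts at the left boundary ends at the right boundary. -/
theorem IsTangle.reaches_right (h : IsTangle M s t p d e) (hp : IsBallot p (M + 1))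
    {i : ℕ} (hi : i ≤ M) (hs : s i = true) :
    ∃ j ≤ M, t j = false ∧ ReflTransGen (TangleStep M d e) (i, 0) (M, j) := by
  obtain ⟨⟨a, b⟩, hQ1, hQ2, hPQ, hend⟩ :=
    h.exists_end (P := (i, 0)) (Nat.zero_le _) hi (h.no_pred_row hi hs)
  have hlev := h.inLevel_eq hPQ
  simp only at hQ1 hQ2 hlev hend
  have h1 : inLevel p d e i 0 ≤ 0 := by
    simp only [inLevel, (h.in_row i hi).2.2 hs]
    exact h.faceHeight_zero_nonpos hi
  rcases hend with ⟨rfl, hpa⟩ | ⟨rfl, ht⟩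
  · rw [h.inLevel_end hQ2 hpa] at hlev
    have h2 := hp.2 (a + 1) (by omega)
    rw [wordHeight_succ_of_one hpa] at h2
    omega
  · exact ⟨b, hQ1, ht, hPQ⟩

/-- A strand leaves a column to the left only through a cell that is used by that column for the
incoming edges. -/
theorem TangleStep.fst_le {P Q : ℕ × ℕ} (h : TangleStep M d e P Q) :
    P.1 ≤ Q.1 ∨ (P.1 = Q.1 + 1 ∧ (e Q.1 Q.2 = ne ∨ e Q.1 Q.2 = se) ∧
      (d P.1 P.2 = nw ∨ d P.1 P.2 = sw)) := by
  obtain ⟨X, Y⟩ := P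
  obtain ⟨X', Y'⟩ := Q
  obtain ⟨⟨h1, h2, h3, h4⟩, ⟨h1', h2', h3', h4'⟩, heq⟩ := h
  simp only at *
  rcases ha : d X Y with _ | _ | _ | _ <;> rcases hb : e X' Y' with _ | _ | _ | _ <;>
    simp only [ha, hb, latticePoint, Dir.offset, Prod.ext_iff, Prod.fst_add, Prod.snd_add,
      reduceCtorEq, or_false, or_true, and_true, and_false] at heq ⊢ <;> omega

end Connect

/-! ### Configurations as tangles -/

/-- The vertex `(x, y)` with `x + y` odd in row `y` of the strip to the left of column `S`; for
`y = S` it is the free end of an external edge. -/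
def cellPoint (S y : ℕ) : ℤ × ℤ := ((S : ℤ) + y, (S : ℤ) - 1 - y)

/-- The graph formed by the edges that the points of a tangle select. -/
def toGraph (M : ℕ) (d e : ℕ → ℕ → Dir) : SimpleGraph (ℤ × ℤ) :=
  SimpleGraph.fromRel fun a b => ∃ X Y D, Dir.IsReal M X Y D ∧ (d X Y = D ∨ e X Y = D) ∧
    a = latticePoint X Y ∧ b = latticePoint X Y + D.offset

/-- A word as a Boolean function, with `true` for the letter `1`. -/
def letterFun (w : List (Fin 2)) (i : ℕ) : Bool := decide (w[i]? = some 1)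

theorem latticePoint_inj {X Y X' Y' : ℕ} :
    latticePoint X Y = latticePoint X' Y' ↔ X = X' ∧ Y = Y' := by
  simp only [latticePoint, Prod.ext_iff]; omega

theorem cellPoint_inj {X Y X' Y' : ℕ} :
    cellPoint X Y = cellPoint X' Y' ↔ X = X' ∧ Y = Y' := by
  simp only [cellPoint, Prod.ext_iff]; omega

theorem latticePoint_ne_cellPoint {X Y S y : ℕ} : latticePoint X Y ≠ cellPoint S y := by
  simp only [latticePoint, cellPoint, Ne, Prod.ext_iff]; omega

theorem latticePoint_add_nw (X Y : ℕ) : latticePoint X Y + nw.offset = cellPoint X Y := by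
  simp only [latticePoint, cellPoint, Dir.offset, Prod.ext_iff, Prod.fst_add, Prod.snd_add]; omega

theorem latticePoint_add_ne (X Y : ℕ) : latticePoint X Y + ne.offset = cellPoint (X + 1) Y := by
  simp only [latticePoint, cellPoint, Dir.offset, Prod.ext_iff, Prod.fst_add, Prod.snd_add]; omega

theorem latticePoint_add_sw (X y : ℕ) :
    latticePoint X (y + 1) + sw.offset = cellPoint X y := by
  simp only [latticePoint, cellPoint, Dir.offset, Prod.ext_iff, Prod.fst_add, Prod.snd_add]; omega

theorem latticePoint_add_se (X y : ℕ) :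
    latticePoint X (y + 1) + se.offset = cellPoint (X + 1) y := by
  simp only [latticePoint, cellPoint, Dir.offset, Prod.ext_iff, Prod.fst_add, Prod.snd_add]; omega

theorem offset_injective : Function.Injective Dir.offset := by
  intro a b; cases a <;> cases b <;> simp [Dir.offset]

/-- The points adjacent to a cell. -/
theorem latticePoint_add_eq_cellPoint {M X Y S y : ℕ} {D : Dir} (hD : D.IsReal M X Y)
    (h : latticePoint X Y + D.offset = cellPoint S y) :
    (D = nw ∧ X = S ∧ Y = y) ∨ (D = sw ∧ X = S ∧ Y = y + 1) ∨ (D = ne ∧ S = X + 1 ∧ Y = y) ∨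
      (D = se ∧ S = X + 1 ∧ Y = y + 1) := by
  obtain ⟨h1, h2, h3, h4⟩ := hD
  cases D <;>
    simp only [latticePoint, cellPoint, Dir.offset, Prod.ext_iff, Prod.fst_add, Prod.snd_add,
      reduceCtorEq, or_false, or_true, true_imp_iff, false_and, true_and, false_or] at * <;>
    omega

theorem Dir.IsReal.exists_cellPoint {M X Y : ℕ} {D : Dir} (hD : D.IsReal M X Y) :
    ∃ S y, y ≤ S ∧ S ≤ M ∧ latticePoint X Y + D.offset = cellPoint S y := by
  obtain ⟨h1, h2, h3, h4⟩ := hD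
  cases D <;> simp only [reduceCtorEq, or_false, or_true, true_imp_iff] at h3 h4
  · obtain ⟨y, rfl⟩ : ∃ y, Y = y + 1 := ⟨Y - 1, by omega⟩
    exact ⟨X, y, by omega, h2, latticePoint_add_sw X y⟩
  · exact ⟨X, Y, h1, h2, latticePoint_add_nw X Y⟩
  · obtain ⟨y, rfl⟩ : ∃ y, Y = y + 1 := ⟨Y - 1, by omega⟩
    exact ⟨X + 1, y, by omega, h3, latticePoint_add_se X y⟩
  · exact ⟨X + 1, Y, by omega, h3, latticePoint_add_ne X Y⟩

section Triangle

variable {n M : ℕ}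

theorem leftVertex_eq (i : ℕ) : leftVertex i = latticePoint i 0 := by
  simp [leftVertex, latticePoint]

theorem rightVertex_eq (hM : M + 1 = 2 * n) (i : ℕ) : rightVertex n i = latticePoint M i := by
  simp only [rightVertex, latticePoint, Prod.ext_iff]; omega

theorem externalEnd_eq (i : ℕ) : externalEnd i = cellPoint i i := by
  simp only [externalEnd, cellPoint, Prod.ext_iff]; omega

theorem bottomVertex_eq (i : ℕ) : bottomVertex i = latticePoint i i := by
  simp only [bottomVertex, latticePoint, Prod.ext_iff]; omega

theorem inTriangle_latticePoint (hM : M + 1 = 2 * n) {X Y : ℕ} :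
    InTriangle n (latticePoint X Y) ↔ Y ≤ X ∧ X ≤ M := by
  simp only [InTriangle, latticePoint]; omega

theorem inTriangle_cellPoint (hM : M + 1 = 2 * n) {S y : ℕ} :
    InTriangle n (cellPoint S y) ↔ y < S ∧ S ≤ M := by
  simp only [InTriangle, cellPoint]; omega

theorem inTriangle_cases (hM : M + 1 = 2 * n) {a : ℤ × ℤ} (h : InTriangle n a) :
    (∃ X Y, Y ≤ X ∧ X ≤ M ∧ a = latticePoint X Y) ∨
      (∃ S y, y < S ∧ S ≤ M ∧ a = cellPoint S y) := by
  obtain ⟨x, y⟩ := a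
  obtain ⟨h1, h2, h3⟩ := h
  simp only at h1 h2 h3
  rcases Int.emod_two_eq_zero_or_one (x + y) with h | h
  · refine Or.inl ⟨((x + y) / 2).toNat, ((x - y) / 2).toNat, ?_, ?_, ?_⟩
    · omega
    · omega
    · simp only [latticePoint, Prod.ext_iff]; omega
  · refine Or.inr ⟨((x + y + 1) / 2).toNat, ((x - y - 1) / 2).toNat, ?_, ?_, ?_⟩
    · omega
    · omega
    · simp only [cellPoint, Prod.ext_iff]; omega

theorem triangleGraph_adj_of_isReal (hM : M + 1 = 2 * n) {X Y : ℕ} {D : Dir}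
    (hD : D.IsReal M X Y) :
    (triangleGraph n).Adj (latticePoint X Y) (latticePoint X Y + D.offset) := by
  obtain ⟨h1, h2, h3, h4⟩ := hD
  have hP := (inTriangle_latticePoint hM).2 ⟨h1, h2⟩
  simp only [triangleGraph, SimpleGraph.fromRel_adj]
  have e1 : ∀ (P Q : ℤ × ℤ), (P = P + Q ↔ Q = 0) := fun P Q => by simp
  cases D <;> simp only [reduceCtorEq, or_false, or_true, true_imp_iff] at h3 h4
  · refine ⟨by simp [Dir.offset], Or.inr (Or.inl ⟨?_, hP, Or.inl ?_⟩)⟩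
    · simp only [InTriangle, latticePoint, Dir.offset, Prod.fst_add, Prod.snd_add]; omega
    · simp only [latticePoint, Dir.offset, Prod.ext_iff, Prod.fst_add, Prod.snd_add]; omega
  · refine ⟨by simp [Dir.offset], Or.inr ?_⟩
    rcases h1.lt_or_eq with h | rfl
    · refine Or.inl ⟨?_, hP, Or.inr ?_⟩
      · simp only [InTriangle, latticePoint, Dir.offset, Prod.fst_add, Prod.snd_add]; omega
      · simp only [latticePoint, Dir.offset, Prod.ext_iff, Prod.fst_add, Prod.snd_add]; omega
    · exact Or.inr ⟨Y, by omega, by rw [latticePoint_add_nw, externalEnd_eq],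
        (bottomVertex_eq Y).symm⟩
  · refine ⟨by simp [Dir.offset], Or.inl (Or.inl ⟨hP, ?_, Or.inr rfl⟩)⟩
    simp only [InTriangle, latticePoint, Dir.offset, Prod.fst_add, Prod.snd_add]; omega
  · refine ⟨by simp [Dir.offset], Or.inl (Or.inl ⟨hP, ?_, Or.inl rfl⟩)⟩
    simp only [InTriangle, latticePoint, Dir.offset, Prod.fst_add, Prod.snd_add]; omega

/-- Each edge of the triangle has exactly one lattice point among its endpoints. -/
theorem triangleGraph_adj (hM : M + 1 = 2 * n) {a b : ℤ × ℤ} (h : (triangleGraph n).Adj a b) :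
    ∃ X Y D, Dir.IsReal M X Y D ∧ ((a = latticePoint X Y ∧ b = latticePoint X Y + D.offset) ∨
      (b = latticePoint X Y ∧ a = latticePoint X Y + D.offset)) := by
  have key : ∀ p q : ℤ × ℤ, ((InTriangle n p ∧ InTriangle n q ∧ (q = p + (1, 0) ∨ q = p + (0, 1))) ∨
      ∃ i : ℕ, i < 2 * n ∧ p = externalEnd i ∧ q = bottomVertex i) →
      ∃ X Y D, Dir.IsReal M X Y D ∧ ((p = latticePoint X Y ∧ q = latticePoint X Y + D.offset) ∨
        (q = latticePoint X Y ∧ p = latticePoint X Y + D.offset)) := by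
    rintro p q (⟨hp, hq, hpq⟩ | ⟨i, hi, rfl, rfl⟩)
    · rcases inTriangle_cases hM hp with ⟨X, Y, hY, hX, rfl⟩ | ⟨S, y, hy, hS, rfl⟩
      · simp only [InTriangle] at hq
        rcases hpq with rfl | rfl
        · refine ⟨X, Y, ne, ⟨hY, hX, ?_, by simp⟩, Or.inl ⟨rfl, rfl⟩⟩
          simp only [latticePoint, Prod.fst_add, Prod.snd_add] at hq
          omega
        · refine ⟨X, Y, se, ⟨hY, hX, ?_, ?_⟩, Or.inl ⟨rfl, rfl⟩⟩
          all_goals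
            simp only [latticePoint, Prod.fst_add, Prod.snd_add] at hq
            omega
      · rcases hpq with rfl | rfl
        · refine ⟨S, y + 1, sw, ⟨by omega, hS, by simp, by simp⟩, Or.inr ⟨?_, ?_⟩⟩
          · simp only [latticePoint, cellPoint, Prod.ext_iff, Prod.fst_add, Prod.snd_add]; omega
          · rw [latticePoint_add_sw]
        · refine ⟨S, y, nw, ⟨by omega, hS, by simp, by simp⟩, Or.inr ⟨?_, ?_⟩⟩
          · simp only [latticePoint, cellPoint, Prod.ext_iff, Prod.fst_add, Prod.snd_add]; omega
          · rw [latticePoint_add_nw]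
    · exact ⟨i, i, nw, ⟨le_rfl, by omega, by simp, by simp⟩,
        Or.inr ⟨bottomVertex_eq i, by rw [latticePoint_add_nw, externalEnd_eq]⟩⟩
  simp only [triangleGraph, SimpleGraph.fromRel_adj] at h
  rcases h.2 with h | h
  · exact key a b h
  · obtain ⟨X, Y, D, hD, h⟩ := key b a h
    exact ⟨X, Y, D, hD, h.symm⟩

theorem triangleGraph_adj_latticePoint (hM : M + 1 = 2 * n) {X Y : ℕ} {b : ℤ × ℤ}
    (h : (triangleGraph n).Adj (latticePoint X Y) b) :
    ∃ D, Dir.IsReal M X Y D ∧ b = latticePoint X Y + D.offset := by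
  obtain ⟨X', Y', D, hD, ⟨h1, h2⟩ | ⟨h1, h2⟩⟩ := triangleGraph_adj hM h
  · obtain ⟨rfl, rfl⟩ := latticePoint_inj.1 h1
    exact ⟨D, hD, h2⟩
  · obtain ⟨S, y, -, -, h3⟩ := hD.exists_cellPoint
    exact absurd (h2.trans h3) latticePoint_ne_cellPoint

theorem triangleGraph_adj_cellPoint (hM : M + 1 = 2 * n) {S y : ℕ} {b : ℤ × ℤ}
    (h : (triangleGraph n).Adj (cellPoint S y) b) :
    ∃ X Y D, Dir.IsReal M X Y D ∧ b = latticePoint X Y ∧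
      latticePoint X Y + D.offset = cellPoint S y := by
  obtain ⟨X', Y', D, hD, ⟨h1, h2⟩ | ⟨h1, h2⟩⟩ := triangleGraph_adj hM h
  · exact absurd h1.symm latticePoint_ne_cellPoint
  · exact ⟨X', Y', D, hD, h1, h2.symm⟩

theorem toGraph_adj_latticePoint {d e : ℕ → ℕ → Dir} {X Y : ℕ} {D : Dir} :
    (toGraph M d e).Adj (latticePoint X Y) (latticePoint X Y + D.offset) ↔
      D.IsReal M X Y ∧ (d X Y = D ∨ e X Y = D) := by
  simp only [toGraph, SimpleGraph.fromRel_adj]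
  constructor
  · rintro ⟨-, ⟨X', Y', D', h1, h2, h3, h4⟩ | ⟨X', Y', D', h1, h2, h3, h4⟩⟩
    · obtain ⟨rfl, rfl⟩ := latticePoint_inj.1 h3
      obtain rfl := offset_injective (add_left_cancel h4)
      exact ⟨h1, h2⟩
    · obtain ⟨S, y, -, -, h5⟩ := h1.exists_cellPoint
      exact absurd (h4.trans h5) latticePoint_ne_cellPoint
  · rintro ⟨h1, h2⟩
    refine ⟨?_, Or.inl ⟨X, Y, D, h1, h2, rfl, rfl⟩⟩
    cases D <;> simp [Dir.offset]

theorem toGraph_le (hM : M + 1 = 2 * n) (d e : ℕ → ℕ → Dir) : toGraph M d e ≤ triangleGraph n := by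
  intro a b h
  simp only [toGraph, SimpleGraph.fromRel_adj] at h
  rcases h with ⟨-, ⟨X', Y', D', h1, h2, rfl, rfl⟩ | ⟨X', Y', D', h1, h2, rfl, rfl⟩⟩
  · exact triangleGraph_adj_of_isReal hM h1
  · exact (triangleGraph_adj_of_isReal hM h1).symm

theorem toGraph_adj_cellPoint (hM : M + 1 = 2 * n) {d e : ℕ → ℕ → Dir} {S y : ℕ} {b : ℤ × ℤ} :
    (toGraph M d e).Adj (cellPoint S y) b ↔ ∃ X Y D, Dir.IsReal M X Y D ∧ b = latticePoint X Y ∧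
      latticePoint X Y + D.offset = cellPoint S y ∧ (d X Y = D ∨ e X Y = D) := by
  constructor
  · intro h
    obtain ⟨X, Y, D, hD, rfl, h2⟩ := triangleGraph_adj_cellPoint hM (toGraph_le hM d e h)
    have h := h.symm
    rw [← h2, toGraph_adj_latticePoint] at h
    exact ⟨X, Y, D, hD, rfl, h2, h.2⟩
  · rintro ⟨X, Y, D, hD, rfl, h2, h3⟩
    rw [← h2]
    exact (toGraph_adj_latticePoint.2 ⟨hD, h3⟩).symm

end Triangle

/-! ### Words as lists and as functions -/

section Words

theorem letterFun_eq_true {w : List (Fin 2)} {i : ℕ} : letterFun w i = true ↔ w[i]? = some 1 := by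
  simp [letterFun]

theorem letterFun_eq_false {w : List (Fin 2)} {i : ℕ} (hi : i < w.length) :
    letterFun w i = false ↔ w[i]? = some 0 := by
  rw [letterFun, decide_eq_false_iff_not, List.getElem?_eq_getElem hi]
  have : ∀ x : Fin 2, ¬ (some x = some (1 : Fin 2)) ↔ some x = some 0 := by decide
  exact this _

theorem wordHeight_letterFun (w : List (Fin 2)) {k : ℕ} (hk : k ≤ w.length) :
    wordHeight (letterFun w) k = ((w.take k).count 0 : ℤ) - (w.take k).count 1 := by
  induction k with
  | zero => simp [wordHeight]
  | succ k ih =>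
    have ih := ih (by omega)
    have h1 : w.take (k + 1) = w.take k ++ [w[k]] := by
      rw [List.take_add_one, List.getElem?_eq_getElem (by omega)]; rfl
    rw [h1]
    simp only [List.count_append]
    have h2 : ∀ x : Fin 2, x = 0 ∨ x = 1 := by decide
    rcases h2 w[k] with h | h
    · have h3 : letterFun w k = false := by
        rw [letterFun_eq_false (by omega), List.getElem?_eq_getElem (by omega), h]
      rw [wordHeight_succ_of_zero h3, ih, h]
      simp; ring
    · have h3 : letterFun w k = true := by
        rw [letterFun_eq_true, List.getElem?_eq_getElem (by omega), h]
      rw [wordHeight_succ_of_one h3, ih, h]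
      simp; ring

theorem isDyck_iff (w : List (Fin 2)) : IsDyck w ↔ IsBallot (letterFun w) w.length := by
  unfold IsDyck IsBallot
  rw [wordHeight_letterFun w le_rfl, List.take_length]
  refine and_congr (by omega) ⟨fun h k hk => ?_, fun h p hp => ?_⟩
  · rw [wordHeight_letterFun w hk]
    have := h _ (List.take_prefix k w)
    omega
  · have h1 := h p.length hp.length_le
    rw [wordHeight_letterFun w hp.length_le, ← List.prefix_iff_eq_take.1 hp] at h1
    omega

theorem isMatched_iff (w : List (Fin 2)) (i j : ℕ) :
    IsMatched w i j ↔ Matched (letterFun w) i j ∧ j < w.length := by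
  constructor
  · rintro ⟨p, m, s, rfl, ⟨hm1, hm2⟩, rfl, rfl⟩
    have hlen : (p ++ 0 :: (m ++ 1 :: s)).length = p.length + 1 + m.length + 1 + s.length := by
      simp; omega
    have htake : ∀ q ≤ m.length, (p ++ 0 :: (m ++ 1 :: s)).take (p.length + 1 + q) =
        p ++ 0 :: m.take q := by
      intro q hq
      rw [List.take_append, List.take_of_length_le (by omega),
        show p.length + 1 + q - p.length = q + 1 by omega, List.take_succ_cons,
        List.take_append_of_le_length hq]
    have hheight : ∀ q ≤ m.length, wordHeight (letterFun (p ++ 0 :: (m ++ 1 :: s)))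
        (p.length + 1 + q) = (p.count 0 + 1 - p.count 1 : ℤ) +
          ((m.take q).count 0 - (m.take q).count 1) := by
      intro q hq
      rw [wordHeight_letterFun _ (by omega), htake q hq]
      simp; ring
    refine ⟨⟨by omega, ?_, ?_, ?_, ?_⟩, by omega⟩
    · rw [letterFun_eq_false (by omega)]; simp
    · rw [letterFun_eq_true, List.getElem?_append_right (by omega),
        show p.length + 1 + m.length - p.length = m.length + 1 by omega]
      simp
    · have h1 := hheight 0 (Nat.zero_le _)
      have h2 := hheight m.length le_rfl
      rw [List.take_length] at h2
      simp only [Nat.add_zero, List.take_zero, List.count_nil] at h1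
      rw [h1, h2]
      omega
    · intro k hk hk'
      obtain ⟨q, rfl⟩ : ∃ q, k = p.length + 1 + q := ⟨k - (p.length + 1), by omega⟩
      have h1 := hheight 0 (Nat.zero_le _)
      simp only [Nat.add_zero, List.take_zero, List.count_nil] at h1
      rw [h1, hheight q (by omega)]
      have := hm2 _ (List.take_prefix q m)
      omega
  · rintro ⟨⟨h1, h2, h3, h4, h5⟩, hj⟩
    rw [letterFun_eq_false (by omega), List.getElem?_eq_getElem (by omega),
      Option.some_inj] at h2
    rw [letterFun_eq_true, List.getElem?_eq_getElem hj, Option.some_inj] at h3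
    set m := (w.drop (i + 1)).take (j - (i + 1)) with hm
    have hmlen : m.length = j - (i + 1) := by simp [hm]; omega
    have hw : w = w.take i ++ 0 :: (m ++ 1 :: w.drop (j + 1)) := by
      conv_lhs => rw [← List.take_append_drop i w, List.drop_eq_getElem_cons (by omega), h2,
        ← List.take_append_drop (j - (i + 1)) (w.drop (i + 1)), List.drop_drop,
        show i + 1 + (j - (i + 1)) = j by omega, List.drop_eq_getElem_cons hj, h3]
    have hheight : ∀ q ≤ m.length, wordHeight (letterFun w) (i + 1 + q) =
        wordHeight (letterFun w) (i + 1) + ((m.take q).count 0 - (m.take q).count 1) := by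
      intro q hq
      rw [wordHeight_letterFun _ (by omega), wordHeight_letterFun _ (by omega)]
      have h6 : w.take (i + 1 + q) = w.take (i + 1) ++ m.take q := by
        rw [List.take_add, hm, List.take_take, min_eq_left (by omega)]
      rw [h6]
      simp only [List.count_append]
      push_cast; ring
    refine ⟨w.take i, m, w.drop (j + 1), hw, ⟨?_, fun p hp => ?_⟩, by simp; omega, by simp; omega⟩
    · have := hheight m.length le_rfl
      rw [List.take_length, hmlen, show i + 1 + (j - (i + 1)) = j by omega] at this
      omega
    · have h6 := hheight p.length hp.length_le
      rw [← List.prefix_iff_eq_take.1 hp] at h6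
      have h7 := h5 (i + 1 + p.length) (by omega) (by have := hp.length_le; omega)
      omega

theorem card_filter_getElem? (w : List (Fin 2)) (x : Fin 2) :
    ((Finset.range w.length).filter (fun i => w[i]? = some x)).card = w.count x := by
  induction w using List.reverseRecOn with
  | nil => simp
  | append_singleton w a ih =>
    rw [List.length_append, List.length_singleton, Finset.range_add_one, Finset.filter_insert]
    have h1 : (Finset.range w.length).filter (fun i => (w ++ [a])[i]? = some x) =
        (Finset.range w.length).filter (fun i => w[i]? = some x) := by
      refine Finset.filter_congr fun i hi => ?_
      rw [List.getElem?_append_left (Finset.mem_range.1 hi)]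
    rw [h1, List.count_append, List.getElem?_concat_length]
    split_ifs with h
    · rw [Finset.card_insert_of_notMem (by simp), ih]
      simp_all
    · rw [ih, List.count_singleton]
      have : ¬ a = x := fun h' => h (by rw [h'])
      simp [this]

theorem dyckWords_count {n : ℕ} {w : List (Fin 2)} (hw : w ∈ dyckWords n) :
    w.length = 2 * n ∧ w.count 0 = n ∧ w.count 1 = n := by
  obtain ⟨h1, h2, -⟩ := hw
  have h3 : w.length = w.count 0 + w.count 1 := by
    clear h1 h2
    induction w with
    | nil => simp
    | cons a w ih =>
      have h2 : ∀ x : Fin 2, x = 0 ∨ x = 1 := by decide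
      rcases h2 a with rfl | rfl <;> simp [ih] <;> omega
  exact ⟨h1, by omega, by omega⟩

theorem dyckWords_isBallot {n : ℕ} {w : List (Fin 2)} (hw : w ∈ dyckWords n) :
    IsBallot (letterFun w) (2 * n) := by
  have := (isDyck_iff w).1 hw.2
  rwa [hw.1] at this

theorem IsBallot.first {p : ℕ → Bool} {N : ℕ} (h : IsBallot p (N + 1)) : p 0 = false := by
  by_contra h1
  have h2 := wordHeight_succ_of_one (k := 0) (by simpa using h1)
  have h3 := h.2 1 (by omega)
  simp only [wordHeight] at h2 h3
  omega

theorem IsBallot.last {p : ℕ → Bool} {N : ℕ} (h : IsBallot p (N + 1)) : p N = true := by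
  by_contra h1
  have h2 := wordHeight_succ_of_zero (k := N) (by simpa using h1)
  have h3 := h.2 N (by omega)
  have h4 := h.1
  omega

end Words

/-! ### From configurations to tangles -/

section Orientation

variable {V : Type*} {f : SimpleGraph V} {O : V → V → Prop}

theorem orientation_out_unique (hO1 : ∀ a b, O a b → f.Adj a b)
    (hO2 : ∀ a b, f.Adj a b → (O a b ↔ ¬ O b a))
    (hO3 : ∀ a b c, f.Adj a b → f.Adj b c → c ≠ a → (O a b ↔ O b c)) {v a b : V}
    (ha : O v a) (hb : O v b) : a = b := by
  by_contra h
  have h1 := hO3 a v b (hO1 _ _ ha).symm (hO1 _ _ hb) (Ne.symm h)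
  exact (hO2 v a (hO1 _ _ ha)).1 ha (h1.2 hb)

theorem orientation_in_unique (hO1 : ∀ a b, O a b → f.Adj a b)
    (hO2 : ∀ a b, f.Adj a b → (O a b ↔ ¬ O b a))
    (hO3 : ∀ a b c, f.Adj a b → f.Adj b c → c ≠ a → (O a b ↔ O b c)) {v a b : V}
    (ha : O a v) (hb : O b v) : a = b := by
  by_contra h
  have h1 := hO3 a v b (hO1 _ _ ha) (hO1 _ _ hb).symm (Ne.symm h)
  exact (hO2 b v (hO1 _ _ hb)).1 hb (h1.1 ha)

/-- A vertex of degree two has both an incoming and an outgoing edge. -/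
theorem orientation_exists (hO2 : ∀ a b, f.Adj a b → (O a b ↔ ¬ O b a))
    (hO3 : ∀ a b c, f.Adj a b → f.Adj b c → c ≠ a → (O a b ↔ O b c)) {v : V}
    (h : (f.neighborSet v).ncard = 2) : (∃ a, O a v) ∧ ∃ a, O v a := by
  obtain ⟨a, b, hab, hset⟩ := Set.ncard_eq_two.1 h
  have ha : f.Adj v a := by
    have : a ∈ f.neighborSet v := by rw [hset]; simp
    exact this
  have hb : f.Adj v b := by
    have : b ∈ f.neighborSet v := by rw [hset]; simp
    exact this
  have h1 := hO2 v a ha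
  have h2 := hO2 v b hb
  have h3 := hO3 a v b ha.symm hb hab.symm
  by_cases h4 : O v a
  · exact ⟨⟨b, by by_contra h5; exact (h1.1 h4) (h3.2 (h2.2 h5))⟩, a, h4⟩
  · have h5 : O a v := by by_contra h6; exact h4 (h1.2 h6)
    exact ⟨⟨a, h5⟩, b, h3.1 h5⟩

end Orientation

section FromConfiguration

variable {n M : ℕ} {σ τ π : List (Fin 2)} {f : SimpleGraph (ℤ × ℤ)}

theorem IsTFPL.adj_latticePoint (hf : IsTFPL n σ τ π f) (hM : M + 1 = 2 * n) {X Y : ℕ} {b : ℤ × ℤ}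
    (h : f.Adj (latticePoint X Y) b) : ∃ D, Dir.IsReal M X Y D ∧ b = latticePoint X Y + D.offset :=
  triangleGraph_adj_latticePoint hM (hf.le_triangle h)

theorem IsTFPL.external_unique (hf : IsTFPL n σ τ π f) (hM : M + 1 = 2 * n) {i : ℕ}
    {b : ℤ × ℤ} (h : f.Adj (cellPoint i i) b) : b = latticePoint i i := by
  obtain ⟨X, Y, D, hD, rfl, h1⟩ := triangleGraph_adj_cellPoint hM (hf.le_triangle h)
  rcases latticePoint_add_eq_cellPoint hD h1 with ⟨-, rfl, rfl⟩ | ⟨-, rfl, h2⟩ | ⟨-, h2, h3⟩ |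
    ⟨-, h2, h3⟩
  · rfl
  all_goals have := hD.1; omega

theorem IsTFPL.degree_cell (hf : IsTFPL n σ τ π f) (hM : M + 1 = 2 * n) {S y : ℕ} (hy : y < S)
    (hS : S ≤ M) : (f.neighborSet (cellPoint S y)).ncard = 2 := by
  refine hf.degree_two _ ((inTriangle_cellPoint hM).2 ⟨hy, hS⟩)
    (fun i _ => ?_) (fun i _ => ?_)
  · rw [leftVertex_eq]; exact latticePoint_ne_cellPoint.symm
  · rw [rightVertex_eq hM]; exact latticePoint_ne_cellPoint.symm

theorem IsTFPL.degree_point (hf : IsTFPL n σ τ π f) (hM : M + 1 = 2 * n) {X Y : ℕ} (hY : 0 < Y)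
    (hYX : Y ≤ X) (hX : X < M) : (f.neighborSet (latticePoint X Y)).ncard = 2 := by
  refine hf.degree_two _ ((inTriangle_latticePoint hM).2 ⟨hYX, hX.le⟩)
    (fun i _ => ?_) (fun i _ => ?_)
  · rw [leftVertex_eq, Ne, latticePoint_inj]; omega
  · rw [rightVertex_eq hM, Ne, latticePoint_inj]; omega

theorem IsTFPL.left_ne (hf : IsTFPL n σ τ π f) (hM : M + 1 = 2 * n) {i : ℕ} (hi : i < M) :
    f.Adj (latticePoint i 0) (latticePoint i 0 + ne.offset) := by
  have := hf.left_horizontal i (by omega)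
  rwa [leftVertex_eq] at this

theorem IsTFPL.left_nw (hf : IsTFPL n σ τ π f) (hM : M + 1 = 2 * n) {i : ℕ} (hi : i ≤ M) :
    f.Adj (latticePoint i 0) (latticePoint i 0 + nw.offset) ↔ σ[i]? = some 0 := by
  have := hf.left_vertical i (by omega)
  rw [leftVertex_eq] at this
  rw [← this]
  simp [Dir.offset, sub_eq_add_neg]

theorem IsTFPL.right_sw (hf : IsTFPL n σ τ π f) (hM : M + 1 = 2 * n) {j : ℕ} (hj : 0 < j)
    (hj' : j ≤ M) : f.Adj (latticePoint M j) (latticePoint M j + sw.offset) := by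
  have := hf.right_horizontal j hj (by omega)
  rw [rightVertex_eq hM] at this
  simpa [Dir.offset, sub_eq_add_neg] using this

theorem IsTFPL.right_nw (hf : IsTFPL n σ τ π f) (hM : M + 1 = 2 * n) {j : ℕ} (hj : j ≤ M) :
    f.Adj (latticePoint M j) (latticePoint M j + nw.offset) ↔ τ[j]? = some 1 := by
  have := hf.right_vertical j (by omega)
  rw [rightVertex_eq hM] at this
  rw [← this]
  simp [Dir.offset, sub_eq_add_neg]

/-- A left boundary vertex other than the apex lies on a horizontal edge and, if its letter is
`0`, on a vertical one. -/
theorem IsTFPL.left_adj (hf : IsTFPL n σ τ π f) (hM : M + 1 = 2 * n) {i : ℕ} (hi : i < M)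
    {b : ℤ × ℤ} (h : f.Adj (latticePoint i 0) b) :
    b = latticePoint i 0 + ne.offset ∨ (b = latticePoint i 0 + nw.offset ∧ σ[i]? = some 0) := by
  obtain ⟨D, ⟨-, -, -, h4⟩, rfl⟩ := hf.adj_latticePoint hM h
  cases D <;> simp only [reduceCtorEq, or_false, or_true, true_imp_iff, lt_irrefl] at h4
  · exact Or.inr ⟨rfl, (hf.left_nw hM hi.le).1 h⟩
  · exact Or.inl rfl

theorem IsTFPL.right_adj (hf : IsTFPL n σ τ π f) (hM : M + 1 = 2 * n) {j : ℕ} (hj : j ≤ M)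
    {b : ℤ × ℤ} (h : f.Adj (latticePoint M j) b) :
    (0 < j ∧ b = latticePoint M j + sw.offset) ∨
      (b = latticePoint M j + nw.offset ∧ τ[j]? = some 1) := by
  obtain ⟨D, ⟨-, -, h3, h4⟩, rfl⟩ := hf.adj_latticePoint hM h
  cases D <;>
    simp only [reduceCtorEq, or_false, or_true, true_imp_iff, lt_irrefl] at h3 h4
  · exact Or.inl ⟨h4, rfl⟩
  · exact Or.inr ⟨rfl, (hf.right_nw hM hj).1 h⟩

theorem IsTFPL.degreeLeTwo (hf : IsTFPL n σ τ π f) (hM : M + 1 = 2 * n) : DegreeLeTwo f := by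
  have hcard : ∀ v a b c, (f.neighborSet v).ncard = 2 → f.Adj v a → f.Adj v b → f.Adj v c →
      a = b ∨ a = c ∨ b = c := by
    intro v a b c h ha hb hc
    obtain ⟨x, y, -, hset⟩ := Set.ncard_eq_two.1 h
    have ha : a ∈ f.neighborSet v := ha
    have hb : b ∈ f.neighborSet v := hb
    have hc : c ∈ f.neighborSet v := hc
    simp only [hset, Set.mem_insert_iff, Set.mem_singleton_iff] at ha hb hc
    rcases ha with rfl | rfl <;> rcases hb with rfl | rfl <;> rcases hc with rfl | rfl <;> simp
  intro v a b c ha hb hc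
  obtain ⟨X, Y, D, hD, ⟨h1, -⟩ | ⟨-, h2⟩⟩ := triangleGraph_adj hM (hf.le_triangle ha)
  · subst h1
    rcases Nat.eq_zero_or_pos Y with rfl | hY
    · rcases hD.2.1.lt_or_eq with hX | rfl
      · rcases hf.left_adj hM hX ha with h1 | h1 <;> rcases hf.left_adj hM hX hb with h2 | h2 <;>
          rcases hf.left_adj hM hX hc with h3 | h3 <;> simp [h1, h2, h3]
      · rcases hf.right_adj hM (Nat.zero_le _) ha with h1 | h1
        · exact absurd h1.1 (by simp)
        · rcases hf.right_adj hM (Nat.zero_le _) hb with h2 | h2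
          · exact absurd h2.1 (by simp)
          · exact Or.inl (h1.1.trans h2.1.symm)
    · rcases hD.2.1.lt_or_eq with hX | rfl
      · exact hcard _ _ _ _ (hf.degree_point hM hY hD.1 hX) ha hb hc
      · rcases hf.right_adj hM hD.1 ha with h1 | h1 <;>
          rcases hf.right_adj hM hD.1 hb with h2 | h2 <;>
          rcases hf.right_adj hM hD.1 hc with h3 | h3 <;> simp [h1, h2, h3]
  · obtain ⟨S, y, hy, hS, h3⟩ := hD.exists_cellPoint
    rw [h3] at h2
    subst h2
    rcases hy.lt_or_eq with hy | rfl
    · exact hcard _ _ _ _ (hf.degree_cell hM hy hS) ha hb hc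
    · rw [hf.external_unique hM ha, hf.external_unique hM hb]; simp

theorem reachable_of_isolated {V : Type*} {f : SimpleGraph V} {a b : V} (h : f.Reachable a b)
    (hb : ∀ c, ¬ f.Adj b c) : a = b := by
  have h := h.symm
  rw [SimpleGraph.reachable_iff_reflTransGen] at h
  rcases ReflTransGen.cases_head h with h | ⟨c, hc, -⟩
  · exact h.symm
  · exact absurd hc (hb c)

/-- The apex is both a left boundary vertex with letter `1` and a right boundary vertex with letter
`0`, joined to itself by the path of length zero, and it is isolated. -/
theorem IsTFPL.apex (hf : IsTFPL n σ τ π f) (hM : M + 1 = 2 * n) (hτ : τ[0]? = some 0)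
    (b : ℤ × ℤ) : ¬ f.Adj (latticePoint M 0) b := by
  intro h
  rcases hf.right_adj hM (Nat.zero_le _) h with h1 | h1
  · exact absurd h1.1 (by simp)
  · rw [hτ] at h1; simp at h1

/-- The orientation of a configuration from the left boundary to the right boundary, and from the
opening to the closing external edges. -/
theorem IsTFPL.exists_orientation (hf : IsTFPL n σ τ π f) (hM : M + 1 = 2 * n)
    (hσ : σ ∈ dyckWords n) (hτ : τ ∈ dyckWords n) (hπ : π ∈ dyckWords n) :
    ∃ O : ℤ × ℤ → ℤ × ℤ → Prop, (∀ a b, O a b → f.Adj a b) ∧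
      (∀ a b, f.Adj a b → (O a b ↔ ¬ O b a)) ∧
      (∀ a b c, f.Adj a b → f.Adj b c → c ≠ a → (O a b ↔ O b c)) ∧
      (∀ i < M, σ[i]? = some 1 → O (latticePoint i 0) (latticePoint i 0 + ne.offset)) ∧
      (∀ j, 0 < j → j ≤ M → τ[j]? = some 0 →
        O (latticePoint M j + sw.offset) (latticePoint M j)) ∧
      (∀ i ≤ M, π[i]? = some 0 → O (cellPoint i i) (latticePoint i i)) ∧
      (∀ i ≤ M, π[i]? = some 1 → O (latticePoint i i) (cellPoint i i)) := by
  classical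
  have hσb := dyckWords_isBallot hσ
  have hτb := dyckWords_isBallot hτ
  have hπb := dyckWords_isBallot hπ
  rw [← hM] at hσb hτb hπb
  obtain ⟨hσl, hσ0, hσ1⟩ := dyckWords_count hσ
  obtain ⟨hτl, hτ0, hτ1⟩ := dyckWords_count hτ
  obtain ⟨hπl, hπ0, hπ1⟩ := dyckWords_count hπ
  have hσM : σ[M]? = some 1 := letterFun_eq_true.1 hσb.last
  have hτZ : τ[0]? = some 0 := (letterFun_eq_false (by omega)).1 hτb.first
  let A := (Finset.range σ.length).filter (fun i => σ[i]? = some 1)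
  let B := (Finset.range τ.length).filter (fun i => τ[i]? = some 0)
  let C := (Finset.range π.length).filter (fun i => π[i]? = some 0)
  let D := (Finset.range π.length).filter (fun i => π[i]? = some 1)
  have hA : ∀ i, i ∈ A.erase M ↔ i < M ∧ σ[i]? = some 1 := fun i => by
    simp only [A, Finset.mem_erase, Finset.mem_filter, Finset.mem_range, ne_eq, ← and_assoc]
    exact and_congr_left fun _ => by omega
  have hB : ∀ i, i ∈ B.erase 0 ↔ (0 < i ∧ i ≤ M) ∧ τ[i]? = some 0 := fun i => by
    simp only [B, Finset.mem_erase, Finset.mem_filter, Finset.mem_range, ne_eq, ← and_assoc]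
    exact and_congr_left fun _ => by omega
  have hC : ∀ i, i ∈ C ↔ i ≤ M ∧ π[i]? = some 0 := fun i => by
    simp only [C, Finset.mem_filter, Finset.mem_range]
    exact and_congr_left fun _ => by omega
  have hD : ∀ i, i ∈ D ↔ i ≤ M ∧ π[i]? = some 1 := fun i => by
    simp only [D, Finset.mem_filter, Finset.mem_range]
    exact and_congr_left fun _ => by omega
  have hcA : (A.erase M).card = n - 1 := by
    rw [Finset.card_erase_of_mem (by
        simp only [A, Finset.mem_filter, Finset.mem_range]; exact ⟨by omega, hσM⟩),
      card_filter_getElem?, hσ1]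
  have hcB : (B.erase 0).card = n - 1 := by
    rw [Finset.card_erase_of_mem (by
        simp only [B, Finset.mem_filter, Finset.mem_range]; exact ⟨by omega, hτZ⟩),
      card_filter_getElem?, hτ0]
  have hcC : C.card = n := by rw [card_filter_getElem?, hπ0]
  have hcD : D.card = n := by rw [card_filter_getElem?, hπ1]
  have hinjL : Function.Injective fun i : ℕ => latticePoint i 0 := fun i j h =>
    (latticePoint_inj.1 h).1
  have hinjR : Function.Injective fun i : ℕ => latticePoint M i := fun i j h =>
    (latticePoint_inj.1 h).2
  have hinjE : Function.Injective fun i : ℕ => cellPoint i i := fun i j h =>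
    (cellPoint_inj.1 h).1
  let St := (A.erase M).image (fun i : ℕ => latticePoint i 0) ∪ C.image (fun i : ℕ => cellPoint i i)
  let En := (B.erase 0).image (fun i : ℕ => latticePoint M i) ∪ D.image (fun i : ℕ => cellPoint i i)
  have hSt : ∀ v, v ∈ St ↔ (∃ i < M, σ[i]? = some 1 ∧ v = latticePoint i 0) ∨
      (∃ i ≤ M, π[i]? = some 0 ∧ v = cellPoint i i) := fun v => by
    simp only [St, Finset.mem_union, Finset.mem_image, hA, hC, and_assoc, eq_comm]
  have hEn : ∀ v, v ∈ En ↔ (∃ j, 0 < j ∧ j ≤ M ∧ τ[j]? = some 0 ∧ v = latticePoint M j) ∨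
      (∃ i ≤ M, π[i]? = some 1 ∧ v = cellPoint i i) := fun v => by
    simp only [En, Finset.mem_union, Finset.mem_image, hB, hD, and_assoc, eq_comm]
  have hcSt : St.card = (n - 1) + n := by
    rw [Finset.card_union_of_disjoint, Finset.card_image_of_injective _ hinjL,
      Finset.card_image_of_injective _ hinjE, hcA, hcC]
    rw [Finset.disjoint_left]
    simp only [Finset.mem_image, not_exists, not_and]
    rintro v ⟨i, -, rfl⟩ j - h
    exact latticePoint_ne_cellPoint h.symm
  have hcEn : En.card ≤ (n - 1) + n := by
    refine (Finset.card_union_le _ _).trans ?_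
    rw [Finset.card_image_of_injective _ hinjR, Finset.card_image_of_injective _ hinjE, hcB, hcD]
  have hext : ∀ i a b, f.Adj (cellPoint i i) a → f.Adj (cellPoint i i) b → a = b :=
    fun i a b ha hb => (hf.external_unique hM ha).trans (hf.external_unique hM hb).symm
  have hdisj : Disjoint St En := by
    rw [Finset.disjoint_left]
    intro v hv hv'
    rcases (hSt _).1 hv with ⟨i, hi, hi', rfl⟩ | ⟨i, hi, hi', rfl⟩ <;>
      rcases (hEn _).1 hv' with ⟨j, hj, hj', hj'', h⟩ | ⟨j, hj, hj', h⟩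
    · have := latticePoint_inj.1 h; omega
    · exact latticePoint_ne_cellPoint h
    · exact latticePoint_ne_cellPoint h.symm
    · obtain ⟨rfl, -⟩ := cellPoint_inj.1 h
      rw [hi'] at hj'; simp at hj'
  have hSu : ∀ s ∈ St, ∀ a b, f.Adj s a → f.Adj s b → a = b := by
    intro v hv a b ha hb
    rcases (hSt _).1 hv with ⟨i, hi, hi', rfl⟩ | ⟨i, hi, hi', rfl⟩
    · rcases hf.left_adj hM hi ha with h1 | h1 <;> rcases hf.left_adj hM hi hb with h2 | h2
      · exact h1.trans h2.symm
      all_goals first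
        | exact absurd (h1.2.symm.trans hi') (by decide)
        | exact absurd (h2.2.symm.trans hi') (by decide)
    · exact hext _ _ _ ha hb
  have hEu : ∀ s ∈ En, ∀ a b, f.Adj s a → f.Adj s b → a = b := by
    intro v hv a b ha hb
    rcases (hEn _).1 hv with ⟨i, hi, hi', hi'', rfl⟩ | ⟨i, hi, hi', rfl⟩
    · rcases hf.right_adj hM hi' ha with h1 | h1 <;> rcases hf.right_adj hM hi' hb with h2 | h2
      · exact h1.2.trans h2.2.symm
      all_goals first
        | exact absurd (h1.2.symm.trans hi'') (by decide)
        | exact absurd (h2.2.symm.trans hi'') (by decide)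
    · exact hext _ _ _ ha hb
  have hreach : ∀ s ∈ St, ∃ t ∈ En, f.Reachable s t := by
    intro v hv
    rcases (hSt _).1 hv with ⟨i, hi, hi', rfl⟩ | ⟨i, hi, hi', rfl⟩
    · obtain ⟨j, hj, hj', hij⟩ := hf.crossing i (by omega) hi'
      rw [leftVertex_eq, rightVertex_eq hM] at hij
      refine ⟨_, (hEn _).2 (Or.inl ⟨j, Nat.pos_of_ne_zero ?_, by omega, hj', rfl⟩), hij⟩
      rintro rfl
      have := latticePoint_inj.1 (reachable_of_isolated hij (hf.apex hM hτZ))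
      omega
    · obtain ⟨j, hj, hij⟩ := exists_matched_of_zero hπb (show i < M + 1 by omega)
        ((letterFun_eq_false (by omega)).2 hi')
      have := hf.bottom i j ((isMatched_iff π i j).2 ⟨hij, by omega⟩)
      rw [externalEnd_eq, externalEnd_eq] at this
      exact ⟨_, (hEn _).2 (Or.inr ⟨j, by omega, letterFun_eq_true.1 hij.2.2.1, rfl⟩), this⟩
  obtain ⟨O, h1, h2, h3, h4, h5⟩ := _root_.exists_orientation (hf.degreeLeTwo hM) St En hdisj
    hSu hEu hreach (hcEn.trans hcSt.ge)
  refine ⟨O, h1, h2, h3, fun i hi hi' => ?_, fun j hj hj' hj'' => ?_, fun i hi hi' => ?_,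
    fun i hi hi' => ?_⟩
  · exact h4 _ ((hSt _).2 (Or.inl ⟨i, hi, hi', rfl⟩)) _ (hf.left_ne hM hi)
  · exact h5 _ ((hEn _).2 (Or.inl ⟨j, hj, hj', hj'', rfl⟩)) _ (hf.right_sw hM hj hj').symm
  · refine h4 _ ((hSt _).2 (Or.inr ⟨i, hi, hi', rfl⟩)) _ ?_
    have := hf.external i (by omega)
    rwa [externalEnd_eq, bottomVertex_eq] at this
  · refine h5 _ ((hEn _).2 (Or.inr ⟨i, hi, hi', rfl⟩)) _ ?_
    have := (hf.external i (by omega)).symm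
    rwa [externalEnd_eq, bottomVertex_eq] at this

end FromConfiguration

/-- An assignment of cells is a dimer covering if it is surjective and injective. The cells are
compared as points of the plane. -/
theorem isDimer_of_unique {M : ℕ} {d : ℕ → ℕ → Dir}
    (hout : ∀ X, d X (X + 1) ≠ se)
    (hcell : ∀ S y, y < S → S ≤ M → ∃ X Y, (d X Y).IsReal M X Y ∧
      latticePoint X Y + (d X Y).offset = cellPoint S y)
    (huniq : ∀ X Y X' Y', (d X Y).IsReal M X Y → (d X' Y').IsReal M X' Y' →
      latticePoint X Y + (d X Y).offset = latticePoint X' Y' + (d X' Y').offset →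
        X = X' ∧ Y = Y') : IsDimer M d := by
  have rnw : ∀ {X Y}, Y ≤ X → X ≤ M → nw.IsReal M X Y := fun h1 h2 => ⟨h1, h2, by simp, by simp⟩
  have rsw : ∀ {X y}, y < X → X ≤ M → sw.IsReal M X (y + 1) :=
    fun h1 h2 => ⟨h1, h2, by simp, by simp⟩
  have rne : ∀ {X Y}, Y ≤ X → X < M → ne.IsReal M X Y :=
    fun h1 h2 => ⟨h1, h2.le, by simp [h2], by simp⟩
  have rse : ∀ {X y}, d X (y + 1) = se → y ≤ X → X < M → se.IsReal M X (y + 1) := by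
    intro X y h h1 h2
    refine ⟨?_, h2.le, by simp [h2], by simp⟩
    by_contra h3
    obtain rfl : y = X := by omega
    exact hout _ h
  constructor
  · intro X y hy hX
    constructor
    · rintro (h1 | h1) (h2 | h2)
      · have := huniq X y (X + 1) y (by rw [h1]; exact rne hy hX)
          (by rw [h2]; exact rnw (by omega) hX)
          (by rw [h1, h2, latticePoint_add_ne, latticePoint_add_nw])
        omega
      · have := huniq X y (X + 1) (y + 1) (by rw [h1]; exact rne hy hX)
          (by rw [h2]; exact rsw (by omega) hX)
          (by rw [h1, h2, latticePoint_add_ne, latticePoint_add_sw])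
        omega
      · have := huniq X (y + 1) (X + 1) y (by rw [h1]; exact rse h1 hy hX)
          (by rw [h2]; exact rnw (by omega) hX)
          (by rw [h1, h2, latticePoint_add_se, latticePoint_add_nw])
        omega
      · have := huniq X (y + 1) (X + 1) (y + 1) (by rw [h1]; exact rse h1 hy hX)
          (by rw [h2]; exact rsw (by omega) hX)
          (by rw [h1, h2, latticePoint_add_se, latticePoint_add_sw])
        omega
    · intro h
      obtain ⟨X', Y', hr, h1⟩ := hcell (X + 1) y (by omega) hX
      rcases latticePoint_add_eq_cellPoint hr h1 with ⟨h2, h3, h4⟩ | ⟨h2, h3, h4⟩ | ⟨h2, h3, h4⟩ |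
        ⟨h2, h3, h4⟩
      · subst h3 h4; exact absurd (Or.inl h2) h
      · subst h3 h4; exact absurd (Or.inr h2) h
      · obtain rfl : X' = X := by omega
        subst h4; exact Or.inl h2
      · obtain rfl : X' = X := by omega
        subst h4; exact Or.inr h2
  · rintro X y hy hX ⟨h1, h2⟩
    have := huniq X y X (y + 1) (by rw [h1]; exact rnw hy.le hX) (by rw [h2]; exact rsw hy hX)
      (by rw [h1, h2, latticePoint_add_nw, latticePoint_add_sw])
    omega
  · rintro X y hy hX ⟨h1, h2⟩
    have := huniq X y X (y + 1) (by rw [h1]; exact rne hy hX) (by rw [h2]; exact rse h2 hy hX)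
      (by rw [h1, h2, latticePoint_add_ne, latticePoint_add_se])
    omega

theorem toGraph_adj_of_out {M : ℕ} {d e : ℕ → ℕ → Dir} {X Y : ℕ} (h : (d X Y).IsReal M X Y) :
    (toGraph M d e).Adj (latticePoint X Y) (latticePoint X Y + (d X Y).offset) :=
  toGraph_adj_latticePoint.2 ⟨h, Or.inl rfl⟩

theorem toGraph_adj_of_in {M : ℕ} {d e : ℕ → ℕ → Dir} {X Y : ℕ} (h : (e X Y).IsReal M X Y) :
    (toGraph M d e).Adj (latticePoint X Y) (latticePoint X Y + (e X Y).offset) :=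
  toGraph_adj_latticePoint.2 ⟨h, Or.inr rfl⟩

theorem toGraph_reachable {M : ℕ} {d e : ℕ → ℕ → Dir} {P Q : ℕ × ℕ}
    (h : ReflTransGen (TangleStep M d e) P Q) :
    (toGraph M d e).Reachable (latticePoint P.1 P.2) (latticePoint Q.1 Q.2) := by
  induction h with
  | refl => rfl
  | tail _ h ih =>
    obtain ⟨h1, h2, h3⟩ := h
    refine ih.trans ((toGraph_adj_of_out h1).reachable.trans ?_)
    rw [h3]
    exact (toGraph_adj_of_in h2).symm.reachable

section FromConfiguration

variable {n M : ℕ} {σ τ π : List (Fin 2)} {f : SimpleGraph (ℤ × ℤ)}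

/-- Each configuration comes from a tangle, in which no strand leads from an external edge to one
further left. -/
theorem IsTFPL.exists_isTangle (hf : IsTFPL n σ τ π f) (hM : M + 1 = 2 * n)
    (hσ : σ ∈ dyckWords n) (hτ : τ ∈ dyckWords n) (hπ : π ∈ dyckWords n) :
    ∃ d e, IsTangle M (letterFun σ) (letterFun τ) (letterFun π) d e ∧
      NoReturn M (letterFun π) d e ∧ f = toGraph M d e := by
  classical
  obtain ⟨O, hO1, hO2, hO3, hL, hR, hI, hJ⟩ := hf.exists_orientation hM hσ hτ hπ
  have hσb := dyckWords_isBallot hσ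
  have hτb := dyckWords_isBallot hτ
  have hπb := dyckWords_isBallot hπ
  rw [← hM] at hσb hτb hπb
  obtain ⟨hσl, -, -⟩ := dyckWords_count hσ
  obtain ⟨hτl, -, -⟩ := dyckWords_count hτ
  obtain ⟨hπl, -, -⟩ := dyckWords_count hπ
  have hτZ : τ[0]? = some 0 := (letterFun_eq_false (by omega)).1 hτb.first
  have hσM : σ[M]? = some 1 := letterFun_eq_true.1 hσb.last
  have hout_uni : ∀ {v a b}, O v a → O v b → a = b := orientation_out_unique hO1 hO2 hO3
  have hin_uni : ∀ {v a b}, O a v → O b v → a = b := orientation_in_unique hO1 hO2 hO3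
  have hasym : ∀ {a b}, O a b → ¬ O b a := fun h => (hO2 _ _ (hO1 _ _ h)).1 h
  have hsplit : ∀ {a b}, f.Adj a b → O a b ∨ O b a := fun h => by
    by_contra hcon
    push Not at hcon
    exact hcon.1 ((hO2 _ _ h).2 hcon.2)
  let out : ℕ → ℕ → Dir → Prop := fun X Y D =>
    D.IsReal M X Y ∧ O (latticePoint X Y) (latticePoint X Y + D.offset)
  let inn : ℕ → ℕ → Dir → Prop := fun X Y D =>
    D.IsReal M X Y ∧ O (latticePoint X Y + D.offset) (latticePoint X Y)
  have hout_uni' : ∀ {X Y D D'}, out X Y D → out X Y D' → D = D' := fun h h' =>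
    offset_injective (add_left_cancel (hout_uni h.2 h'.2))
  have hin_uni' : ∀ {X Y D D'}, inn X Y D → inn X Y D' → D = D' := fun h h' =>
    offset_injective (add_left_cancel (hin_uni h.2 h'.2))
  have hout_of : ∀ {X Y b}, O (latticePoint X Y) b → ∃ D, out X Y D := fun h => by
    obtain ⟨D, hD, rfl⟩ := hf.adj_latticePoint hM (hO1 _ _ h)
    exact ⟨D, hD, h⟩
  have hin_of : ∀ {X Y b}, O b (latticePoint X Y) → ∃ D, inn X Y D := fun h => by
    obtain ⟨D, hD, rfl⟩ := hf.adj_latticePoint hM (hO1 _ _ h).symm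
    exact ⟨D, hD, h⟩
  have hsw : ∀ j, ¬ sw.IsReal M j 0 := fun j h => by have := h.2.2.2 (Or.inl rfl); omega
  have hseR : ∀ j, ¬ se.IsReal M j 0 := fun j h => by have := h.2.2.2 (Or.inr rfl); omega
  have hneM : ∀ j, ¬ ne.IsReal M M j := fun j h => by have := h.2.2.1 (Or.inl rfl); omega
  have hseM : ∀ j, ¬ se.IsReal M M j := fun j h => by have := h.2.2.1 (Or.inr rfl); omega
  -- the points without outgoing edge
  have hout_none : ∀ {Y}, Y ≤ M → τ[Y]? = some 0 → ∀ D, ¬ out M Y D := by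
    rintro Y hY ht D ⟨hD, h⟩
    rcases Nat.eq_zero_or_pos Y with rfl | hY0
    · exact hf.apex hM hτZ _ (hO1 _ _ h)
    · have h1 := hR Y hY0 hY ht
      have h2 := hf.right_adj hM hY (hO1 _ _ h)
      rw [ht] at h2
      rcases h2 with h2 | h2
      · rw [h2.2] at h
        exact hasym h h1
      · simp at h2
  have hin_none : ∀ {X}, X ≤ M → σ[X]? = some 1 → ∀ D, ¬ inn X 0 D := by
    rintro X hX hs D ⟨hD, h⟩
    rcases hX.lt_or_eq with hX | rfl
    · have h1 := hL X hX hs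
      have h2 := hf.left_adj hM hX (hO1 _ _ h).symm
      rw [hs] at h2
      rcases h2 with h2 | h2
      · rw [h2] at h
        exact hasym h h1
      · simp at h2
    · exact hf.apex hM hτZ _ (hO1 _ _ h).symm
  have hex : ∀ {X Y}, Y ≤ X → X ≤ M → ((∃ D, out X Y D) ∨ (X = M ∧ τ[Y]? = some 0)) ∧
      ((∃ D, inn X Y D) ∨ (Y = 0 ∧ σ[X]? = some 1)) := by
    intro X Y hY hX
    have hletter : ∀ x : Fin 2, x = 0 ∨ x = 1 := by decide
    -- a point with two edges has an incoming and an outgoing one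
    have htwo : ∀ {a b}, f.Adj (latticePoint X Y) a → f.Adj (latticePoint X Y) b → b ≠ a →
        (∃ D, out X Y D) ∧ ∃ D, inn X Y D := by
      intro a b ha hb hab
      have h3 := hO3 a _ b ha.symm hb hab
      rcases hsplit ha with h | h
      · refine ⟨hout_of h, hin_of (b := b) ?_⟩
        rcases hsplit hb with h' | h'
        · exact absurd (h3.2 h') (hasym h)
        · exact h'
      · exact ⟨hout_of (h3.1 h), hin_of h⟩
    rcases Nat.eq_zero_or_pos Y with rfl | hY0
    · rcases hX.lt_or_eq with hX | rfl
      · have hne := hf.left_ne hM hX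
        rcases hletter (σ[X]'(by omega)) with h | h
        · have h' : σ[X]? = some 0 := by rw [List.getElem?_eq_getElem (by omega), h]
          have hnw := (hf.left_nw hM hX.le).2 h'
          obtain ⟨h1, h2⟩ := htwo hne hnw (by simp [Dir.offset])
          exact ⟨Or.inl h1, Or.inl h2⟩
        · have h' : σ[X]? = some 1 := by rw [List.getElem?_eq_getElem (by omega), h]
          exact ⟨Or.inl (hout_of (hL X hX h')), Or.inr ⟨rfl, h'⟩⟩
      · exact ⟨Or.inr ⟨rfl, hτZ⟩, Or.inr ⟨rfl, hσM⟩⟩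
    · rcases hX.lt_or_eq with hX | rfl
      · obtain ⟨⟨a, ha⟩, b, hb⟩ := orientation_exists hO2 hO3 (hf.degree_point hM hY0 hY hX)
        exact ⟨Or.inl (hout_of hb), Or.inl (hin_of ha)⟩
      · have hswj := hf.right_sw hM hY0 hY
        rcases hletter (τ[Y]'(by omega)) with h | h
        · have h' : τ[Y]? = some 0 := by rw [List.getElem?_eq_getElem (by omega), h]
          exact ⟨Or.inr ⟨rfl, h'⟩, Or.inl (hin_of (hR Y hY0 hY h'))⟩
        · have h' : τ[Y]? = some 1 := by rw [List.getElem?_eq_getElem (by omega), h]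
          have hnw := (hf.right_nw hM hY).2 h'
          obtain ⟨h1, h2⟩ := htwo hswj hnw (by simp [Dir.offset])
          exact ⟨Or.inl h1, Or.inl h2⟩
  let d : ℕ → ℕ → Dir := fun X Y => if h : ∃ D, out X Y D then h.choose else ne
  let e : ℕ → ℕ → Dir := fun X Y => if h : ∃ D, inn X Y D then h.choose else sw
  have hd1 : ∀ {X Y D}, out X Y D → d X Y = D := fun {X Y D} h => by
    have h' : ∃ D, out X Y D := ⟨D, h⟩
    simp only [d, dif_pos h']
    exact hout_uni' h'.choose_spec h
  have he1 : ∀ {X Y D}, inn X Y D → e X Y = D := fun {X Y D} h => by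
    have h' : ∃ D, inn X Y D := ⟨D, h⟩
    simp only [e, dif_pos h']
    exact hin_uni' h'.choose_spec h
  have hd0 : ∀ {X Y}, (∀ D, ¬ out X Y D) → d X Y = ne := fun {X Y} h => by
    simp only [d, dif_neg (not_exists.2 h)]
  have he0 : ∀ {X Y}, (∀ D, ¬ inn X Y D) → e X Y = sw := fun {X Y} h => by
    simp only [e, dif_neg (not_exists.2 h)]
  have hdout : ∀ X Y, X < Y ∨ M < X → d X Y = ne := fun X Y h =>
    hd0 fun D hD => by have := hD.1.1; have := hD.1.2.1; omega
  have heout : ∀ X Y, X < Y ∨ M < X → e X Y = sw := fun X Y h =>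
    he0 fun D hD => by have := hD.1.1; have := hD.1.2.1; omega
  have hdcol : ∀ {Y}, Y ≤ M → τ[Y]? = some 0 → d M Y = ne := fun h1 h2 => hd0 (hout_none h1 h2)
  have herow : ∀ {X}, X ≤ M → σ[X]? = some 1 → e X 0 = sw := fun h1 h2 => he0 (hin_none h1 h2)
  have hd2 : ∀ {X Y D}, D.IsReal M X Y → d X Y = D → out X Y D := by
    intro X Y D hD h
    rcases (hex hD.1 hD.2.1).1 with ⟨D', h'⟩ | ⟨rfl, h'⟩
    · rwa [← h, hd1 h']
    · rw [hdcol hD.1 h'] at h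
      subst h
      exact absurd hD (hneM _)
  have he2 : ∀ {X Y D}, D.IsReal M X Y → e X Y = D → inn X Y D := by
    intro X Y D hD h
    rcases (hex hD.1 hD.2.1).2 with ⟨D', h'⟩ | ⟨rfl, h'⟩
    · rwa [← h, he1 h']
    · rw [herow hD.2.1 h'] at h
      subst h
      exact absurd hD (hsw _)
  have hcell : ∀ S y, y < S → S ≤ M → (∃ X Y, (d X Y).IsReal M X Y ∧
      latticePoint X Y + (d X Y).offset = cellPoint S y) ∧ ∃ X Y, (e X Y).IsReal M X Y ∧
      latticePoint X Y + (e X Y).offset = cellPoint S y := by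
    intro S y hy hS
    obtain ⟨⟨a, ha⟩, b, hb⟩ := orientation_exists hO2 hO3 (hf.degree_cell hM hy hS)
    obtain ⟨X, Y, D, hD, rfl, h1⟩ :=
      triangleGraph_adj_cellPoint hM (hf.le_triangle (hO1 _ _ ha).symm)
    obtain ⟨X', Y', D', hD', rfl, h1'⟩ :=
      triangleGraph_adj_cellPoint hM (hf.le_triangle (hO1 _ _ hb))
    rw [← h1] at ha
    rw [← h1'] at hb
    refine ⟨⟨X, Y, ?_⟩, ⟨X', Y', ?_⟩⟩
    · rw [hd1 ⟨hD, ha⟩]; exact ⟨hD, h1⟩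
    · rw [he1 ⟨hD', hb⟩]; exact ⟨hD', h1'⟩
  have hgraph : f = toGraph M d e := by
    have key : ∀ X Y D, Dir.IsReal M X Y D →
        (f.Adj (latticePoint X Y) (latticePoint X Y + D.offset) ↔
          (toGraph M d e).Adj (latticePoint X Y) (latticePoint X Y + D.offset)) := by
      intro X Y D hD
      rw [toGraph_adj_latticePoint]
      constructor
      · intro h
        refine ⟨hD, ?_⟩
        rcases hsplit h with h | h
        · exact Or.inl (hd1 ⟨hD, h⟩)
        · exact Or.inr (he1 ⟨hD, h⟩)
      · rintro ⟨-, h | h⟩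
        · exact hO1 _ _ (hd2 hD h).2
        · exact (hO1 _ _ (he2 hD h).2).symm
    ext a b
    constructor
    · intro h
      obtain ⟨X, Y, D, hD, ⟨rfl, rfl⟩ | ⟨rfl, rfl⟩⟩ := triangleGraph_adj hM (hf.le_triangle h)
      · exact (key X Y D hD).1 h
      · exact ((key X Y D hD).1 h.symm).symm
    · intro h
      obtain ⟨X, Y, D, hD, ⟨rfl, rfl⟩ | ⟨rfl, rfl⟩⟩ := triangleGraph_adj hM (toGraph_le hM d e h)
      · exact (key X Y D hD).2 h
      · exact ((key X Y D hD).2 h.symm).symm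
  have hrow_real : ∀ {X D}, Dir.IsReal M X 0 D → D ≠ sw ∧ D ≠ se := by
    rintro X D hD
    exact ⟨by rintro rfl; exact hsw _ hD, by rintro rfl; exact hseR _ hD⟩
  have hcol_real : ∀ {Y D}, Dir.IsReal M M Y D → D ≠ ne ∧ D ≠ se := by
    rintro Y D hD
    exact ⟨by rintro rfl; exact hneM _ hD, by rintro rfl; exact hseM _ hD⟩
  have hnw : ∀ {X}, X ≤ M → nw.IsReal M X X := fun hX => ⟨le_rfl, hX, by simp, by simp⟩
  refine ⟨d, e, ⟨hdout, heout, ?_, ?_, ?_, ?_, ?_, ?_, ?_, ?_, ?_⟩, ?_, hgraph⟩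
  · refine isDimer_of_unique (fun X => by rw [hdout X (X + 1) (by omega)]; simp)
      (fun S y hy hS => (hcell S y hy hS).1) fun X Y X' Y' h h' heq => ?_
    have h1 := (hd2 h rfl).2
    rw [heq] at h1
    exact latticePoint_inj.1 (hin_uni h1 (hd2 h' rfl).2)
  · refine isDimer_of_unique (fun X => by rw [heout X (X + 1) (by omega)]; simp)
      (fun S y hy hS => (hcell S y hy hS).2) fun X Y X' Y' h h' heq => ?_
    have h1 := (he2 h rfl).2
    rw [heq] at h1
    exact latticePoint_inj.1 (hout_uni h1 (he2 h' rfl).2)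
  · intro X Y hY hX h
    rcases (hex hY hX).1 with ⟨D, h1⟩ | ⟨rfl, h1⟩
    · have h2 := hd1 h1
      have h3 := he2 h1.1 (h.symm.trans h2)
      exact hasym h1.2 h3.2
    · rw [hdcol hY h1] at h
      rcases (hex hY le_rfl).2 with ⟨D', h2⟩ | ⟨rfl, h2⟩
      · rw [he1 h2] at h
        subst h
        exact hneM _ h2.1
      · rw [herow le_rfl h2] at h
        simp at h
  · intro X hX
    refine ⟨fun h => ?_, fun h => hd1 ⟨hnw hX, ?_⟩⟩
    · by_contra h1
      have h1 := (letterFun_eq_false (show X < π.length by omega)).1 (by simpa using h1)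
      have h2 := (hd2 (hnw hX) h).2
      rw [latticePoint_add_nw] at h2
      exact hasym h2 (hI X hX h1)
    · rw [latticePoint_add_nw]
      exact hJ X hX (letterFun_eq_true.1 h)
  · intro X hX
    refine ⟨fun h => ?_, fun h => he1 ⟨hnw hX, ?_⟩⟩
    · by_contra h1
      have h1 := letterFun_eq_true.1 (by simpa using h1)
      have h2 := (he2 (hnw hX) h).2
      rw [latticePoint_add_nw] at h2
      exact hasym h2 (hJ X hX h1)
    · rw [latticePoint_add_nw]
      exact hI X hX ((letterFun_eq_false (by omega)).1 h)
  · intro X hX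
    rcases hX.lt_or_eq with hlt | rfl
    · obtain ⟨D, h1⟩ := (hex (Nat.zero_le X) hX).1.resolve_right (by omega)
      refine ⟨?_, ?_, fun h => hd1 ⟨⟨Nat.zero_le _, hX, by simp [hlt], by simp⟩, ?_⟩⟩
      · rw [hd1 h1]; exact (hrow_real h1.1).1
      · rw [hd1 h1]; exact (hrow_real h1.1).2
      · exact hL X hlt (letterFun_eq_true.1 h)
    · rw [hdcol (Nat.zero_le _) hτZ]; simp
  · intro X hX
    rw [letterFun_eq_true]
    rcases (hex (Nat.zero_le X) hX).2 with ⟨D, h1⟩ | ⟨-, h1⟩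
    · rw [he1 h1]
      exact ⟨(hrow_real h1.1).2, fun h => absurd h (hrow_real h1.1).1,
        fun h => absurd h1 (hin_none hX h D)⟩
    · rw [herow hX h1]; simp [h1]
  · intro Y hY
    rw [letterFun_eq_false (show Y < τ.length by omega)]
    rcases (hex hY le_rfl).1 with ⟨D, h1⟩ | ⟨-, h1⟩
    · rw [hd1 h1]
      exact ⟨(hcol_real h1.1).2, fun h => absurd h (hcol_real h1.1).1,
        fun h => absurd h1 (hout_none hY h D)⟩
    · rw [hdcol hY h1]; simp [h1]
  · intro Y hY
    rw [letterFun_eq_false (show Y < τ.length by omega)]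
    rcases (hex hY le_rfl).2 with ⟨D, h1⟩ | ⟨rfl, h1⟩
    · rw [he1 h1]
      refine ⟨(hcol_real h1.1).1, (hcol_real h1.1).2, fun h => ?_⟩
      rcases Nat.eq_zero_or_pos Y with rfl | hY0
      · exact absurd h1 (hin_none le_rfl hσM D)
      · exact hin_uni' h1 ⟨⟨hY, le_rfl, by simp, by simp [hY0]⟩, hR Y hY0 hY h⟩
    · rw [herow le_rfl h1]; simp
  · intro i j hi hj hpi hpj hreach
    obtain ⟨j', hj', hij'⟩ := exists_matched_of_zero hπb (show i < M + 1 by omega) hpi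
    have h1 := hf.bottom i j' ((isMatched_iff π i j').2 ⟨hij', by omega⟩)
    rw [externalEnd_eq, externalEnd_eq] at h1
    have h2 := toGraph_reachable hreach
    rw [← hgraph] at h2
    simp only at h2
    have hext : ∀ k ≤ M, f.Adj (cellPoint k k) (latticePoint k k) := fun k hk => by
      have := hf.external k (by omega)
      rwa [externalEnd_eq, bottomVertex_eq] at this
    have h3 : f.Reachable (cellPoint i i) (cellPoint j j) :=
      (hext i hi).reachable.trans (h2.trans (hext j hj).symm.reachable)
    have huni : ∀ k a b, f.Adj (cellPoint k k) a → f.Adj (cellPoint k k) b → a = b :=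
      fun k a b ha hb => (hf.external_unique hM ha).trans (hf.external_unique hM hb).symm
    have hne : ∀ k, letterFun π k = true → cellPoint k k ≠ cellPoint i i := fun k hk h => by
      obtain ⟨rfl, -⟩ := cellPoint_inj.1 h
      rw [hpi] at hk; cases hk
    have h4 := end_unique_of_reachable (hf.degreeLeTwo hM) (huni i) (huni j) (huni j') h3 h1
      (hne j hpj) (hne j' hij'.2.2.1)
    obtain ⟨rfl, -⟩ := cellPoint_inj.1 h4
    exact hij'.1

end FromConfiguration

/-! ### From tangles to configurations -/

section ToConfiguration

variable {n M : ℕ} {s t p : ℕ → Bool} {σ τ π : List (Fin 2)} {d e : ℕ → ℕ → Dir}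

theorem IsTangle.in_isReal (h : IsTangle M s t p d e) {X Y : ℕ} (hY : Y ≤ X) (hX : X ≤ M)
    (hne : Y = 0 → e X Y ≠ sw) : (e X Y).IsReal M X Y := by
  refine ⟨hY, hX, ?_, ?_⟩
  · rintro (h1 | h1)
    · by_contra h2
      obtain rfl : X = M := by omega
      exact (h.in_col Y hY).1 h1
    · by_contra h2
      obtain rfl : X = M := by omega
      exact (h.in_col Y hY).2.1 h1
  · rintro (h1 | h1) <;> by_contra h2
    · exact hne (by omega) h1
    · obtain rfl : Y = 0 := by omega
      exact (h.in_row X hX).1 h1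

/-- A tangle in which no strand leads from an external edge to one further left is a
configuration. -/
theorem IsTangle.isTFPL (h : IsTangle M (letterFun σ) (letterFun τ) (letterFun π) d e)
    (hM : M + 1 = 2 * n) (hσ : σ.length = 2 * n) (hτ : τ.length = 2 * n) (hπ : π ∈ dyckWords n)
    (hmono : NoReturn M (letterFun π) d e) :
    IsTFPL n σ τ π (toGraph M d e) := by
  have hπb := dyckWords_isBallot hπ
  rw [← hM] at hπb
  have hext : ∀ i ≤ M, (toGraph M d e).Adj (cellPoint i i) (latticePoint i i) := by
    intro i hi
    rw [← latticePoint_add_nw]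
    refine (toGraph_adj_latticePoint.2 ⟨⟨le_rfl, hi, by simp, by simp⟩, ?_⟩).symm
    cases hp : letterFun π i
    · exact Or.inr ((h.in_diag i hi).2 hp)
    · exact Or.inl ((h.out_diag i hi).2 hp)
  have hsub : ∀ P : ℤ × ℤ, P - (0, 1) = P + nw.offset ∧ P - (1, 0) = P + sw.offset ∧
      P + (1, 0) = P + ne.offset := fun P => by
    simp [Dir.offset, sub_eq_add_neg]
  constructor
  · exact toGraph_le hM d e
  · intro i hi
    rw [externalEnd_eq, bottomVertex_eq]
    exact hext i (by omega)
  · intro P hP hPL hPR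
    rcases inTriangle_cases hM hP with ⟨X, Y, hY, hX, rfl⟩ | ⟨S, y, hy, hS, rfl⟩
    · have hY0 : Y ≠ 0 := by
        rintro rfl
        exact hPL X (by omega) (leftVertex_eq X).symm
      have hXM : X ≠ M := by
        rintro rfl
        exact hPR Y (by omega) (rightVertex_eq hM Y).symm
      have h1 := h.out_isReal hY hX (fun h => absurd h hXM)
      have h2 := h.in_isReal hY hX (fun h => absurd h hY0)
      have hset : (toGraph M d e).neighborSet (latticePoint X Y) =
          {latticePoint X Y + (d X Y).offset, latticePoint X Y + (e X Y).offset} := by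
        ext b
        simp only [SimpleGraph.mem_neighborSet, Set.mem_insert_iff, Set.mem_singleton_iff]
        constructor
        · intro hb
          obtain ⟨D, hD, rfl⟩ := triangleGraph_adj_latticePoint hM (toGraph_le hM d e hb)
          rcases (toGraph_adj_latticePoint.1 hb).2 with rfl | rfl
          · exact Or.inl rfl
          · exact Or.inr rfl
        · rintro (rfl | rfl)
          · exact toGraph_adj_of_out h1
          · exact toGraph_adj_of_in h2
      rw [hset, Set.ncard_pair]
      intro heq
      exact h.disjoint X Y hY hX (offset_injective (add_left_cancel heq))
    · obtain ⟨X1, Y1, h1, h1'⟩ := h.out_dimer.exists_point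
        (fun X => by rw [h.out_outside X (X + 1) (by simp)]; simp) hy hS
      obtain ⟨X2, Y2, h2, h2'⟩ := h.in_dimer.exists_point
        (fun X => by rw [h.in_outside X (X + 1) (by simp)]; simp) hy hS
      change _ = cellPoint S y at h1' h2'
      have hset : (toGraph M d e).neighborSet (cellPoint S y) =
          {latticePoint X1 Y1, latticePoint X2 Y2} := by
        ext b
        simp only [SimpleGraph.mem_neighborSet, Set.mem_insert_iff, Set.mem_singleton_iff,
          toGraph_adj_cellPoint hM]
        constructor
        · rintro ⟨X, Y, D, hD, rfl, h3, rfl | rfl⟩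
          · left
            obtain ⟨rfl, rfl⟩ := h.out_dimer.injective hD h1 (h3.trans h1'.symm)
            rfl
          · right
            obtain ⟨rfl, rfl⟩ := h.in_dimer.injective hD h2 (h3.trans h2'.symm)
            rfl
        · rintro (rfl | rfl)
          · exact ⟨X1, Y1, _, h1, rfl, h1', Or.inl rfl⟩
          · exact ⟨X2, Y2, _, h2, rfl, h2', Or.inr rfl⟩
      rw [hset, Set.ncard_pair]
      intro heq
      obtain ⟨rfl, rfl⟩ := latticePoint_inj.1 heq
      exact h.disjoint X1 Y1 h1.1 h1.2.1
        (offset_injective (add_left_cancel (h1'.trans h2'.symm)))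
  · intro i hi
    rw [leftVertex_eq, (hsub _).2.2, toGraph_adj_latticePoint]
    have h1 := h.out_row i (by omega)
    have h2 := h.in_row i (by omega)
    have h3 := h.disjoint i 0 (Nat.zero_le _) (by omega)
    refine ⟨⟨Nat.zero_le _, by omega, by simp; omega, by simp⟩, ?_⟩
    cases hs : letterFun σ i <;> rcases hd : d i 0 with _ | _ | _ | _ <;>
      rcases he : e i 0 with _ | _ | _ | _ <;> simp_all
  · intro i hi
    rw [leftVertex_eq, (hsub _).1, toGraph_adj_latticePoint,
      ← letterFun_eq_false (show i < σ.length by omega)]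
    have h1 := h.out_row i (by omega)
    have h2 := h.in_row i (by omega)
    have h3 := h.disjoint i 0 (Nat.zero_le _) (by omega)
    have h4 : nw.IsReal M i 0 := ⟨Nat.zero_le _, by omega, by simp, by simp⟩
    cases hs : letterFun σ i <;> rcases hd : d i 0 with _ | _ | _ | _ <;>
      rcases he : e i 0 with _ | _ | _ | _ <;> simp_all
  · intro j hj hj'
    rw [rightVertex_eq hM, (hsub _).2.1, toGraph_adj_latticePoint]
    have h1 := h.out_col j (by omega)
    have h2 := h.in_col j (by omega)
    have h3 := h.disjoint M j (by omega) le_rfl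
    refine ⟨⟨by omega, le_rfl, by simp, by simp; omega⟩, ?_⟩
    cases hs : letterFun τ j <;> rcases hd : d M j with _ | _ | _ | _ <;>
      rcases he : e M j with _ | _ | _ | _ <;> simp_all
  · intro j hj
    rw [rightVertex_eq hM, (hsub _).1, toGraph_adj_latticePoint, ← letterFun_eq_true]
    have h1 := h.out_col j (by omega)
    have h2 := h.in_col j (by omega)
    have h3 := h.disjoint M j (by omega) le_rfl
    have h4 : nw.IsReal M M j := ⟨by omega, le_rfl, by simp, by simp⟩
    cases hs : letterFun τ j <;> rcases hd : d M j with _ | _ | _ | _ <;>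
      rcases he : e M j with _ | _ | _ | _ <;> simp_all
  · intro i hi hi'
    obtain ⟨j, hj, hj', hij⟩ := h.reaches_right hπb (show i ≤ M by omega) (letterFun_eq_true.2 hi')
    refine ⟨j, by omega, (letterFun_eq_false (by omega)).1 hj', ?_⟩
    rw [leftVertex_eq, rightVertex_eq hM]
    exact toGraph_reachable hij
  · intro i j hij
    obtain ⟨hij, hj⟩ := (isMatched_iff π i j).1 hij
    have hπl : π.length = 2 * n := hπ.1
    have hlt := hij.1
    have h1 := toGraph_reachable (h.reaches_matched hπb hπb.last hmono (by omega) hij)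
    rw [externalEnd_eq, externalEnd_eq]
    exact (hext i (by omega)).reachable.trans (h1.trans (hext j (by omega)).symm.reachable)

end ToConfiguration

/-! ### Tangles built column by column -/

/-- A column of directions that uses exactly the cells outside `L` to its left and, if there is a
further column, exactly the cells in `R` to its right. -/
structure IsColumn (M X : ℕ) (L R : ℕ → Prop) (c : ℕ → Dir) : Prop where
  left : ∀ y < X, (c y = nw ∨ c (y + 1) = sw) ↔ ¬ L y
  left_excl : ∀ y < X, ¬ (c y = nw ∧ c (y + 1) = sw)
  right : X < M → ∀ y ≤ X, (c y = ne ∨ (y < X ∧ c (y + 1) = se)) ↔ R y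
  right_excl : ∀ y < X, ¬ (c y = ne ∧ c (y + 1) = se)

/-- Columns that agree on which cells of the strip between them are used by the left one fit
together. -/
theorem isDimer_of_isColumn {M : ℕ} {d : ℕ → ℕ → Dir} {κ : ℕ → ℕ → Prop}
    (h : ∀ X ≤ M, IsColumn M X (κ X) (κ (X + 1)) (d X)) (hout : ∀ X, d X (X + 1) ≠ se) :
    IsDimer M d := by
  constructor
  · intro X y hy hX
    rw [usesLeft, (h (X + 1) hX).left y (by omega), not_not, ← (h X hX.le).right hX y hy, usesRight]
    refine or_congr_right ⟨fun h' => ⟨lt_of_le_of_ne hy ?_, h'⟩, fun h' => h'.2⟩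
    rintro rfl
    exact hout _ h'
  · intro X y hy hX
    exact (h X hX).left_excl y hy
  · intro X y hy hX
    rcases hy.lt_or_eq with hy | rfl
    · exact (h X hX.le).right_excl y hy
    · exact fun h' => hout _ h'.2

theorem IsColumn.congr {M X : ℕ} {L R : ℕ → Prop} {c c' : ℕ → Dir} (h : IsColumn M X L R c)
    (hc : ∀ y ≤ X, c' y = c y) : IsColumn M X L R c' := by
  constructor
  · intro y hy; rw [hc y hy.le, hc (y + 1) hy]; exact h.left y hy
  · intro y hy; rw [hc y hy.le, hc (y + 1) hy]; exact h.left_excl y hy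
  · intro hX y hy
    rw [hc y hy, ← h.right hX y hy]
    exact or_congr_right (and_congr_right fun h' => by rw [hc (y + 1) h'])
  · intro y hy; rw [hc y hy.le, hc (y + 1) hy]; exact h.right_excl y hy

/-- A description of tangles by states. The state `x` of the strip to the left of column `X`
determines which cells of the strip are used by column `X - 1`: those in `usedOut X x` for the
outgoing and those in `usedIn X x` for the incoming edges. The directions in column `X` are
determined by the states of the two adjacent strips. -/
structure ColumnModel (α : Type*) where
  /-- The state of the strip before the first column. -/
  start : α
  /-- The possible transitions at a column. -/
  step : ℕ → α → α → Prop
  /-- A property of the states that occur. -/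
  inv : ℕ → α → Prop
  /-- The cells of a strip assigned to the previous column by the outgoing edges. -/
  usedOut : ℕ → α → ℕ → Prop
  /-- The cells of a strip assigned to the previous column by the incoming edges. -/
  usedIn : ℕ → α → ℕ → Prop
  /-- The outgoing directions in a column. -/
  colOut : ℕ → α → α → ℕ → Dir
  /-- The incoming directions in a column. -/
  colIn : ℕ → α → α → ℕ → Dir

namespace ColumnModel

variable {α : Type*} (m : ColumnModel α) {M : ℕ} {s t p : ℕ → Bool}

/-- A sequence of states, with the value `start` beyond column `M`. -/
structure IsChain (M : ℕ) (g : ℕ → α) : Prop where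
  zero : g 0 = m.start
  step : ∀ X ≤ M, m.step X (g X) (g (X + 1))
  beyond : ∀ X, M + 1 < X → g X = m.start

/-- The outgoing directions of a sequence of states. -/
def outDir (M : ℕ) (g : ℕ → α) (X Y : ℕ) : Dir :=
  if Y ≤ X ∧ X ≤ M then m.colOut X (g X) (g (X + 1)) Y else ne

/-- The incoming directions of a sequence of states. -/
def inDir (M : ℕ) (g : ℕ → α) (X Y : ℕ) : Dir :=
  if Y ≤ X ∧ X ≤ M then m.colIn X (g X) (g (X + 1)) Y else sw

/-- The conditions under which each sequence of states gives a tangle. -/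
structure IsValid (M : ℕ) (s p : ℕ → Bool) : Prop where
  inv_start : m.inv 0 m.start
  inv_step : ∀ X ≤ M, ∀ x x', m.inv X x → m.step X x x' → m.inv (X + 1) x'
  out_column : ∀ X ≤ M, ∀ x x', m.inv X x → m.step X x x' →
    IsColumn M X (m.usedOut X x) (m.usedOut (X + 1) x') (m.colOut X x x')
  in_column : ∀ X ≤ M, ∀ x x', m.inv X x → m.step X x x' →
    IsColumn M X (m.usedIn X x) (m.usedIn (X + 1) x') (m.colIn X x x')
  disjoint : ∀ X ≤ M, ∀ x x', m.inv X x → m.step X x x' →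
    ∀ y ≤ X, m.colOut X x x' y ≠ m.colIn X x x' y
  diag : ∀ X ≤ M, ∀ x x', m.inv X x → m.step X x x' →
    (m.colOut X x x' X = nw ↔ p X = true) ∧ (m.colIn X x x' X = nw ↔ p X = false)
  row : ∀ X ≤ M, ∀ x x', m.inv X x → m.step X x x' →
    (m.colOut X x x' 0 ≠ sw ∧ m.colOut X x x' 0 ≠ se ∧ (s X = true → m.colOut X x x' 0 = ne)) ∧
      m.colIn X x x' 0 ≠ se ∧ (m.colIn X x x' 0 = sw ↔ s X = true)
  last : ∀ x x', m.inv M x → m.step M x x' → ∀ y ≤ M,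
    (m.colOut M x x' y ≠ se ∧ (m.colOut M x x' y = ne ↔ m.usedOut M x y)) ∧
      m.colIn M x x' y = sw

variable {m}

theorem IsChain.inv {g : ℕ → α} (hg : m.IsChain M g) (hm : m.IsValid M s p) {X : ℕ}
    (hX : X ≤ M + 1) : m.inv X (g X) := by
  induction X with
  | zero => rw [hg.zero]; exact hm.inv_start
  | succ X ih => exact hm.inv_step X (by omega) _ _ (ih (by omega)) (hg.step X (by omega))

theorem outDir_eq {g : ℕ → α} {X Y : ℕ} (hY : Y ≤ X) (hX : X ≤ M) :
    m.outDir M g X Y = m.colOut X (g X) (g (X + 1)) Y := if_pos ⟨hY, hX⟩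

theorem inDir_eq {g : ℕ → α} {X Y : ℕ} (hY : Y ≤ X) (hX : X ≤ M) :
    m.inDir M g X Y = m.colIn X (g X) (g (X + 1)) Y := if_pos ⟨hY, hX⟩

/-- The right boundary word of the tangle is read off the cells used in the last strip. -/
theorem IsChain.isTangle {g : ℕ → α} (hg : m.IsChain M g) (hm : m.IsValid M s p)
    (ht : ∀ Y ≤ M, t Y = false ↔ m.usedOut M (g M) Y) :
    IsTangle M s t p (m.outDir M g) (m.inDir M g) := by
  have hinv : ∀ {X}, X ≤ M → m.inv X (g X) := fun hX => hg.inv hm (by omega)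
  have hout : ∀ X Y, X < Y ∨ M < X → m.outDir M g X Y = ne := fun X Y h => if_neg (by omega)
  have hin : ∀ X Y, X < Y ∨ M < X → m.inDir M g X Y = sw := fun X Y h => if_neg (by omega)
  refine ⟨hout, hin, ?_, ?_, ?_, ?_, ?_, ?_, ?_, ?_, ?_⟩
  · refine isDimer_of_isColumn (κ := fun X => m.usedOut X (g X)) (fun X hX => ?_)
      fun X => by rw [hout X (X + 1) (by omega)]; simp
    exact (hm.out_column X hX _ _ (hinv hX) (hg.step X hX)).congr fun y hy => outDir_eq hy hX
  · refine isDimer_of_isColumn (κ := fun X => m.usedIn X (g X)) (fun X hX => ?_)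
      fun X => by rw [hin X (X + 1) (by omega)]; simp
    exact (hm.in_column X hX _ _ (hinv hX) (hg.step X hX)).congr fun y hy => inDir_eq hy hX
  · intro X Y hY hX
    rw [outDir_eq hY hX, inDir_eq hY hX]
    exact hm.disjoint X hX _ _ (hinv hX) (hg.step X hX) Y hY
  · intro X hX
    rw [outDir_eq le_rfl hX]
    exact (hm.diag X hX _ _ (hinv hX) (hg.step X hX)).1
  · intro X hX
    rw [inDir_eq le_rfl hX]
    exact (hm.diag X hX _ _ (hinv hX) (hg.step X hX)).2
  · intro X hX
    rw [outDir_eq (Nat.zero_le _) hX]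
    exact (hm.row X hX _ _ (hinv hX) (hg.step X hX)).1
  · intro X hX
    rw [inDir_eq (Nat.zero_le _) hX]
    exact (hm.row X hX _ _ (hinv hX) (hg.step X hX)).2
  · intro Y hY
    rw [outDir_eq hY le_rfl, ht Y hY]
    exact (hm.last _ _ (hinv le_rfl) (hg.step M le_rfl) Y hY).1
  · intro Y hY
    rw [inDir_eq hY le_rfl, (hm.last _ _ (hinv le_rfl) (hg.step M le_rfl) Y hY).2]
    simp

/-- What is known about column `X` of a tangle when the strip to its left is in state `x`. -/
structure Fits (m : ColumnModel α) (M : ℕ) (s p : ℕ → Bool) (X : ℕ) (x : α) (c c' : ℕ → Dir) :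
    Prop where
  out_left : ∀ y < X, (c y = nw ∨ c (y + 1) = sw) ↔ ¬ m.usedOut X x y
  in_left : ∀ y < X, (c' y = nw ∨ c' (y + 1) = sw) ↔ ¬ m.usedIn X x y
  out_left_excl : ∀ y < X, ¬ (c y = nw ∧ c (y + 1) = sw)
  in_left_excl : ∀ y < X, ¬ (c' y = nw ∧ c' (y + 1) = sw)
  out_right_excl : ∀ y < X, ¬ (c y = ne ∧ c (y + 1) = se)
  in_right_excl : ∀ y < X, ¬ (c' y = ne ∧ c' (y + 1) = se)
  disjoint : ∀ y ≤ X, c y ≠ c' y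
  out_diag : c X = nw ↔ p X = true
  in_diag : c' X = nw ↔ p X = false
  out_row : c 0 ≠ sw ∧ c 0 ≠ se
  in_row : c' 0 ≠ se ∧ (c' 0 = sw ↔ s X = true)
  out_last : X = M → ∀ y ≤ M, c y ≠ se

/-- The columns before `X` of a tangle follow the model. -/
structure Follows (m : ColumnModel α) (X : ℕ) (g : ℕ → α) (d e : ℕ → ℕ → Dir) : Prop where
  zero : g 0 = m.start
  step : ∀ j < X, m.step j (g j) (g (j + 1))
  out : ∀ j < X, ∀ y ≤ j, d j y = m.colOut j (g j) (g (j + 1)) y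
  inn : ∀ j < X, ∀ y ≤ j, e j y = m.colIn j (g j) (g (j + 1)) y

theorem Follows.inv {g : ℕ → α} {d e : ℕ → ℕ → Dir} {X j : ℕ} (hg : m.Follows X g d e)
    (hm : m.IsValid M s p) (hX : X ≤ M + 1) (hj : j ≤ X) : m.inv j (g j) := by
  induction j with
  | zero => rw [hg.zero]; exact hm.inv_start
  | succ j ih => exact hm.inv_step j (by omega) _ _ (ih (by omega)) (hg.step j (by omega))

theorem Follows.fits {g : ℕ → α} {d e : ℕ → ℕ → Dir} {X : ℕ} (hg : m.Follows X g d e)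
    (hm : m.IsValid M s p) (h : IsTangle M s t p d e) (hX : X ≤ M) :
    m.Fits M s p X (g X) (d X) (e X) := by
  refine ⟨?_, ?_, fun y hy => h.out_dimer.left_excl X y hy hX,
    fun y hy => h.in_dimer.left_excl X y hy hX, ?_, ?_, fun y hy => h.disjoint X y hy hX,
    h.out_diag X hX, h.in_diag X hX, ⟨(h.out_row X hX).1, (h.out_row X hX).2.1⟩, h.in_row X hX, ?_⟩
  · intro y hy
    obtain ⟨j, rfl⟩ : ∃ j, X = j + 1 := ⟨X - 1, by omega⟩
    have h1 := h.out_dimer.cell j y (by omega) hX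
    have h2 := (hm.out_column j (by omega) _ _ (hg.inv hm (by omega) (by omega))
      (hg.step j (by omega))).congr (hg.out j (by omega))
    rw [← h2.right (by omega) y (by omega), ← not_iff_not, not_not, iff_comm]
    refine Iff.trans (or_congr_right ⟨fun h' => h'.2, fun h' => ⟨?_, h'⟩⟩) h1
    by_contra hcon
    obtain rfl : y = j := by omega
    rw [h.out_outside y (y + 1) (by omega)] at h'
    cases h'
  · intro y hy
    obtain ⟨j, rfl⟩ : ∃ j, X = j + 1 := ⟨X - 1, by omega⟩
    have h1 := h.in_dimer.cell j y (by omega) hX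
    have h2 := (hm.in_column j (by omega) _ _ (hg.inv hm (by omega) (by omega))
      (hg.step j (by omega))).congr (hg.inn j (by omega))
    rw [← h2.right (by omega) y (by omega), ← not_iff_not, not_not, iff_comm]
    refine Iff.trans (or_congr_right ⟨fun h' => h'.2, fun h' => ⟨?_, h'⟩⟩) h1
    by_contra hcon
    obtain rfl : y = j := by omega
    rw [h.in_outside y (y + 1) (by omega)] at h'
    cases h'
  · intro y hy ⟨h1, h2⟩
    rcases hX.lt_or_eq with hX | rfl
    · exact h.out_dimer.right_excl X y hy.le hX ⟨h1, h2⟩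
    · exact (h.out_col (y + 1) hy).1 h2
  · intro y hy ⟨h1, h2⟩
    rcases hX.lt_or_eq with hX | rfl
    · exact h.in_dimer.right_excl X y hy.le hX ⟨h1, h2⟩
    · exact (h.in_col (y + 1) hy).2.1 h2
  · rintro rfl y hy
    exact (h.out_col y hy).1

/-- Some transition from the state `x` describes the column with the directions `c` and `c'`. -/
def Continues (m : ColumnModel α) (X : ℕ) (x : α) (c c' : ℕ → Dir) : Prop :=
  ∃ x', m.step X x x' ∧ ∀ y ≤ X, c y = m.colOut X x x' y ∧ c' y = m.colIn X x x' y

/-- A tangle each of whose columns continues the model follows the model. -/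
theorem exists_isChain {d e : ℕ → ℕ → Dir} (hm : m.IsValid M s p) (h : IsTangle M s t p d e)
    (hstep : ∀ X ≤ M, ∀ g, m.Follows X g d e → m.inv X (g X) →
      m.Fits M s p X (g X) (d X) (e X) → m.Continues X (g X) (d X) (e X)) :
    ∃ g, m.IsChain M g ∧ d = m.outDir M g ∧ e = m.inDir M g := by
  have key : ∀ X ≤ M + 1, ∃ g, m.Follows X g d e ∧ ∀ j, X < j → g j = m.start := by
    intro X
    induction X with
    | zero => exact fun _ => ⟨fun _ => m.start, ⟨rfl, by simp, by simp, by simp⟩, fun _ _ => rfl⟩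
    | succ X ih =>
      intro hX
      obtain ⟨g, hg, hg'⟩ := ih (by omega)
      obtain ⟨x', hx', hcol⟩ := hstep X (by omega) g hg (hg.inv hm (by omega) le_rfl)
        (hg.fits hm h (by omega))
      have h1 : ∀ j ≤ X, Function.update g (X + 1) x' j = g j := fun j hj =>
        Function.update_of_ne (by omega) _ _
      have h2 : Function.update g (X + 1) x' (X + 1) = x' := Function.update_self _ _ _
      refine ⟨Function.update g (X + 1) x', ⟨?_, ?_, ?_, ?_⟩, fun j hj => ?_⟩
      · rw [h1 0 (Nat.zero_le _), hg.zero]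
      · intro j hj
        rcases Nat.lt_succ_iff_lt_or_eq.1 hj with hj | rfl
        · rw [h1 j hj.le, h1 (j + 1) hj]; exact hg.step j hj
        · rw [h1 j le_rfl, h2]; exact hx'
      · intro j hj
        rcases Nat.lt_succ_iff_lt_or_eq.1 hj with hj | rfl
        · rw [h1 j hj.le, h1 (j + 1) hj]; exact hg.out j hj
        · rw [h1 j le_rfl, h2]; exact fun y hy => (hcol y hy).1
      · intro j hj
        rcases Nat.lt_succ_iff_lt_or_eq.1 hj with hj | rfl
        · rw [h1 j hj.le, h1 (j + 1) hj]; exact hg.inn j hj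
        · rw [h1 j le_rfl, h2]; exact fun y hy => (hcol y hy).2
      · rw [Function.update_of_ne (by omega)]
        exact hg' j (by omega)
  obtain ⟨g, hg, hg'⟩ := key (M + 1) le_rfl
  refine ⟨g, ⟨hg.zero, fun X hX => hg.step X (by omega), hg'⟩, ?_, ?_⟩
  · funext X Y
    by_cases hXY : Y ≤ X ∧ X ≤ M
    · rw [outDir_eq hXY.1 hXY.2]; exact hg.out X (by omega) Y hXY.1
    · rw [outDir, if_neg hXY]; exact h.out_outside X Y (by omega)
  · funext X Y
    by_cases hXY : Y ≤ X ∧ X ≤ M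
    · rw [inDir_eq hXY.1 hXY.2]; exact hg.inn X (by omega) Y hXY.1
    · rw [inDir, if_neg hXY]; exact h.in_outside X Y (by omega)

end ColumnModel

/-! ### Configurations determine their tangles -/

section Injective

variable {M : ℕ} {s t p : ℕ → Bool} {d e d' e' : ℕ → ℕ → Dir}

/-- At each lattice point a configuration determines the unordered pair of the two directions. The
directions that point out of the triangle are the same for both tangles, as they are determined by
the boundary words. -/
theorem IsTangle.pair_eq (h : IsTangle M s t p d e) (h' : IsTangle M s t p d' e')
    (heq : toGraph M d e = toGraph M d' e') {X Y : ℕ} (hY : Y ≤ X) (hX : X ≤ M) :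
    (d X Y = d' X Y ∧ e X Y = e' X Y) ∨ (d X Y = e' X Y ∧ e X Y = d' X Y) := by
  have key : ∀ D, D.IsReal M X Y → ((d X Y = D ∨ e X Y = D) ↔ (d' X Y = D ∨ e' X Y = D)) := by
    intro D hD
    have h1 := toGraph_adj_latticePoint (M := M) (d := d) (e := e) (X := X) (Y := Y) (D := D)
    have h2 := toGraph_adj_latticePoint (M := M) (d := d') (e := e') (X := X) (Y := Y) (D := D)
    rw [heq, h2] at h1
    simpa [hD] using h1.symm
  have hdis := h.disjoint X Y hY hX
  have hdis' := h'.disjoint X Y hY hX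
  have hcol := h.out_col Y
  have hcol' := h'.out_col Y
  have hrow := h.in_row X hX
  have hrow' := h'.in_row X hX
  have hrowd := h.out_row X hX
  have hrowd' := h'.out_row X hX
  have hin := h.in_col Y
  have hin' := h'.in_col Y
  by_cases h1 : X = M ∧ t Y = false
  · obtain ⟨rfl, h1⟩ := h1
    left
    rw [(hcol hY).2.2 h1, (hcol' hY).2.2 h1, (hin hY).2.2 h1, (hin' hY).2.2 h1]
    simp
  · by_cases h2 : Y = 0 ∧ s X = true
    · obtain ⟨rfl, h2⟩ := h2
      left
      rw [hrow.2.2 h2, hrow'.2.2 h2, hrowd.2.2 h2, hrowd'.2.2 h2]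
      simp
    · have hr1 := h.out_isReal hY hX
        (fun hXM hne => h1 ⟨hXM, (hXM ▸ hcol (hXM ▸ hY)).2.1 (hXM ▸ hne)⟩)
      have hr2 := h.in_isReal hY hX (fun hY0 hsw => h2 ⟨hY0, by subst hY0; exact hrow.2.1 hsw⟩)
      have k1 := (key _ hr1).1 (Or.inl rfl)
      have k2 := (key _ hr2).1 (Or.inr rfl)
      rcases k1 with k1 | k1 <;> rcases k2 with k2 | k2
      · exact absurd (k1.symm.trans k2) hdis
      · exact Or.inl ⟨k1.symm, k2.symm⟩
      · exact Or.inr ⟨k1.symm, k2.symm⟩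
      · exact absurd (k1.symm.trans k2) hdis

end Injective

namespace ColumnModel

variable {α : Type*} {m : ColumnModel α} {M : ℕ} {s t p : ℕ → Bool}

/-- If the state to the right of a column can be read off its unordered pairs of directions and the
state to its left, then configurations determine sequences of states. -/
theorem IsChain.eq_of_toGraph_eq {g g' : ℕ → α} (hg : m.IsChain M g) (hg' : m.IsChain M g')
    (hm : m.IsValid M s p) (ht : ∀ Y ≤ M, t Y = false ↔ m.usedOut M (g M) Y)
    (ht' : ∀ Y ≤ M, t Y = false ↔ m.usedOut M (g' M) Y)
    (hinj : ∀ X ≤ M, ∀ x x' x'', m.inv X x → m.step X x x' → m.step X x x'' →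
      (∀ y ≤ X, (m.colOut X x x' y = m.colOut X x x'' y ∧ m.colIn X x x' y = m.colIn X x x'' y) ∨
        (m.colOut X x x' y = m.colIn X x x'' y ∧ m.colIn X x x' y = m.colOut X x x'' y)) → x' = x'')
    (heq : toGraph M (m.outDir M g) (m.inDir M g) = toGraph M (m.outDir M g') (m.inDir M g')) :
    g = g' := by
  have h := hg.isTangle hm ht
  have h' := hg'.isTangle hm ht'
  have key : ∀ X ≤ M + 1, g X = g' X := by
    intro X
    induction X with
    | zero => exact fun _ => by rw [hg.zero, hg'.zero]
    | succ X ih =>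
      intro hX
      have ih := ih (by omega)
      refine hinj X (by omega) (g X) _ _ (hg.inv hm (by omega)) (hg.step X (by omega))
        (by rw [ih]; exact hg'.step X (by omega)) fun y hy => ?_
      have := h.pair_eq h' heq hy (by omega)
      rwa [outDir_eq hy (by omega), outDir_eq hy (by omega), inDir_eq hy (by omega),
        inDir_eq hy (by omega), ← ih] at this
  funext X
  by_cases hX : X ≤ M + 1
  · exact key X hX
  · rw [hg.beyond X (by omega), hg'.beyond X (by omega)]

end ColumnModel

/-! ### Counting sequences of states -/

section Count

variable {α : Type*}

/-- The sequences that start with the value `x` at the place `i`, follow `step` up to the place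
`N`, where they satisfy `P`, and have the value `o` elsewhere. -/
def pathSet (step : ℕ → α → α → Prop) (P : α → Prop) (o : α) (N i : ℕ) (x : α) : Set (ℕ → α) :=
  {g | g i = x ∧ (∀ X, i ≤ X → X < N → step X (g X) (g (X + 1))) ∧ P (g N) ∧
    (∀ X, N < X → g X = o) ∧ ∀ X < i, g X = o}

/-- A function that satisfies the recursion of a transfer matrix counts the sequences. -/
theorem ncard_pathSet {step : ℕ → α → α → Prop} {P : α → Prop} {o : α} {N : ℕ}
    (inv : ℕ → α → Prop) (W : ℕ → α → ℕ)
    (hinv : ∀ X < N, ∀ x x', inv X x → step X x x' → inv (X + 1) x')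
    (hend : ∀ x, inv N x → (P x → W N x = 1) ∧ (¬ P x → W N x = 0))
    (hrec : ∀ X < N, ∀ x, inv X x →
      ∃ S : Finset α, (∀ x', x' ∈ S ↔ step X x x') ∧ W X x = ∑ x' ∈ S, W (X + 1) x')
    {i : ℕ} (hi : i ≤ N) {x : α} (hx : inv i x) :
    (pathSet step P o N i x).ncard = W i x := by
  classical
  suffices h : ∃ F : Finset (ℕ → α), (∀ g, g ∈ F ↔ g ∈ pathSet step P o N i x) ∧
      F.card = W i x by
    obtain ⟨F, hF, hcard⟩ := h
    rw [← hcard, ← Set.ncard_coe_finset]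
    congr 1
    ext g
    exact (hF g).symm
  obtain ⟨k, hk⟩ : ∃ k, i + k = N := ⟨N - i, by omega⟩
  induction k generalizing i x with
  | zero =>
    obtain rfl : i = N := by omega
    by_cases hP : P x
    · refine ⟨{Function.update (fun _ => o) i x}, fun g => ?_, by
        rw [(hend x hx).1 hP, Finset.card_singleton]⟩
      rw [Finset.mem_singleton]
      constructor
      · rintro rfl
        refine ⟨Function.update_self _ _ _, fun X h1 h2 => by omega, ?_, fun X hX => ?_,
          fun X hX => ?_⟩
        · rwa [Function.update_self]
        · exact Function.update_of_ne (by omega) _ _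
        · exact Function.update_of_ne (by omega) _ _
      · rintro ⟨h1, -, -, h4, h5⟩
        funext X
        rcases lt_trichotomy X i with h | rfl | h
        · rw [Function.update_of_ne (by omega), h5 X h]
        · rw [Function.update_self, h1]
        · rw [Function.update_of_ne (by omega), h4 X h]
    · refine ⟨∅, fun g => ?_, by rw [(hend x hx).2 hP, Finset.card_empty]⟩
      simp only [Finset.notMem_empty, false_iff]
      rintro ⟨h1, -, h3, -⟩
      exact hP (h1 ▸ h3)
  | succ k ih =>
    obtain ⟨S, hS, hW⟩ := hrec i (by omega) x hx
    have ih' : ∀ x', ∃ F : Finset (ℕ → α), step i x x' →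
        (∀ g, g ∈ F ↔ g ∈ pathSet step P o N (i + 1) x') ∧ F.card = W (i + 1) x' := by
      intro x'
      by_cases h : step i x x'
      · obtain ⟨F, hF⟩ := ih (i := i + 1) (x := x') (by omega) (hinv i (by omega) x x' hx h)
          (by omega)
        exact ⟨F, fun _ => hF⟩
      · exact ⟨∅, fun h' => absurd h' h⟩
    choose F hF using ih'
    refine ⟨S.biUnion fun x' => (F x').image fun g => Function.update g i x, fun g => ?_, ?_⟩
    · simp only [Finset.mem_biUnion, Finset.mem_image]
      constructor
      · rintro ⟨x', hx', g, hg, rfl⟩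
        have hstep := (hS x').1 hx'
        obtain ⟨h1, h2, h3, h4, h5⟩ := ((hF x' hstep).1 g).1 hg
        refine ⟨Function.update_self _ _ _, fun X hX hXN => ?_, ?_, fun X hX => ?_, fun X hX => ?_⟩
        · rw [Function.update_of_ne (a := X + 1) (by omega)]
          rcases hX.lt_or_eq with hX | rfl
          · rw [Function.update_of_ne (by omega)]
            exact h2 X hX hXN
          · rw [Function.update_self, h1]
            exact hstep
        · rw [Function.update_of_ne (by omega)]; exact h3
        · rw [Function.update_of_ne (by omega)]; exact h4 X hX
        · rw [Function.update_of_ne (by omega)]; exact h5 X (by omega)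
      · rintro ⟨h1, h2, h3, h4, h5⟩
        have hstep : step i x (g (i + 1)) := by
          have := h2 i le_rfl (by omega)
          rwa [h1] at this
        refine ⟨g (i + 1), (hS _).2 hstep, Function.update g i o, ?_, ?_⟩
        · rw [(hF _ hstep).1]
          refine ⟨Function.update_of_ne (by omega) _ _, fun X hX hXN => ?_, ?_, fun X hX => ?_,
            fun X hX => ?_⟩
          · rw [Function.update_of_ne (by omega), Function.update_of_ne (by omega)]
            exact h2 X (by omega) hXN
          · rw [Function.update_of_ne (by omega)]; exact h3
          · rw [Function.update_of_ne (by omega)]; exact h4 X hX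
          · rcases Nat.lt_succ_iff_lt_or_eq.1 hX with hX | rfl
            · rw [Function.update_of_ne (by omega)]; exact h5 X hX
            · rw [Function.update_self]
        · rw [Function.update_idem, ← h1, Function.update_eq_self]
    · rw [hW, Finset.card_biUnion]
      · refine Finset.sum_congr rfl fun x' hx' => ?_
        have hstep := (hS x').1 hx'
        rw [Finset.card_image_of_injOn, (hF x' hstep).2]
        intro g hg g' hg' heq
        have h1 := ((hF x' hstep).1 g).1 hg
        have h2 := ((hF x' hstep).1 g').1 hg'
        funext X
        by_cases hX : X = i
        · subst hX
          rw [h1.2.2.2.2 X (by omega), h2.2.2.2.2 X (by omega)]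
        · have := congrFun heq X
          simpa only [Function.update_of_ne hX] using this
      · intro x1 hx1 x2 hx2 hne
        rw [Function.onFun, Finset.disjoint_left]
        simp only [Finset.mem_image, not_exists, not_and]
        rintro _ ⟨g, hg, rfl⟩ g' hg' heq
        have h1 := ((hF x1 ((hS x1).1 hx1)).1 g).1 hg
        have h2 := ((hF x2 ((hS x2).1 hx2)).1 g').1 hg'
        have := congrFun heq (i + 1)
        rw [Function.update_of_ne (by omega), Function.update_of_ne (by omega), h1.1, h2.1] at this
        exact hne this.symm

theorem ColumnModel.setOf_isChain (m : ColumnModel α) (M : ℕ) (P : α → Prop) :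
    {g | m.IsChain M g ∧ P (g (M + 1))} = pathSet m.step P m.start (M + 1) 0 m.start := by
  ext g
  constructor
  · rintro ⟨⟨h1, h2, h3⟩, h4⟩
    exact ⟨h1, fun X _ hX => h2 X (by omega), h4, h3, fun X hX => by omega⟩
  · rintro ⟨h1, h2, h3, h4, -⟩
    exact ⟨⟨h1, fun X hX => h2 X (Nat.zero_le _) (by omega), h4⟩, h3⟩

end Count

/-! ### Single columns -/

section Column

variable {c : ℕ → Dir}

/-- Above a row that does not use its left cell, the used left cells are used from above. -/
theorem column_sw {A B : ℕ} (h : ∀ y, A ≤ y → y < B → c y = nw ∨ c (y + 1) = sw) (hA : c A ≠ nw)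
    {y : ℕ} (hy : A < y) (hy' : y ≤ B) : c y = sw := by
  induction y with
  | zero => omega
  | succ y ih =>
    rcases Nat.lt_succ_iff_lt_or_eq.1 hy with h1 | rfl
    · have := ih h1 (by omega)
      rcases h y (by omega) hy' with h2 | h2
      · rw [this] at h2; cases h2
      · exact h2
    · exact (h A le_rfl hy').resolve_left hA

/-- Below a row that does not use the left cell under it, the used left cells are used from
below. -/
theorem column_nw {A B : ℕ} (h : ∀ y, A ≤ y → y < B → c y = nw ∨ c (y + 1) = sw) (hB : c B ≠ sw)
    {y : ℕ} (hy : A ≤ y) (hy' : y < B) : c y = nw := by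
  obtain ⟨k, hk⟩ : ∃ k, y + k + 1 = B := ⟨B - y - 1, by omega⟩
  induction k generalizing y with
  | zero =>
    obtain rfl : B = y + 1 := by omega
    exact (h y hy hy').resolve_right hB
  | succ k ih =>
    have := ih (y := y + 1) (by omega) (by omega) (by omega)
    exact (h y hy hy').resolve_right (by rw [this]; simp)

/-- If all left cells between the rows `A` and `B` are used by the rows from `A` to `B`, then
exactly one of these rows has no left cell. -/
theorem column_exists_right {A B : ℕ} (h : ∀ y, A ≤ y → y < B → c y = nw ∨ c (y + 1) = sw)
    (hex : ∀ y, A ≤ y → y < B → ¬ (c y = nw ∧ c (y + 1) = sw)) (hAB : A ≤ B) (hA : c A ≠ sw)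
    (hB : c B ≠ nw) : ∃ r, A ≤ r ∧ r ≤ B ∧ (c r = ne ∨ c r = se) ∧ (∀ y, A ≤ y → y < r → c y = nw) ∧
      ∀ y, r < y → y ≤ B → c y = sw := by
  classical
  have hP : ∃ r, A ≤ r ∧ c r ≠ nw := ⟨B, hAB, hB⟩
  set r := Nat.find hP with hr
  obtain ⟨h1, h2⟩ : A ≤ r ∧ c r ≠ nw := Nat.find_spec hP
  have h3 : ∀ y, A ≤ y → y < r → c y = nw := fun y hy hy' => by
    by_contra hcon
    exact Nat.find_min hP hy' ⟨hy, hcon⟩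
  have h4 : r ≤ B := Nat.find_min' hP ⟨hAB, hB⟩
  have h5 : c r ≠ sw := by
    rcases h1.lt_or_eq with h1 | h1
    · obtain ⟨q, hq⟩ : ∃ q, r = q + 1 := ⟨r - 1, by omega⟩
      rw [hq]
      exact fun h6 => hex q (by omega) (by omega) ⟨h3 q (by omega) (by omega), h6⟩
    · rwa [← h1]
  refine ⟨r, h1, h4, ?_, h3, fun y hy hy' => column_sw (fun x hx => h x (by omega)) h2 hy hy'⟩
  rcases hc : c r with _ | _ | _ | _ <;> simp_all

/-- The rows next to unused left cells at the bottom of a column point to the right. -/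
theorem column_bottom {Q : ℕ} (h : ∀ y < Q, ¬ (c y = nw ∨ c (y + 1) = sw))
    (hex : ∀ y < Q, ¬ (c y = ne ∧ c (y + 1) = se)) (h0 : c 0 ≠ sw ∧ c 0 ≠ se) :
    (∀ y < Q, c y = ne) ∧ c Q ≠ sw ∧ c Q ≠ se := by
  induction Q with
  | zero => exact ⟨by simp, h0⟩
  | succ Q ih =>
    obtain ⟨h1, h2, h3⟩ := ih (fun y hy => h y (by omega)) (fun y hy => hex y (by omega))
    have h4 := h Q (by omega)
    have h5 := hex Q (by omega)
    have h6 : c Q = ne := by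
      rcases hc : c Q with _ | _ | _ | _ <;> simp_all
    refine ⟨fun y hy => ?_, fun h => h4 (Or.inr h), fun h => h5 ⟨h6, h⟩⟩
    rcases Nat.lt_succ_iff_lt_or_eq.1 hy with hy | rfl
    · exact h1 y hy
    · exact h6

/-- A run of rows that point to the right consists of rows of direction `se`, followed by rows of
direction `ne`. -/
theorem column_run {A B : ℕ} (hAB : A ≤ B) (h : ∀ y, A ≤ y → y < B → c y = ne ∨ c y = se)
    (hex : ∀ y, A ≤ y → y + 1 < B → ¬ (c y = ne ∧ c (y + 1) = se)) :
    ∃ r, A ≤ r ∧ r ≤ B ∧ (∀ y, A ≤ y → y < r → c y = se) ∧ ∀ y, r ≤ y → y < B → c y = ne := by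
  obtain ⟨k, rfl⟩ : ∃ k, B = A + k := ⟨B - A, by omega⟩
  induction k with
  | zero => exact ⟨A, le_rfl, le_rfl, by omega, by omega⟩
  | succ k ih =>
    obtain ⟨r, h1, h2, h3, h4⟩ := ih (by omega) (fun y hy hy' => h y hy (by omega))
      (fun y hy hy' => hex y hy (by omega))
    by_cases hr : r = A + k
    · rcases h (A + k) (by omega) (by omega) with h5 | h5
      · refine ⟨r, h1, by omega, h3, fun y hy hy' => ?_⟩
        obtain rfl : y = A + k := by omega
        exact h5
      · refine ⟨A + k + 1, by omega, by omega, fun y hy hy' => ?_, fun y hy hy' => by omega⟩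
        rcases Nat.lt_succ_iff_lt_or_eq.1 hy' with h6 | rfl
        · exact h3 y hy (by omega)
        · exact h5
    · refine ⟨r, h1, by omega, h3, fun y hy hy' => ?_⟩
      by_cases hy2 : y < A + k
      · exact h4 y hy hy2
      · obtain rfl : y = A + k := by omega
        have h5 := h4 (A + k - 1) (by omega) (by omega)
        have h6 := hex (A + k - 1) (by omega) (by omega)
        rw [show A + k - 1 + 1 = A + k by omega] at h6
        exact (h (A + k) (by omega) (by omega)).resolve_right fun h7 => h6 ⟨h5, h7⟩

end Column

/-! ### The words `u 0 1^a v` and `u 1^a 0 v` -/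

theorem zerosBefore_succ_of_one {p : ℕ → Bool} {X : ℕ} (h : p X = true) :
    zerosBefore p (X + 1) = zerosBefore p X := by simp [zerosBefore, h]

theorem zerosBefore_succ_of_zero {p : ℕ → Bool} {X : ℕ} (h : p X = false) :
    zerosBefore p (X + 1) = zerosBefore p X + 1 := by simp [zerosBefore, h]

theorem zerosBefore_succ_cases (p : ℕ → Bool) (X : ℕ) :
    (p X = true ∧ zerosBefore p (X + 1) = zerosBefore p X) ∨
      (p X = false ∧ zerosBefore p (X + 1) = zerosBefore p X + 1) := by
  cases hp : p X
  · exact Or.inr ⟨rfl, zerosBefore_succ_of_zero hp⟩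
  · exact Or.inl ⟨rfl, zerosBefore_succ_of_one hp⟩

theorem zerosBefore_le (p : ℕ → Bool) (X : ℕ) : zerosBefore p X ≤ X := by
  induction X with
  | zero => simp [zerosBefore]
  | succ X ih => cases h : p X <;> simp [zerosBefore, h] <;> omega

theorem zerosBefore_mono (p : ℕ → Bool) : Monotone (zerosBefore p) :=
  monotone_nat_of_le_succ fun X => by simp [zerosBefore]

theorem zerosBefore_lt {p : ℕ → Bool} {i X : ℕ} (hi : p i = true) (hX : i < X) :
    zerosBefore p X < X := by
  induction X with
  | zero => omega
  | succ X ih =>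
    rcases Nat.lt_succ_iff_lt_or_eq.1 hX with h | rfl
    · have := ih h
      cases h : p X <;> simp [zerosBefore, h] <;> omega
    · rw [zerosBefore_succ_of_one hi]
      have := zerosBefore_le p i
      omega

/-- The words `s = u 0 1^a v` and `p = u 1^a 0 v`, where `u` has `l` letters, `z` of them `0`. -/
structure OneRun (M l a z : ℕ) (s p : ℕ → Bool) : Prop where
  zeros : zerosBefore p l = z
  p_one : ∀ X, l ≤ X → X < l + a → p X = true
  p_zero : p (l + a) = false
  s_zero : s l = false
  s_one : ∀ X, l < X → X ≤ l + a → s X = true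
  s_eq : ∀ X, X < l ∨ l + a < X → s X = p X
  p_first : p 0 = false
  p_last : p M = true
  lt : l + a < M

/-- The column model for the words `u 0 1^a v` and `u 1^a 0 v`. Before column `l` all columns are
forced. In the columns from `l` to `l + a` a strand runs back to the left; the state is the row
above the cell in which it enters a column. Beyond column `l + a` the outgoing edges use the
lowest cells of a strip and one further cell, and the state exceeds `z` by the distance by which
that cell is displaced upwards. -/
def oneRunModel (M l a z : ℕ) (p : ℕ → Bool) : ColumnModel ℕ where
  start := 0
  step X g g' :=
    if X < l then g' = 0
    else if X < l + a then g' = max g z + 1 ∨ (1 ≤ g' ∧ g ≤ g' ∧ (g' ≤ z ∨ g' = g))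
    else g' = max z g ∨ (X < M ∧ g' = max z (g - 1))
  inv X g :=
    if X ≤ l then g = 0
    else if X ≤ l + a then 1 ≤ g ∧ g ≤ X ∧ g + l ≤ z + X
    else z ≤ g ∧ g ≤ z + a ∧ zerosBefore p X + g ≤ X + z
  usedOut X g y :=
    if X ≤ l + a then y < zerosBefore p X
    else y + 1 < zerosBefore p X ∨ y + 1 + z = zerosBefore p X + g
  usedIn X g y := X ≤ l + a ∧ y + 1 = g
  colOut X g g' y :=
    if X < l + a then
      if y < zerosBefore p (X + 1) then ne else if p X then nw else sw
    else if X = l + a then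
      if y < z then ne else if y < g then nw
      else if y = max g z then (if g' < g then se else ne) else sw
    else
      if y + 1 < zerosBefore p (X + 1) then ne
      else if y + 1 + z = zerosBefore p (X + 1) + g then (if g' < g then se else ne)
      else if p X then nw else sw
  colIn X g g' y :=
    if l ≤ X ∧ X < l + a then
      if y < g then sw
      else if z < g' ∧ g < g' then
        (if y + 1 < g' then nw else if y + 1 = g' then ne else sw)
      else (if y < g' then nw else if y = g' then se else sw)
    else if p X then sw
    else if X = l + a ∧ y < g then sw else nw

namespace OneRun

variable {M l a z : ℕ} {s t p : ℕ → Bool}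

theorem zeros_mid (h : OneRun M l a z s p) {X : ℕ} (h1 : l ≤ X) (h2 : X ≤ l + a) :
    zerosBefore p X = z := by
  obtain ⟨k, rfl⟩ : ∃ k, X = l + k := ⟨X - l, by omega⟩
  induction k with
  | zero => exact h.zeros
  | succ k ih =>
    rw [← Nat.add_assoc, zerosBefore_succ_of_one (h.p_one (l + k) (by omega) (by omega))]
    exact ih (by omega) (by omega)

theorem zeros_succ (h : OneRun M l a z s p) : zerosBefore p (l + a + 1) = z + 1 := by
  rw [zerosBefore_succ_of_zero h.p_zero, h.zeros_mid (by omega) le_rfl]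

theorem zeros_gt (h : OneRun M l a z s p) {X : ℕ} (hX : l + a < X) : z + 1 ≤ zerosBefore p X := by
  rw [← h.zeros_succ]
  exact zerosBefore_mono p hX

theorem pos (h : OneRun M l a z s p) (ha : 1 ≤ a) : 1 ≤ z := by
  rcases Nat.eq_zero_or_pos l with rfl | hl
  · have := h.p_one 0 le_rfl (by omega)
    rw [h.p_first] at this
    cases this
  · have h1 := zerosBefore_mono p (show 1 ≤ l from hl)
    rw [zerosBefore_succ_of_zero h.p_first, h.zeros] at h1
    omega

theorem le (h : OneRun M l a z s p) : z ≤ l := by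
  rw [← h.zeros]; exact zerosBefore_le p l

theorem inv_step (h : OneRun M l a z s p) : ∀ X ≤ M, ∀ x x', (oneRunModel M l a z p).inv X x →
    (oneRunModel M l a z p).step X x x' → (oneRunModel M l a z p).inv (X + 1) x' := by
  have hzl := h.le
  have hlt := h.lt
  have hcases : ∀ X, X < l ∨ (l ≤ X ∧ X < l + a) ∨ X = l + a ∨ l + a < X := fun X => by omega
  intro X hX x x' hx hs
  have hZ := zerosBefore_le p X
  have h1 : zerosBefore p (X + 1) ≤ zerosBefore p X + 1 := by
    cases hp : p X
    · rw [zerosBefore_succ_of_zero hp]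
    · rw [zerosBefore_succ_of_one hp]; omega
  simp only [oneRunModel] at hx hs ⊢
  rcases hcases X with hc | hc | rfl | hc
  · rw [if_pos (by omega)] at hx hs
    rw [if_pos (by omega)]
    exact hs
  · have := h.pos (by omega)
    rw [if_neg (by omega), if_pos (by omega)] at hs
    rw [if_neg (by omega), if_pos (by omega)]
    split_ifs at hx <;> omega
  · rw [if_neg (by omega), if_neg (by omega)] at hs
    rw [if_neg (by omega), if_neg (by omega), h.zeros_succ]
    split_ifs at hx <;> omega
  · rw [if_neg (by omega), if_neg (by omega)] at hx hs
    rw [if_neg (by omega), if_neg (by omega)]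
    omega

theorem out_column (h : OneRun M l a z s p) : ∀ X ≤ M, ∀ x x', (oneRunModel M l a z p).inv X x →
    (oneRunModel M l a z p).step X x x' → IsColumn M X ((oneRunModel M l a z p).usedOut X x)
      ((oneRunModel M l a z p).usedOut (X + 1) x') ((oneRunModel M l a z p).colOut X x x') := by
  have hzl := h.le
  have hlt := h.lt
  have hcases : ∀ X, X < l ∨ (l ≤ X ∧ X < l + a) ∨ X = l + a ∨ l + a < X := fun X => by omega
  intro X hX x x' hx hs
  have hZ := zerosBefore_le p X
  have hZ1 : (p X = true ∧ zerosBefore p (X + 1) = zerosBefore p X) ∨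
      (p X = false ∧ zerosBefore p (X + 1) = zerosBefore p X + 1) := by
    cases hp : p X
    · exact Or.inr ⟨rfl, zerosBefore_succ_of_zero hp⟩
    · exact Or.inl ⟨rfl, zerosBefore_succ_of_one hp⟩
  simp only [oneRunModel] at hx hs ⊢
  rcases hcases X with hc | hc | hc | hc
  · simp only [show X ≤ l + a by omega, show X + 1 ≤ l + a by omega, show X < l + a by omega,
      if_true]
    generalize zerosBefore p X = Z at *
    generalize zerosBefore p (X + 1) = Z' at *
    rcases hZ1 with ⟨hp, rfl⟩ | ⟨hp, rfl⟩ <;>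
      simp only [hp, Bool.false_eq_true, if_true, if_false] <;>
      constructor <;> intros <;> split_ifs <;> simp <;> omega
  · have hp := h.p_one X hc.1 hc.2
    have h1 := h.zeros_mid (X := X) (by omega) (by omega)
    have h2 := h.zeros_mid (X := X + 1) (by omega) (by omega)
    simp only [show X ≤ l + a by omega, show X + 1 ≤ l + a by omega, show X < l + a by omega,
      if_true, hp, h1, h2]
    constructor <;> intros <;> split_ifs <;> simp <;> omega
  · subst hc
    have h1 := h.zeros_mid (X := l + a) (by omega) le_rfl
    have h2 := h.zeros_succ
    have h3 : x ≤ l + a := by split_ifs at hx <;> omega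
    rw [if_neg (by omega), if_neg (by omega)] at hs
    simp only [le_refl, show ¬ l + a + 1 ≤ l + a by omega, lt_irrefl, if_true, if_false, h1, h2]
    constructor <;> intros <;> split_ifs <;> simp <;> omega
  · have h1 := h.zeros_gt hc
    rw [if_neg (by omega), if_neg (by omega)] at hx hs
    simp only [show ¬ X ≤ l + a by omega, show ¬ X + 1 ≤ l + a by omega,
      show ¬ X < l + a by omega, show X ≠ l + a by omega, if_false]
    generalize zerosBefore p X = Z at *
    generalize zerosBefore p (X + 1) = Z' at *
    rcases hZ1 with ⟨hp, rfl⟩ | ⟨hp, rfl⟩ <;>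
      simp only [hp, Bool.false_eq_true, if_true, if_false] <;>
      constructor <;> intros <;> split_ifs <;> simp <;> omega

theorem in_column (h : OneRun M l a z s p) : ∀ X ≤ M, ∀ x x', (oneRunModel M l a z p).inv X x →
    (oneRunModel M l a z p).step X x x' → IsColumn M X ((oneRunModel M l a z p).usedIn X x)
      ((oneRunModel M l a z p).usedIn (X + 1) x') ((oneRunModel M l a z p).colIn X x x') := by
  have hzl := h.le
  have hlt := h.lt
  have hcases : ∀ X, X < l ∨ (l ≤ X ∧ X < l + a) ∨ X = l + a ∨ l + a < X := fun X => by omega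
  intro X hX x x' hx hs
  simp only [oneRunModel] at hx hs ⊢
  rcases hcases X with hc | hc | hc | hc
  · rw [if_pos (by omega)] at hx hs
    subst hx hs
    simp only [show ¬ l ≤ X by omega, show X ≠ l + a by omega, false_and, if_false]
    cases hp : p X <;> constructor <;> intros <;> simp
  · have hp := h.p_one X hc.1 hc.2
    have hz := h.pos (by omega)
    rw [if_neg (by omega), if_pos (by omega)] at hs
    have hx' : x ≤ X ∧ x' ≤ X + 1 := by split_ifs at hx <;> omega
    clear hx
    simp only [hc, show X ≤ l + a by omega, show X + 1 ≤ l + a by omega, true_and, and_self,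
      if_true]
    constructor <;> intros <;> split_ifs <;> simp <;> omega
  · subst hc
    have h3 : x ≤ l + a := by split_ifs at hx <;> omega
    simp only [le_refl, lt_irrefl, and_false, if_false, h.p_zero, Bool.false_eq_true, true_and,
      show ¬ l + a + 1 ≤ l + a by omega, false_and]
    constructor <;> intros <;> split_ifs <;> simp <;> omega
  · simp only [show ¬ X ≤ l + a by omega, show ¬ X + 1 ≤ l + a by omega, false_and,
      show ¬ X < l + a by omega, show X ≠ l + a by omega, if_false, and_false]
    cases hp : p X <;> constructor <;> intros <;> simp

theorem disjoint (h : OneRun M l a z s p) : ∀ X ≤ M, ∀ x x', (oneRunModel M l a z p).inv X x →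
    (oneRunModel M l a z p).step X x x' → ∀ y ≤ X,
      (oneRunModel M l a z p).colOut X x x' y ≠ (oneRunModel M l a z p).colIn X x x' y := by
  have hzl := h.le
  have hlt := h.lt
  have hcases : ∀ X, X < l ∨ (l ≤ X ∧ X < l + a) ∨ X = l + a ∨ l + a < X := fun X => by omega
  intro X hX x x' hx hs y hy
  simp only [oneRunModel] at hx hs ⊢
  rcases hcases X with hc | hc | hc | hc
  · simp only [show X < l + a by omega, show ¬ l ≤ X by omega, show X ≠ l + a by omega,
      false_and, if_true, if_false]
    cases hp : p X <;> simp only [Bool.false_eq_true, if_true, if_false] <;> split_ifs <;> simp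
  · have hp := h.p_one X hc.1 hc.2
    have hz := h.pos (by omega)
    rw [if_neg (by omega), if_pos (by omega)] at hs
    rw [h.zeros_mid (X := X + 1) (by omega) (by omega)]
    simp only [hc, hp, and_self, if_true]
    split_ifs <;> simp <;> omega
  · subst hc
    rw [if_neg (by omega), if_neg (by omega)] at hs
    simp only [lt_irrefl, and_false, if_false, h.p_zero, Bool.false_eq_true, true_and, if_true]
    split_ifs <;> simp
  · simp only [show ¬ X < l + a by omega, show X ≠ l + a by omega, false_and, if_false, and_false]
    cases hp : p X <;> simp only [Bool.false_eq_true, if_true, if_false] <;> split_ifs <;> simp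

theorem diag (h : OneRun M l a z s p) : ∀ X ≤ M, ∀ x x', (oneRunModel M l a z p).inv X x →
    (oneRunModel M l a z p).step X x x' →
    ((oneRunModel M l a z p).colOut X x x' X = nw ↔ p X = true) ∧
      ((oneRunModel M l a z p).colIn X x x' X = nw ↔ p X = false) := by
  have hzl := h.le
  have hlt := h.lt
  have hcases : ∀ X, X < l ∨ (l ≤ X ∧ X < l + a) ∨ X = l + a ∨ l + a < X := fun X => by omega
  intro X hX x x' hx hs
  have hZ := zerosBefore_le p X
  simp only [oneRunModel] at hx hs ⊢
  rcases hcases X with hc | hc | hc | hc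
  · simp only [show X < l + a by omega, show ¬ l ≤ X by omega, show X ≠ l + a by omega,
      false_and, if_true, if_false]
    cases hp : p X
    · rw [zerosBefore_succ_of_zero hp]
      simp only [Bool.false_eq_true, if_false]
      split_ifs <;> simp
    · rw [zerosBefore_succ_of_one hp]
      simp only [if_true]
      split_ifs <;> simp
      omega
  · have hp := h.p_one X hc.1 hc.2
    have hz := h.pos (by omega)
    rw [if_neg (by omega), if_pos (by omega)] at hs
    have hx' : x ≤ X ∧ x' ≤ X + 1 := by split_ifs at hx <;> omega
    rw [h.zeros_mid (X := X + 1) (by omega) (by omega)]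
    simp only [hc, hp, and_self, if_true]
    split_ifs <;> simp <;> omega
  · subst hc
    rw [if_neg (by omega), if_neg (by omega)] at hs
    have h3 : x ≤ l + a := by split_ifs at hx <;> omega
    simp only [lt_irrefl, and_false, if_false, h.p_zero, Bool.false_eq_true, true_and, if_true]
    split_ifs <;> simp <;> omega
  · rw [if_neg (by omega), if_neg (by omega)] at hx
    simp only [show ¬ X < l + a by omega, show X ≠ l + a by omega, false_and, if_false, and_false]
    cases hp : p X
    · rw [zerosBefore_succ_of_zero hp]
      simp only [Bool.false_eq_true, if_false]
      split_ifs <;> simp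
    · rw [zerosBefore_succ_of_one hp]
      have := zerosBefore_lt hp (Nat.lt_succ_self X)
      simp only [if_true]
      split_ifs <;> simp <;> omega

theorem row (h : OneRun M l a z s p) : ∀ X ≤ M, ∀ x x', (oneRunModel M l a z p).inv X x →
    (oneRunModel M l a z p).step X x x' → ((oneRunModel M l a z p).colOut X x x' 0 ≠ sw ∧
      (oneRunModel M l a z p).colOut X x x' 0 ≠ se ∧
      (s X = true → (oneRunModel M l a z p).colOut X x x' 0 = ne)) ∧
      (oneRunModel M l a z p).colIn X x x' 0 ≠ se ∧
      ((oneRunModel M l a z p).colIn X x x' 0 = sw ↔ s X = true) := by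
  have hzl := h.le
  have hlt := h.lt
  have hcases : ∀ X, X < l ∨ (l ≤ X ∧ X < l + a) ∨ X = l + a ∨ l + a < X := fun X => by omega
  intro X hX x x' hx hs
  have h0 : l < X → 0 < zerosBefore p X := by
    intro hX
    have h1 := zerosBefore_mono p (show 1 ≤ X by omega)
    rw [zerosBefore_succ_of_zero h.p_first] at h1
    omega
  simp only [oneRunModel] at hx hs ⊢
  rcases hcases X with hc | hc | hc | hc
  · have hs1 := h.s_eq X (Or.inl hc)
    simp only [show X < l + a by omega, show ¬ l ≤ X by omega, show X ≠ l + a by omega,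
      false_and, if_true, if_false, hs1]
    cases hp : p X
    · rw [zerosBefore_succ_of_zero hp]
      simp
    · have : X ≠ 0 := by rintro rfl; rw [h.p_first] at hp; cases hp
      have h1 := zerosBefore_mono p (show 1 ≤ X + 1 by omega)
      rw [zerosBefore_succ_of_zero h.p_first] at h1
      simp only [if_true]
      rw [if_pos (by omega)]
      simp
  · have hp := h.p_one X hc.1 hc.2
    have hz := h.pos (by omega)
    rw [if_neg (by omega), if_pos (by omega)] at hs
    rw [h.zeros_mid (X := X + 1) (by omega) (by omega)]
    simp only [hc, hp, and_self, if_true]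
    rcases hc.1.lt_or_eq with h1 | rfl
    · rw [h.s_one X h1 (by omega)]
      rw [if_neg (by omega), if_pos (by omega)] at hx
      rw [if_pos (by omega), if_pos (by omega)]
      simp
    · rw [h.s_zero]
      rw [if_pos le_rfl] at hx
      subst hx
      rw [if_pos (by omega)]
      split_ifs <;> simp <;> omega
  · subst hc
    rw [if_neg (by omega), if_neg (by omega)] at hs
    simp only [lt_irrefl, and_false, if_false, h.p_zero, Bool.false_eq_true, true_and, if_true]
    rcases Nat.eq_zero_or_pos a with rfl | ha
    · rw [if_pos (by omega)] at hx
      subst hx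
      rw [Nat.add_zero, h.s_zero]
      split_ifs <;> simp <;> omega
    · have hz := h.pos ha
      rw [if_neg (by omega), if_pos (by omega)] at hx
      rw [if_pos (by omega), if_pos (by omega), h.s_one (l + a) (by omega) le_rfl]
      simp
  · have hs1 := h.s_eq X (Or.inr hc)
    have h1 := h.zeros_gt hc
    have hz := h.pos
    rw [if_neg (by omega), if_neg (by omega)] at hx hs
    simp only [show ¬ X < l + a by omega, show X ≠ l + a by omega, false_and, if_false, and_false,
      hs1]
    cases hp : p X
    · rw [zerosBefore_succ_of_zero hp]
      simp only [Bool.false_eq_true, if_false]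
      split_ifs <;> simp <;> omega
    · rw [zerosBefore_succ_of_one hp]
      simp only [if_true]
      split_ifs <;> simp <;> omega

theorem last (h : OneRun M l a z s p) : ∀ x x', (oneRunModel M l a z p).inv M x →
    (oneRunModel M l a z p).step M x x' → ∀ y ≤ M, ((oneRunModel M l a z p).colOut M x x' y ≠ se ∧
      ((oneRunModel M l a z p).colOut M x x' y = ne ↔ (oneRunModel M l a z p).usedOut M x y)) ∧
      (oneRunModel M l a z p).colIn M x x' y = sw := by
  have hzl := h.le
  have hlt := h.lt
  intro x x' hx hs y hy
  have h1 := h.zeros_gt hlt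
  simp only [oneRunModel] at hx hs ⊢
  rw [if_neg (by omega), if_neg (by omega)] at hx hs
  rw [zerosBefore_succ_of_one h.p_last]
  simp only [show ¬ M < l + a by omega, show M ≠ l + a by omega, show ¬ M ≤ l + a by omega,
    false_and, and_false, if_false, h.p_last, if_true]
  split_ifs <;> simp <;> omega

/-- The model is consistent. -/
theorem isValid (h : OneRun M l a z s p) : (oneRunModel M l a z p).IsValid M s p :=
  ⟨by simp [oneRunModel], h.inv_step, h.out_column, h.in_column, h.disjoint, h.diag, h.row, h.last⟩

end OneRun

/-! ### Tangles for the words `u 0 1^a v` and `u 1^a 0 v` follow the model -/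

theorem Dir.eq_ne {D : Dir} (h1 : D ≠ sw) (h2 : D ≠ nw) (h3 : D ≠ se) : D = ne := by
  cases D <;> simp_all

section Steps

variable {M : ℕ} {d e : ℕ → ℕ → Dir}

theorem Dir.isReal_nw {X Y : ℕ} (hY : Y ≤ X) (hX : X ≤ M) : nw.IsReal M X Y :=
  ⟨hY, hX, by simp, by simp⟩

theorem Dir.isReal_sw {X y : ℕ} (hY : y < X) (hX : X ≤ M) : sw.IsReal M X (y + 1) :=
  ⟨hY, hX, by simp, by simp⟩

theorem Dir.isReal_ne {X Y : ℕ} (hY : Y ≤ X) (hX : X < M) : ne.IsReal M X Y :=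
  ⟨hY, hX.le, by simp [hX], by simp⟩

theorem Dir.isReal_se {X y : ℕ} (hY : y < X) (hX : X < M) : se.IsReal M X (y + 1) :=
  ⟨hY, hX.le, by simp [hX], by simp⟩

/-- A strand runs down in column `X`, from row `B` to row `A`, through the cells to the left of the
column. -/
theorem reflTransGen_descend {X A B : ℕ} (hAB : A ≤ B) (hB : B ≤ X) (hX : X ≤ M)
    (hd : ∀ y, A < y → y ≤ B → d X y = sw) (he : ∀ y, A ≤ y → y < B → e X y = nw) :
    ReflTransGen (TangleStep M d e) (X, B) (X, A) := by
  obtain ⟨k, rfl⟩ : ∃ k, B = A + k := ⟨B - A, by omega⟩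
  induction k with
  | zero => exact .refl
  | succ k ih =>
    refine .head ?_ (ih (by omega) (by omega) (fun y h1 h2 => hd y h1 (by omega))
      (fun y h1 h2 => he y h1 (by omega)))
    have h1 : d X (A + k + 1) = sw := hd _ (by omega) (by omega)
    have h2 : e X (A + k) = nw := he _ (by omega) (by omega)
    rw [← Nat.add_assoc]
    refine ⟨?_, ?_, ?_⟩
    · simp only [h1]; exact isReal_sw (by omega) hX
    · simp only [h2]; exact isReal_nw (by omega) hX
    · simp only [h1, h2, latticePoint_add_sw, latticePoint_add_nw]

/-- A strand runs up in column `X`, from row `A` to row `B`, through the cells to the left of the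
column. -/
theorem reflTransGen_ascend {X A B : ℕ} (hAB : A ≤ B) (hB : B ≤ X) (hX : X ≤ M)
    (hd : ∀ y, A ≤ y → y < B → d X y = nw) (he : ∀ y, A < y → y ≤ B → e X y = sw) :
    ReflTransGen (TangleStep M d e) (X, A) (X, B) := by
  obtain ⟨k, rfl⟩ : ∃ k, B = A + k := ⟨B - A, by omega⟩
  induction k with
  | zero => exact .refl
  | succ k ih =>
    refine .tail (ih (by omega) (by omega) (fun y h1 h2 => hd y h1 (by omega))
      (fun y h1 h2 => he y h1 (by omega))) ?_
    have h1 : d X (A + k) = nw := hd _ (by omega) (by omega)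
    have h2 : e X (A + k + 1) = sw := he _ (by omega) (by omega)
    rw [← Nat.add_assoc]
    refine ⟨?_, ?_, ?_⟩
    · simp only [h1]; exact isReal_nw (by omega) hX
    · simp only [h2]; exact isReal_sw (by omega) hX
    · simp only [h1, h2, latticePoint_add_sw, latticePoint_add_nw]

end Steps

theorem column_all_nw {X : ℕ} {c : ℕ → Dir} (h : ∀ y < X, c y = nw ∨ c (y + 1) = sw)
    (hX : c X = nw) : ∀ y ≤ X, c y = nw := by
  intro y hy
  rcases hy.lt_or_eq with hy | rfl
  · exact column_nw (A := 0) (fun y _ => h y) (by rw [hX]; simp) (Nat.zero_le _) hy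
  · exact hX

theorem column_all_sw {X : ℕ} {c : ℕ → Dir} (h : ∀ y < X, c y = nw ∨ c (y + 1) = sw)
    (h0 : c 0 = sw) : ∀ y ≤ X, c y = sw := by
  intro y hy
  rcases Nat.eq_zero_or_pos y with rfl | h1
  · exact h0
  · exact column_sw (A := 0) (fun y _ => h y) (by rw [h0]; simp) h1 hy

namespace OneRun

variable {M l a z : ℕ} {s t p : ℕ → Bool} {d e : ℕ → ℕ → Dir}

/-- In column `l + a`, the strand that runs back must not come from the external edge of that
column: otherwise it would lead to the external edge on its left. -/
theorem out_ne_sw (h : OneRun M l a z s p) {g : ℕ → ℕ}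
    (hmono : NoReturn M p d e)
    (hg : (oneRunModel M l a z p).Follows (l + a) g d e) (ha : 1 ≤ a)
    (hgz : z < g (l + a)) (hgX : g (l + a) ≤ l + a)
    (hout : ∀ y, z ≤ y → y < l + a → d (l + a) y = nw ∨ d (l + a) (y + 1) = sw)
    (hin : ∀ y, g (l + a) ≤ y → y ≤ l + a → e (l + a) y = nw) :
    d (l + a) (g (l + a)) ≠ sw := by
  intro hbad
  have hlt := h.lt
  have hzl := h.le
  set G := g (l + a) with hG
  obtain ⟨j, hj⟩ : ∃ j, l + a = j + 1 := ⟨l + a - 1, by omega⟩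
  have hpj := h.p_one j (by omega) (by omega)
  have h1 : ReflTransGen (TangleStep M d e) (l + a, l + a) (l + a, G) :=
    reflTransGen_descend hgX le_rfl hlt.le
      (fun y hy hy' => column_sw (fun x hx hx' => hout x (by omega) hx') (by rw [hbad]; simp)
        hy hy')
      (fun y hy hy' => hin y hy hy'.le)
  have hstep := hg.step j (by omega)
  have hinv := hg.inv (M := M) (s := s) h.isValid (j := j) (by omega) (by omega)
  have hdj : ∀ y, z ≤ y → y ≤ j → d j y = nw := by
    intro y hy hy'
    rw [hg.out j (by omega) y hy']
    simp only [oneRunModel]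
    rw [if_pos (by omega), h.zeros_mid (X := j + 1) (by omega) (by omega), if_neg (by omega),
      if_pos hpj]
  have hej := hg.inn j (by omega)
  rw [← hj, ← hG] at hstep hej
  simp only [oneRunModel] at hstep hinv hej
  rw [if_neg (by omega), if_pos (by omega)] at hstep
  simp only [if_pos (show l ≤ j ∧ j < l + a by omega)] at hej
  obtain ⟨G', hG'⟩ : ∃ G', G = G' + 1 := ⟨G - 1, by omega⟩
  have hlast : ReflTransGen (TangleStep M d e) (l + a, G) (j, j) := by
    by_cases hc : z < G ∧ g j < G
    · have h2 : e j G' = ne := by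
        rw [hej G' (by omega), if_neg (by omega), if_pos hc, if_neg (by omega), if_pos (by omega)]
      have h3 := reflTransGen_ascend (M := M) (d := d) (e := e) (X := j) (A := G') (B := j)
        (by omega) le_rfl (by omega)
        (fun y hy hy' => hdj y (by omega) hy'.le) (fun y hy hy' => by
          rw [hej y hy', if_neg (by omega), if_pos hc, if_neg (by omega), if_neg (by omega)])
      refine .head ⟨?_, ?_, ?_⟩ h3
      · change (d (l + a) G).IsReal M (l + a) G
        rw [hbad, hG']; exact isReal_sw (by omega) hlt.le
      · simp only [h2]; exact isReal_ne (by omega) (by omega)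
      · simp only [hbad, h2]
        rw [hG', latticePoint_add_sw, latticePoint_add_ne, hj]
    · have hc' : g j = G := by
        rcases hstep with h4 | h4 <;> omega
      have hGj : G ≤ j := by split_ifs at hinv <;> omega
      have h2 : e j G = se := by
        rw [hej G hGj, if_neg (by omega), if_neg hc, if_neg (by omega), if_pos rfl]
      have h3 := reflTransGen_ascend (M := M) (d := d) (e := e) (X := j) (A := G) (B := j)
        hGj le_rfl (by omega)
        (fun y hy hy' => hdj y (by omega) hy'.le) (fun y hy hy' => by
          rw [hej y hy', if_neg (by omega), if_neg hc, if_neg (by omega), if_neg (by omega)])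
      refine .head ⟨?_, ?_, ?_⟩ h3
      · change (d (l + a) G).IsReal M (l + a) G
        rw [hbad, hG']; exact isReal_sw (by omega) hlt.le
      · change (e j G).IsReal M j G
        rw [h2, hG']; exact isReal_se (by omega) (by omega)
      · simp only [hbad, h2]
        rw [hG', latticePoint_add_sw, latticePoint_add_se, hj]
  have := hmono (l + a) j (by omega) (by omega) h.p_zero hpj (h1.trans hlast)
  omega

/-- In the columns from `l` to `l + a`, the incoming edges below the state have direction `sw`. -/
theorem in_bottom (h : OneRun M l a z s p) {X g : ℕ} {c' : ℕ → Dir} (h1 : l ≤ X) (h2 : X ≤ l + a)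
    (hg : g ≤ X) (hg0 : l < X → 1 ≤ g) (hg1 : X = l → g = 0)
    (hleft : ∀ y < X, (c' y = nw ∨ c' (y + 1) = sw) ↔ ¬ y + 1 = g)
    (hrow : c' 0 = sw ↔ s X = true) : (∀ y < g, c' y = sw) ∧ c' g ≠ sw := by
  rcases h1.lt_or_eq with h3 | rfl
  · have h4 := hrow.2 (h.s_one X h3 h2)
    obtain ⟨q, rfl⟩ : ∃ q, g = q + 1 := ⟨g - 1, by have := hg0 h3; omega⟩
    refine ⟨fun y hy => ?_, fun h5 => (hleft q (by omega)).1 (Or.inr h5) rfl⟩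
    exact column_all_sw (X := q) (fun y hy => (hleft y (by omega)).2 (by omega)) h4 y (by omega)
  · rw [hg1 rfl]
    exact ⟨by simp, fun h4 => by
      have h5 := hrow.1 h4
      rw [h.s_zero] at h5
      cases h5⟩

theorem continues_lt (h : OneRun M l a z s p) {X : ℕ} (hX : X ≤ M) {g : ℕ → ℕ}
    (hinv : (oneRunModel M l a z p).inv X (g X))
    (hf : (oneRunModel M l a z p).Fits M s p X (g X) (d X) (e X))
    (hc : X < l) : (oneRunModel M l a z p).Continues X (g X) (d X) (e X) := by
  have hlt := h.lt
  have hzl := h.le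
  obtain ⟨hol, hil, hoe, hie, hore, hire, hdis, hod, hid, hor, hir, hlast⟩ := hf
  have hZX := zerosBefore_le p X
  simp only [oneRunModel, ColumnModel.Continues] at hinv hol hil ⊢
  simp only [show X ≤ l + a by omega, true_and, if_true, if_pos hc.le] at hinv hol hil
  rw [hinv] at hil
  have hil : ∀ y < X, e X y = nw ∨ e X (y + 1) = sw := fun y hy => (hil y hy).2 (by omega)
  have hs := h.s_eq X (Or.inl hc)
  obtain ⟨hb1, hb2, hb3⟩ := column_bottom (c := d X) (Q := zerosBefore p X)
    (fun y hy h' => (hol y (by omega)).1 h' hy) (fun y hy => hore y (by omega)) hor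
  refine ⟨0, by simp [hc], fun y hy => ?_⟩
  simp only [show X < l + a by omega, show ¬ l ≤ X by omega, show X ≠ l + a by omega,
      false_and, if_true, if_false]
  cases hp : p X
  · have he := column_all_nw hil (hid.2 hp)
    rw [zerosBefore_succ_of_zero hp]
    have h2 : d X (zerosBefore p X) = ne := by
      have h3 := hdis (zerosBefore p X) hZX
      rw [he _ hZX] at h3
      exact Dir.eq_ne hb2 h3 hb3
    refine ⟨?_, by simpa using he y hy⟩
    simp only [Bool.false_eq_true, if_false]
    split_ifs with h4
    · rcases Nat.lt_succ_iff_lt_or_eq.1 h4 with h4 | rfl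
      · exact hb1 y h4
      · exact h2
    · exact column_sw (A := zerosBefore p X) (B := X)
        (fun x hx hx' => (hol x hx').2 (by omega)) (by rw [h2]; simp) (by omega) hy
  · have he := column_all_sw hil (hir.2.2 (hs.trans hp))
    rw [zerosBefore_succ_of_one hp]
    refine ⟨?_, by simpa using he y hy⟩
    simp only [if_true]
    split_ifs with h4
    · exact hb1 y h4
    · rcases hy.lt_or_eq with hy | rfl
      · exact column_nw (A := zerosBefore p X) (B := X)
          (fun x hx hx' => (hol x hx').2 (by omega)) (by rw [hod.2 hp]; simp) (by omega) hy
      · exact hod.2 hp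

/-- In these columns the outgoing edges are forced. The incoming edges have one direction `ne` or
`se` to the right, and its row gives the next state; direction `ne` is possible only from row `z`
on, since the outgoing edges of the lower rows have this direction. -/
theorem continues_run (h : OneRun M l a z s p) {X : ℕ} (hX : X ≤ M) {g : ℕ → ℕ}
    (hinv : (oneRunModel M l a z p).inv X (g X))
    (hf : (oneRunModel M l a z p).Fits M s p X (g X) (d X) (e X))
    (hc : l ≤ X ∧ X < l + a) : (oneRunModel M l a z p).Continues X (g X) (d X) (e X) := by
  have hlt := h.lt
  have hzl := h.le
  obtain ⟨hol, hil, hoe, hie, hore, hire, hdis, hod, hid, hor, hir, hlast⟩ := hf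
  have hZX := zerosBefore_le p X
  simp only [oneRunModel, ColumnModel.Continues] at hinv hol hil ⊢
  have hp := h.p_one X hc.1 hc.2
  have hz := h.pos (by omega)
  have hz1 := h.zeros_mid (X := X) (by omega) (by omega)
  simp only [show X ≤ l + a by omega, true_and, if_true, hz1] at hinv hol hil
  obtain ⟨hb1, hb2, hb3⟩ := column_bottom (c := d X) (Q := z)
    (fun y hy h' => (hol y (by omega)).1 h' hy) (fun y hy => hore y (by omega)) hor
  have hdX : ∀ y, z ≤ y → y ≤ X → d X y = nw := by
    intro y hy hy'
    rcases hy'.lt_or_eq with hy' | rfl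
    · exact column_nw (A := z) (B := X)
        (fun x hx hx' => (hol x hx').2 (by omega)) (by rw [hod.2 hp]; simp) (by omega) hy'
    · exact hod.2 hp
  have hgX : g X ≤ X := by split_ifs at hinv <;> omega
  obtain ⟨he1, he2⟩ := h.in_bottom hc.1 hc.2.le hgX
    (fun h' => by split_ifs at hinv <;> omega) (fun h' => by rwa [if_pos h'.le] at hinv) hil hir.2
  obtain ⟨r, hr1, hr2, hr3, hr4, hr5⟩ := column_exists_right (c := e X) (A := g X) (B := X)
    (fun y hy hy' => (hil y hy').2 (by omega)) (fun y hy hy' => hie y hy') hgX he2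
    (fun h' => by rw [hid.1 h'] at hp; cases hp)
  -- the rows from `z` on are occupied by outgoing edges of direction `nw`
  have hrz : r ≤ z ∨ r = g X := by
    by_contra hcon
    have h1 := hr4 (r - 1) (by omega) (by omega)
    exact hdis (r - 1) (by omega) ((hdX _ (by omega) (by omega)).trans h1.symm)
  simp only [show ¬ X < l by omega, hc.1, hc.2, and_self, if_true, if_false]
  have hout : ∀ y ≤ X, d X y = if y < zerosBefore p (X + 1) then ne else
      if p X = true then nw else sw := by
    intro y hy
    rw [h.zeros_mid (X := X + 1) (by omega) (by omega), if_pos hp]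
    split_ifs with h1
    · exact hb1 y h1
    · exact hdX y (by omega) hy
  rcases hr3 with hr3 | hr3
  · have hrz' : z ≤ r := by
      by_contra hcon
      exact hdis r hr2 ((hb1 r (by omega)).trans hr3.symm)
    refine ⟨r + 1, by omega, fun y hy => ⟨?_, ?_⟩⟩
    · exact hout y hy
    · rw [if_pos (show z < r + 1 ∧ g X < r + 1 by omega)]
      split_ifs with h1 h2 h3
      · exact he1 y h1
      · exact hr4 y (by omega) (by omega)
      · obtain rfl : y = r := by omega
        exact hr3
      · exact hr5 y (by omega) hy
  · have hr0 : r ≠ 0 := by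
      rintro rfl
      exact hir.1 hr3
    refine ⟨r, by omega, fun y hy => ⟨?_, ?_⟩⟩
    · exact hout y hy
    · rw [if_neg (show ¬ (z < r ∧ g X < r) by omega)]
      split_ifs with h1 h2 h3
      · exact he1 y h1
      · exact hr4 y (by omega) (by omega)
      · rw [h3]
        exact hr3
      · exact hr5 y (by omega) hy

theorem continues_last (h : OneRun M l a z s p) {X : ℕ} (hX : X ≤ M) {g : ℕ → ℕ}
    (hmono : NoReturn M p d e)
    (hg : (oneRunModel M l a z p).Follows X g d e)
    (hinv : (oneRunModel M l a z p).inv X (g X))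
    (hf : (oneRunModel M l a z p).Fits M s p X (g X) (d X) (e X))
    (hc : X = l + a) : (oneRunModel M l a z p).Continues X (g X) (d X) (e X) := by
  have hlt := h.lt
  have hzl := h.le
  obtain ⟨hol, hil, hoe, hie, hore, hire, hdis, hod, hid, hor, hir, hlast⟩ := hf
  have hZX := zerosBefore_le p X
  simp only [oneRunModel, ColumnModel.Continues] at hinv hol hil ⊢
  subst hc
  have hz1 := h.zeros_mid (X := l + a) (by omega) le_rfl
  simp only [le_refl, true_and, if_true, hz1] at hinv hol hil
  have hz := h.pos
  obtain ⟨hb1, hb2, hb3⟩ := column_bottom (c := d (l + a)) (Q := z)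
    (fun y hy h' => (hol y (by omega)).1 h' hy) (fun y hy => hore y (by omega)) hor
  have hgX : g (l + a) ≤ l + a := by split_ifs at hinv <;> omega
  obtain ⟨he1, he2⟩ := h.in_bottom (by omega) le_rfl hgX
    (fun h' => by split_ifs at hinv <;> omega) (fun h' => by rwa [if_pos h'.le] at hinv) hil hir.2
  have heX := hid.2 h.p_zero
  have hin : ∀ y, g (l + a) ≤ y → y ≤ l + a → e (l + a) y = nw := by
    intro y hy hy'
    rcases hy'.lt_or_eq with hy' | rfl
    · exact column_nw (A := g (l + a)) (B := l + a) (fun x hx hx' => (hil x hx').2 (by omega))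
        (by rw [heX]; simp) hy hy'
    · exact heX
  simp only [lt_irrefl, show ¬ l + a < l by omega, and_false, if_false, h.p_zero,
    Bool.false_eq_true, true_and, if_true]
  have hcolIn : ∀ y ≤ l + a, e (l + a) y = if y < g (l + a) then sw else nw := by
    intro y hy
    split_ifs with h1
    · exact he1 y h1
    · exact hin y (by omega) hy
  rcases Nat.lt_or_ge z (g (l + a)) with hgz | hgz
  · have ha : 1 ≤ a := by
      by_contra hcon
      split_ifs at hinv <;> omega
    have hgsw := h.out_ne_sw hmono hg ha hgz hgX
      (fun y hy hy' => (hol y hy').2 (by omega)) hin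
    have hgnw : d (l + a) (g (l + a)) ≠ nw := by
      rw [← hin _ le_rfl hgX]
      exact hdis _ hgX
    have hmid : ∀ y, z ≤ y → y < g (l + a) → d (l + a) y = nw := fun y hy hy' =>
      column_nw (A := z) (fun x hx hx' => (hol x (by omega)).2 (by omega)) hgsw hy hy'
    have hup : ∀ y, g (l + a) < y → y ≤ l + a → d (l + a) y = sw := fun y hy hy' =>
      column_sw (fun x hx hx' => (hol x hx').2 (by omega)) hgnw hy hy'
    rcases hgd : d (l + a) (g (l + a)) with _ | _ | _ | _
    · exact absurd hgd hgsw
    · exact absurd hgd hgnw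
    · refine ⟨g (l + a) - 1, by omega, fun y hy => ⟨?_, hcolIn y hy⟩⟩
      split_ifs with h1 h2 h3
      · exact hb1 y h1
      · exact hmid y (by omega) h2
      · rw [h3, max_eq_left hgz.le, hgd]
      · omega
      · exact hup y (by omega) hy
    · refine ⟨g (l + a), by omega, fun y hy => ⟨?_, hcolIn y hy⟩⟩
      split_ifs with h1 h2 h3 h4
      · exact hb1 y h1
      · exact hmid y (by omega) h2
      · omega
      · rw [h3, max_eq_left hgz.le, hgd]
      · exact hup y (by omega) hy
  · have hdz : d (l + a) z = ne := by
      have h1 := hdis z (by omega)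
      rw [hin z hgz (by omega)] at h1
      exact Dir.eq_ne hb2 h1 hb3
    refine ⟨z, by omega, fun y hy => ⟨?_, hcolIn y hy⟩⟩
    rw [max_eq_right hgz]
    split_ifs with h1 h2 h3
    · exact hb1 y h1
    · omega
    · omega
    · rw [h3, hdz]
    · exact column_sw (A := z) (fun x hx hx' => (hol x hx').2 (by omega)) (by rw [hdz]; simp)
        (by omega) hy

/-- Beyond column `l + a` the incoming edges are forced, and the only freedom is the direction `ne`
or `se` of the outgoing edge in the row next to the displaced cell. -/
theorem continues_gt (h : OneRun M l a z s p) {X : ℕ} (hX : X ≤ M) {g : ℕ → ℕ}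
    (hinv : (oneRunModel M l a z p).inv X (g X))
    (hf : (oneRunModel M l a z p).Fits M s p X (g X) (d X) (e X))
    (hc : l + a < X) : (oneRunModel M l a z p).Continues X (g X) (d X) (e X) := by
  have hlt := h.lt
  have hzl := h.le
  obtain ⟨hol, hil, hoe, hie, hore, hire, hdis, hod, hid, hor, hir, hlast⟩ := hf
  have hZX := zerosBefore_le p X
  simp only [oneRunModel, ColumnModel.Continues] at hinv hol hil ⊢
  have hs := h.s_eq X (Or.inr hc)
  have hZ1 := h.zeros_gt hc
  simp only [show ¬ X ≤ l + a by omega, show ¬ X ≤ l by omega, false_and, if_false,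
    not_false_eq_true, iff_true] at hinv hol hil
  obtain ⟨hb1, hb2, hb3⟩ := column_bottom (c := d X) (Q := zerosBefore p X - 1)
    (fun y hy h' => (hol y (by omega)).1 h' (Or.inl (by omega))) (fun y hy => hore y (by omega)) hor
  simp only [show ¬ X < l + a by omega, show ¬ X < l by omega, show X ≠ l + a by omega,
    false_and, and_false, if_false]
  cases hp : p X
  · have he := column_all_nw hil (hid.2 hp)
    have hnw : ∀ y ≤ X, d X y ≠ nw := fun y hy => by
      rw [← he y hy]; exact hdis y hy
    rw [zerosBefore_succ_of_zero hp]
    simp only [Bool.false_eq_true, if_false]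
    generalize hZ : zerosBefore p X = Z at *
    have hlow : ∀ y < Z, d X y = ne := by
      intro y hy
      by_cases h1 : y < Z - 1
      · exact hb1 y h1
      · obtain rfl : y = Z - 1 := by omega
        exact Dir.eq_ne hb2 (hnw (Z - 1) (by omega)) hb3
    have hhigh : ∀ y, Z ≤ y → y ≤ X → y + z ≠ Z + g X → d X y = sw := by
      intro y hy hy' hne
      obtain ⟨q, rfl⟩ : ∃ q, y = q + 1 := ⟨y - 1, by omega⟩
      exact ((hol q (by omega)).2 (by omega)).resolve_left (hnw q (by omega))
    obtain ⟨q, hq⟩ : ∃ q, q + 1 + z = Z + g X := ⟨Z + g X - z - 1, by omega⟩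
    have hqsw : d X (q + 1) ≠ sw := fun h' =>
      (hol q (by omega)).1 (Or.inr h') (Or.inr hq)
    have hqnw := hnw (q + 1) (by omega)
    rcases hqd : d X (q + 1) with _ | _ | _ | _
    · exact absurd hqd hqsw
    · exact absurd hqd hqnw
    · have hzg : z < g X := by
        by_contra hcon
        exact hore q (by omega) ⟨hlow q (by omega), hqd⟩
      have hXM : X ≠ M := fun h' => hlast h' (q + 1) (by omega) hqd
      refine ⟨g X - 1, by omega, fun y hy => ⟨?_, by simpa using he y hy⟩⟩
      split_ifs with h1 h2 h3
      · exact hlow y (by omega)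
      · obtain rfl : y = q + 1 := by omega
        exact hqd
      · omega
      · exact hhigh y (by omega) hy (by omega)
    · refine ⟨g X, by omega, fun y hy => ⟨?_, by simpa using he y hy⟩⟩
      split_ifs with h1 h2 h3
      · exact hlow y (by omega)
      · omega
      · obtain rfl : y = q + 1 := by omega
        exact hqd
      · exact hhigh y (by omega) hy (by omega)
  · have he := column_all_sw hil (hir.2.2 (hs.trans hp))
    have hsw : ∀ y ≤ X, d X y ≠ sw := fun y hy => by
      rw [← he y hy]; exact hdis y hy
    rw [zerosBefore_succ_of_one hp]
    simp only [if_true]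
    generalize hZ : zerosBefore p X = Z at *
    have hhigh : ∀ y, Z ≤ y + 1 → y ≤ X → y + 1 + z ≠ Z + g X → d X y = nw := by
      intro y hy hy' hne
      rcases hy'.lt_or_eq with hy' | rfl
      · exact ((hol y hy').2 (by omega)).resolve_right (hsw (y + 1) hy')
      · exact hod.2 hp
    obtain ⟨q, hq⟩ : ∃ q, q + 1 + z = Z + g X := ⟨Z + g X - z - 1, by omega⟩
    have hqnw : d X q ≠ nw := fun h' => (hol q (by omega)).1 (Or.inl h') (Or.inr hq)
    have hqsw := hsw q (by omega)
    rcases hqd : d X q with _ | _ | _ | _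
    · exact absurd hqd hqsw
    · exact absurd hqd hqnw
    · have hzg : z < g X := by
        by_contra hcon
        obtain rfl : q = Z - 1 := by omega
        exact hb3 hqd
      have hXM : X ≠ M := fun h' => hlast h' q (by omega) hqd
      refine ⟨g X - 1, by omega, fun y hy => ⟨?_, by simpa using he y hy⟩⟩
      split_ifs with h1 h2 h3
      · exact hb1 y (by omega)
      · obtain rfl : y = q := by omega
        exact hqd
      · omega
      · exact hhigh y (by omega) hy (by omega)
    · refine ⟨g X, by omega, fun y hy => ⟨?_, by simpa using he y hy⟩⟩
      split_ifs with h1 h2 h3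
      · exact hb1 y (by omega)
      · omega
      · obtain rfl : y = q := by omega
        exact hqd
      · exact hhigh y (by omega) hy (by omega)

theorem continues (h : OneRun M l a z s p) (hmono : NoReturn M p d e)
    {X : ℕ} (hX : X ≤ M) {g : ℕ → ℕ} (hg : (oneRunModel M l a z p).Follows X g d e)
    (hinv : (oneRunModel M l a z p).inv X (g X))
    (hf : (oneRunModel M l a z p).Fits M s p X (g X) (d X) (e X)) :
    (oneRunModel M l a z p).Continues X (g X) (d X) (e X) := by
  have hcases : X < l ∨ (l ≤ X ∧ X < l + a) ∨ X = l + a ∨ l + a < X := by omega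
  rcases hcases with hc | hc | hc | hc
  · exact h.continues_lt hX hinv hf hc
  · exact h.continues_run hX hinv hf hc
  · exact h.continues_last hX hmono hg hinv hf hc
  · exact h.continues_gt hX hinv hf hc

end OneRun

/-! ### Configurations as sequences of states -/

/-- The right boundary word is determined by the last state. -/
theorem ColumnModel.IsValid.right_word {α : Type*} {m : ColumnModel α} {M : ℕ} {s t p : ℕ → Bool}
    {d e : ℕ → ℕ → Dir} (hm : m.IsValid M s p) {g : ℕ → α} (h : IsTangle M s t p d e)
    (hg : m.IsChain M g) (hd : d = m.outDir M g) (Y : ℕ) (hY : Y ≤ M) :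
    t Y = false ↔ m.usedOut M (g M) Y := by
  rw [← (h.out_col Y hY).2, hd, ColumnModel.outDir_eq hY le_rfl]
  exact (hm.last _ _ (hg.inv hm (by omega)) (hg.step M le_rfl) Y hY).1.2

/-- If a model describes exactly the tangles of configurations, and is determined by them, then the
configurations are counted by the sequences of states. -/
theorem ColumnModel.tfplNumber_eq {α : Type*} (m : ColumnModel α) {n M : ℕ} {σ τ π : List (Fin 2)}
    (hM : M + 1 = 2 * n) (hσ : σ ∈ dyckWords n) (hτ : τ ∈ dyckWords n) (hπ : π ∈ dyckWords n)
    (hm : m.IsValid M (letterFun σ) (letterFun π))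
    (hcont : ∀ d e, IsTangle M (letterFun σ) (letterFun τ) (letterFun π) d e →
      NoReturn M (letterFun π) d e → ∀ X ≤ M, ∀ g, m.Follows X g d e →
      m.inv X (g X) → m.Fits M (letterFun σ) (letterFun π) X (g X) (d X) (e X) →
      m.Continues X (g X) (d X) (e X))
    (hmono : ∀ g, m.IsChain M g →
      IsTangle M (letterFun σ) (letterFun τ) (letterFun π) (m.outDir M g) (m.inDir M g) →
      NoReturn M (letterFun π) (m.outDir M g) (m.inDir M g))
    (hinj : ∀ X ≤ M, ∀ x x' x'', m.inv X x → m.step X x x' → m.step X x x'' →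
      (∀ y ≤ X, (m.colOut X x x' y = m.colOut X x x'' y ∧ m.colIn X x x' y = m.colIn X x x'' y) ∨
        (m.colOut X x x' y = m.colIn X x x'' y ∧ m.colIn X x x' y = m.colOut X x x'' y)) →
      x' = x'') :
    tfplNumber n σ τ π =
      {g | m.IsChain M g ∧ ∀ Y ≤ M, letterFun τ Y = false ↔ m.usedOut M (g M) Y}.ncard := by
  have himage : tfplSet n σ τ π = (fun g => toGraph M (m.outDir M g) (m.inDir M g)) ''
      {g | m.IsChain M g ∧ ∀ Y ≤ M, letterFun τ Y = false ↔ m.usedOut M (g M) Y} := by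
    ext f
    constructor
    · intro hf
      obtain ⟨d, e, ht, hmono', rfl⟩ := IsTFPL.exists_isTangle hf hM hσ hτ hπ
      obtain ⟨g, hg, hd, he⟩ := exists_isChain hm ht (hcont d e ht hmono')
      refine ⟨g, ⟨hg, hm.right_word ht hg hd⟩, ?_⟩
      simp only [hd, he]
    · rintro ⟨g, ⟨hg, hgt⟩, rfl⟩
      have ht := hg.isTangle hm hgt
      exact ht.isTFPL hM hσ.1 hτ.1 hπ (hmono g hg ht)
  rw [tfplNumber, himage, Set.InjOn.ncard_image]
  rintro g ⟨hg, hgt⟩ g' ⟨hg', hgt'⟩ heq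
  exact hg.eq_of_toGraph_eq hg' hm hgt hgt' hinj heq

theorem reflTransGen_invariant {β : Type*} {r : β → β → Prop} (I : β → Prop) {P Q : β}
    (h : ReflTransGen r P Q) (hP : I P) (hI : ∀ A B, I A → r A B → I B) : I Q := by
  induction h with
  | refl => exact hP
  | tail _ h ih => exact hI _ _ ih h

/-- The number of lattice paths with steps `0` and `-1` and `N` steps from `i` to `k`. -/
def stepCount (N i k : ℕ) : ℕ := if k ≤ i then N.choose (i - k) else 0

theorem stepCount_succ (N i k : ℕ) :
    stepCount (N + 1) (i + 1) k = stepCount N (i + 1) k + stepCount N i k := by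
  unfold stepCount
  rcases lt_trichotomy k (i + 1) with h | rfl | h
  · rw [if_pos h.le, if_pos h.le, if_pos (by omega), show i + 1 - k = i - k + 1 by omega,
      Nat.choose_succ_succ]
    ring
  · simp
  · rw [if_neg (by omega), if_neg (by omega), if_neg (by omega)]

theorem stepCount_zero (N N' k : ℕ) : stepCount N 0 k = stepCount N' 0 k := by
  unfold stepCount
  split_ifs with h
  · obtain rfl : k = 0 := by omega
    simp
  · rfl

theorem stepCount_add_sum (N j m k : ℕ) :
    stepCount N (j + 1) k + ∑ t ∈ Finset.range m, stepCount (N + t) j k =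
      stepCount (N + m) (j + 1) k := by
  induction m with
  | zero => simp
  | succ m ih =>
    rw [Finset.sum_range_succ, ← Nat.add_assoc, ih, ← stepCount_succ]
    rfl

namespace OneRun

variable {M l a z : ℕ} {s t p : ℕ → Bool}

/-- A strand leaves a column to the left only within the run of letters `1` of `p`. -/
theorem backward {g : ℕ → ℕ} {P Q : ℕ × ℕ}
    (hPQ : TangleStep M ((oneRunModel M l a z p).outDir M g)
      ((oneRunModel M l a z p).inDir M g) P Q) :
    P.1 ≤ Q.1 ∨ (P.1 = Q.1 + 1 ∧ l ≤ Q.1 ∧ Q.1 < l + a) := by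
  rcases hPQ.fst_le with h1 | ⟨h1, h2, -⟩
  · exact Or.inl h1
  · refine Or.inr ⟨h1, ?_⟩
    by_contra hcon
    obtain ⟨h3, h4, -, -⟩ := hPQ.2.1
    rw [ColumnModel.inDir_eq h3 h4] at h2
    simp only [oneRunModel, if_neg hcon] at h2
    split_ifs at h2 <;> simp at h2

/-- Strands run back to the left only in columns with a letter `1` of `p`, so it suffices to
consider the external edge `l + a`. Its strand goes down this column, stays above the cell in which
a strand leaves the column to the left, and goes on to the right. -/
theorem noReturn (h : OneRun M l a z s p) {g : ℕ → ℕ} (hg : (oneRunModel M l a z p).IsChain M g) :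
    NoReturn M p ((oneRunModel M l a z p).outDir M g) ((oneRunModel M l a z p).inDir M g) := by
  intro i j hi hj hpi hpj hij
  have hlt := h.lt
  have hne : i ≠ j := by rintro rfl; rw [hpi] at hpj; cases hpj
  have hcases : i < l ∨ (l ≤ i ∧ i < l + a) ∨ i = l + a ∨ l + a < i := by omega
  rcases hcases with hc | hc | rfl | hc
  · have := reflTransGen_invariant (fun Q => i ≤ Q.1) hij le_rfl (fun A B hA hAB => by
      have := backward hAB; omega)
    simp only at this
    omega
  · rw [h.p_one i hc.1 hc.2] at hpi; cases hpi
  · have hX := hlt.le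
    have hinv := hg.inv h.isValid (s := s) (X := l + a) (by omega)
    have hzl := h.le
    have hgX : g (l + a) ≤ l + a := by
      simp only [oneRunModel] at hinv
      split_ifs at hinv <;> omega
    have hin : ∀ y ≤ l + a, (oneRunModel M l a z p).inDir M g (l + a) y =
        if y < g (l + a) then sw else nw := by
      intro y hy
      rw [ColumnModel.inDir_eq hy hX]
      simp [oneRunModel, h.p_zero]
    have hout : ∀ y ≤ l + a, max (g (l + a)) z ≤ y →
        ((y = max (g (l + a)) z ∧ ((oneRunModel M l a z p).outDir M g (l + a) y = se ∨
          (oneRunModel M l a z p).outDir M g (l + a) y = ne)) ∨ (max (g (l + a)) z < y ∧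
          (oneRunModel M l a z p).outDir M g (l + a) y = sw)) := by
      intro y hy hy'
      rw [ColumnModel.outDir_eq hy hX]
      simp only [oneRunModel, lt_irrefl, if_true, if_false]
      rw [if_neg (by omega), if_neg (by omega)]
      by_cases h1 : y = max (g (l + a)) z
      · rw [if_pos h1]
        split_ifs <;> simp [h1]
      · rw [if_neg h1]
        exact Or.inr ⟨by omega, rfl⟩
    -- the strand goes down column `l + a` and leaves it to the right
    have := reflTransGen_invariant
      (fun Q => (Q.1 = l + a ∧ max (g (l + a)) z ≤ Q.2) ∨ l + a < Q.1) hij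
      (Or.inl ⟨rfl, by simp only; omega⟩) (fun A B hA hAB => by
        have hback := backward hAB
        rcases hA with ⟨hA1, hA2⟩ | hA
        · obtain ⟨A1, A2⟩ := A
          obtain ⟨B1, B2⟩ := B
          simp only at hA1 hA2 hback ⊢
          subst hA1
          have hfst := hAB.fst_le
          obtain ⟨hr1, hr2, heq⟩ := hAB
          simp only at hr1 hr2 heq hfst
          rcases hout A2 hr1.1 hA2 with ⟨rfl, hd⟩ | ⟨hlt', hd⟩
          · right
            have hB : l + a ≤ B1 := by
              rcases hfst with h1 | ⟨-, -, h1⟩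
              · exact h1
              · rcases hd with hd | hd <;> rw [hd] at h1 <;> simp at h1
            refine lt_of_le_of_ne hB ?_
            rintro rfl
            have he := hin B2 hr2.1
            have hd' : ((oneRunModel M l a z p).outDir M g (l + a)
                (max (g (l + a)) z)).offset.1 + ((oneRunModel M l a z p).outDir M g (l + a)
                (max (g (l + a)) z)).offset.2 = 1 := by
              rcases hd with hd | hd <;> rw [hd] <;> rfl
            have he' : ((oneRunModel M l a z p).inDir M g (l + a) B2).offset.1 +
                ((oneRunModel M l a z p).inDir M g (l + a) B2).offset.2 = -1 := by
              rw [he]; split_ifs <;> rfl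
            simp only [latticePoint, Prod.ext_iff, Prod.fst_add, Prod.snd_add] at heq
            omega
          · left
            obtain ⟨q, rfl⟩ : ∃ q, A2 = q + 1 := ⟨A2 - 1, by omega⟩
            have he : (oneRunModel M l a z p).inDir M g (l + a) q = nw := by
              rw [hin q (by have := hr1.1; omega), if_neg (by omega)]
            have hdim := isDimer_of_isColumn (M := M) (d := (oneRunModel M l a z p).inDir M g)
              (κ := fun X => (oneRunModel M l a z p).usedIn X (g X))
              (fun X hX => ((h.isValid.in_column X hX _ _
                (hg.inv h.isValid (by omega)) (hg.step X hX)).congr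
                  fun y hy => ColumnModel.inDir_eq hy hX))
              (fun X => by rw [ColumnModel.inDir, if_neg (by omega)]; simp)
            obtain ⟨h5, h6⟩ := hdim.injective (X := l + a) (Y := q) (X' := B1) (Y' := B2)
              (by rw [he]; exact isReal_nw (by have := hr1.1; omega) hX) hr2
              (by rw [he, ← heq, hd, latticePoint_add_sw, latticePoint_add_nw])
            exact ⟨h5.symm, by omega⟩
        · right; omega)
    simp only at this
    omega
  · have := reflTransGen_invariant (fun Q => i ≤ Q.1) hij le_rfl (fun A B hA hAB => by
      have := backward hAB; omega)
    simp only at this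
    omega

/-- The next state affects the directions of one kind only, outgoing or incoming. So the unordered
pairs of directions determine both, and the row of the direction `ne` or `se` gives the next state.
-/
theorem eq_of_columns (h : OneRun M l a z s p) (X : ℕ) (hX : X ≤ M) (x x' x'' : ℕ)
    (hx : (oneRunModel M l a z p).inv X x) (h1 : (oneRunModel M l a z p).step X x x')
    (h2 : (oneRunModel M l a z p).step X x x'')
    (hpair : ∀ y ≤ X, ((oneRunModel M l a z p).colOut X x x' y =
        (oneRunModel M l a z p).colOut X x x'' y ∧
        (oneRunModel M l a z p).colIn X x x' y = (oneRunModel M l a z p).colIn X x x'' y) ∨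
      ((oneRunModel M l a z p).colOut X x x' y = (oneRunModel M l a z p).colIn X x x'' y ∧
        (oneRunModel M l a z p).colIn X x x' y = (oneRunModel M l a z p).colOut X x x'' y)) :
    x' = x'' := by
  have hdis := h.disjoint X hX x x'' hx h2
  have hzl := h.le
  have hlt := h.lt
  have hcases : X < l ∨ (l ≤ X ∧ X < l + a) ∨ X = l + a ∨ l + a < X := by omega
  rcases hcases with hc | hc | hc | hc
  · simp only [oneRunModel, if_pos hc] at h1 h2
    omega
  · have hin : ∀ y ≤ X, (oneRunModel M l a z p).colIn X x x' y =
        (oneRunModel M l a z p).colIn X x x'' y := by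
      intro y hy
      refine (hpair y hy).elim (fun h => h.2) fun h => absurd h.1 ?_
      have : (oneRunModel M l a z p).colOut X x x' y =
          (oneRunModel M l a z p).colOut X x x'' y := by
        simp only [oneRunModel, if_pos hc.2]
      rw [this]
      exact hdis y hy
    have hxX : x ≤ X := by
      simp only [oneRunModel] at hx
      split_ifs at hx <;> omega
    simp only [oneRunModel, if_pos hc, if_neg (show ¬ X < l by omega), if_pos hc.2] at h1 h2 hin
    by_cases h3 : z < x' ∧ x < x'
    · have := hin (x' - 1) (by omega)
      rw [if_neg (by omega), if_pos h3, if_neg (by omega), if_pos (by omega)] at this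
      split_ifs at this; omega
    · have := hin x' (by omega)
      rw [if_neg (by omega), if_neg h3, if_neg (by omega), if_pos rfl] at this
      split_ifs at this; omega
  · subst hc
    have hout : ∀ y ≤ l + a, (oneRunModel M l a z p).colOut (l + a) x x' y =
        (oneRunModel M l a z p).colOut (l + a) x x'' y := by
      intro y hy
      refine (hpair y hy).elim (fun h => h.1) fun h' => absurd h'.1.symm ?_
      have : (oneRunModel M l a z p).colIn (l + a) x x'' y =
          (oneRunModel M l a z p).colIn (l + a) x x' y := by
        simp only [oneRunModel, lt_irrefl, and_false, if_false]
      rw [this]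
      exact (h.disjoint (l + a) hX x x' hx h1 y hy).symm
    have hxX : x ≤ l + a := by
      simp only [oneRunModel] at hx
      split_ifs at hx <;> omega
    have h3 := hout (max x z) (by omega)
    simp only [oneRunModel, lt_irrefl, if_false, if_true, if_neg (show ¬ l + a < l by omega),
      if_neg (show ¬ max x z < z by omega), if_neg (show ¬ max x z < x by omega)] at h1 h2 h3
    split_ifs at h3 <;> omega
  · have hout : ∀ y ≤ X, (oneRunModel M l a z p).colOut X x x' y =
        (oneRunModel M l a z p).colOut X x x'' y := by
      intro y hy
      refine (hpair y hy).elim (fun h => h.1) fun h' => absurd h'.1.symm ?_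
      have : (oneRunModel M l a z p).colIn X x x'' y =
          (oneRunModel M l a z p).colIn X x x' y := by
        simp only [oneRunModel, if_neg (show ¬ (l ≤ X ∧ X < l + a) by omega)]
      rw [this]
      exact (h.disjoint X hX x x' hx h1 y hy).symm
    have hZ : zerosBefore p (X + 1) ≤ zerosBefore p X + 1 := by
      cases hp : p X
      · rw [zerosBefore_succ_of_zero hp]
      · rw [zerosBefore_succ_of_one hp]; omega
    have hZ' := h.zeros_gt (X := X + 1) (by omega)
    simp only [oneRunModel, if_neg (show ¬ X < l by omega), if_neg (show ¬ X < l + a by omega),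
      if_neg (show ¬ X ≤ l by omega), if_neg (show ¬ X ≤ l + a by omega),
      if_neg (show X ≠ l + a by omega)] at h1 h2 hx hout
    have h3 := hout (zerosBefore p (X + 1) + x - z - 1) (by omega)
    rw [if_neg (by omega), if_pos (by omega)] at h3
    split_ifs at h3 <;> omega

/-- The transfer matrix count. From the first state `g ≥ z` on, the excess of the state over `z`,
increased by the number of columns left in the run, makes steps `0` and `-1`. A state `g ≤ z` in the
run has the same number of continuations as the state `z` would have with `z - g` further steps. -/
theorem ncard_isChain (h : OneRun M l a z s p) (k : ℕ) :
    {g | (oneRunModel M l a z p).IsChain M g ∧ g (M + 1) = z + k}.ncard =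
      stepCount (M - l + z - 1) a k := by
  have hzl := h.le
  have hlt := h.lt
  rw [ColumnModel.setOf_isChain _ _ (fun x => x = z + k)]
  let W : ℕ → ℕ → ℕ := fun X g =>
    if X ≤ l then stepCount (M - l + z - 1) a k
    else if X ≤ l + a then
      if z ≤ g then stepCount (M - X) (g - z + (l + a - X)) k
      else stepCount (M - X + (z - g)) (l + a - X) k
    else stepCount (M - X) (g - z) k
  have hrun : ∀ X g, (1 ≤ g ∨ X = l) → l ≤ X → X < l + a → g ≤ z → 1 ≤ z → ∀ g0, g0 = max 1 g →
      W (X + 1) (z + 1) + ∑ g' ∈ (Finset.range (z + 1 - g0)).image (fun t => z - t), W (X + 1) g' =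
        stepCount (M - X - 1 + (z + 1 - g0)) (l + a - X) k := by
    intro X g _ hX hX' hgz hz g0 hg0
    have hinj : Set.InjOn (fun t => z - t) (Finset.range (z + 1 - g0) : Set ℕ) := by
      intro t ht t' ht' heq
      simp only [Finset.coe_range, Set.mem_Iio] at ht ht' heq
      omega
    rw [Finset.sum_image hinj]
    have h1 : ∀ t ∈ Finset.range (z + 1 - g0), W (X + 1) (z - t) =
        stepCount (M - X - 1 + t) (l + a - X - 1) k := by
      intro t ht
      have ht := Finset.mem_range.1 ht
      simp only [W]
      rw [if_neg (by omega), if_pos (by omega)]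
      split_ifs with h2
      · obtain rfl : t = 0 := by omega
        congr 1; omega
      · congr 1; omega
    rw [Finset.sum_congr rfl h1]
    have h2 : W (X + 1) (z + 1) = stepCount (M - X - 1) (l + a - X - 1 + 1) k := by
      simp only [W]
      rw [if_neg (by omega), if_pos (by omega), if_pos (by omega)]
      congr 1; omega
    rw [h2, stepCount_add_sum]
    congr 1; omega
  have hrun_mem : ∀ g g0, g ≤ z → 1 ≤ z → g0 = max 1 g → ∀ x',
      (x' ∈ insert (z + 1) ((Finset.range (z + 1 - g0)).image (fun t => z - t)) ↔
        (x' = max g z + 1 ∨ (1 ≤ x' ∧ g ≤ x' ∧ (x' ≤ z ∨ x' = g)))) := by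
    intro g g0 hg hz hg0 x'
    simp only [Finset.mem_insert, Finset.mem_image, Finset.mem_range]
    constructor
    · rintro (rfl | ⟨t, ht, rfl⟩) <;> omega
    · rintro (rfl | h1)
      · left; omega
      · exact Or.inr ⟨z - x', by omega, by omega⟩
  have hnotin : ∀ g0, z + 1 ∉ (Finset.range (z + 1 - g0)).image (fun t => z - t) := by
    intro g0
    simp only [Finset.mem_image, Finset.mem_range, not_exists, not_and]
    intro t _
    omega
  have hpair : ∀ N i, 1 ≤ N → stepCount (N - 1) (i + 1) k + stepCount (N - 1) i k =
      stepCount N (i + 1) k := by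
    intro N i hN
    rw [← stepCount_succ, Nat.sub_add_cancel hN]
  have key := ncard_pathSet (P := fun x => x = z + k) (o := 0)
    (step := (oneRunModel M l a z p).step)
    (oneRunModel M l a z p).inv W (N := M + 1)
    (fun X hX => h.inv_step X (by omega)) ?_ ?_ (Nat.zero_le _) h.isValid.inv_start
  · change (pathSet (oneRunModel M l a z p).step (fun x => x = z + k) 0 (M + 1) 0 0).ncard = _
    rw [show (oneRunModel M l a z p).start = 0 from rfl] at key
    rw [key]
    simp [W]
  · intro x hx
    simp only [oneRunModel, if_neg (show ¬ M + 1 ≤ l by omega),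
      if_neg (show ¬ M + 1 ≤ l + a by omega)] at hx
    simp only [W, if_neg (show ¬ M + 1 ≤ l by omega),
      if_neg (show ¬ M + 1 ≤ l + a by omega), show M - (M + 1) = 0 by omega, stepCount]
    constructor
    · rintro rfl
      simp
    · intro h1
      split_ifs with h2
      · exact Nat.choose_eq_zero_of_lt (by omega)
      · rfl
  · intro X hX x hx
    have hz := h.pos
    have hinv := hx
    simp only [oneRunModel] at hx ⊢
    have hcases : X < l ∨ (l ≤ X ∧ X < l + a) ∨ l + a ≤ X := by omega
    rcases hcases with hc | hc | hc
    · refine ⟨{0}, fun x' => by simp [hc], ?_⟩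
      simp only [Finset.sum_singleton, W, if_pos hc.le, if_pos (show X + 1 ≤ l from hc)]
    · simp only [if_neg (show ¬ X < l by omega), if_pos hc.2]
      by_cases hxz : x ≤ z
      · refine ⟨_, hrun_mem x _ hxz (hz (by omega)) rfl, ?_⟩
        rw [Finset.sum_insert (hnotin _), hrun X x (by split_ifs at hx <;> omega) hc.1 hc.2 hxz
          (hz (by omega)) _ rfl]
        simp only [W]
        split_ifs at hx with h1 h2
        · obtain rfl : X = l := by omega
          rw [if_pos le_rfl]
          have := hz (by omega)
          congr 1 <;> omega
        · rw [if_neg h1, if_pos h2]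
          split_ifs with h3
          · congr 1 <;> omega
          · congr 1; omega
        · omega
      · refine ⟨{x + 1, x}, fun x' => ?_, ?_⟩
        · simp only [Finset.mem_insert, Finset.mem_singleton]
          omega
        · rw [Finset.sum_pair (by omega)]
          split_ifs at hx with h1 h2
          · omega
          · have hWr : ∀ X' x', l < X' → X' ≤ l + a → z ≤ x' →
                W X' x' = stepCount (M - X') (x' - z + (l + a - X')) k := fun X' x' h3 h4 h5 => by
              simp only [W]
              rw [if_neg (by omega), if_pos h4, if_pos h5]
            rw [hWr X x (by omega) h2 (by omega), hWr _ (x + 1) (by omega) hc.2 (by omega),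
              hWr _ x (by omega) hc.2 (by omega),
              show x + 1 - z + (l + a - (X + 1)) = x - z + (l + a - (X + 1)) + 1 by omega,
              show M - (X + 1) = M - X - 1 by omega, hpair _ _ (by omega)]
            congr 1; omega
          · omega
    · simp only [if_neg (show ¬ X < l by omega), if_neg (show ¬ X < l + a by omega)]
      have hW1 : ∀ x', W (X + 1) x' = stepCount (M - (X + 1)) (x' - z) k := fun x' => by
        simp only [W]
        rw [if_neg (by omega), if_neg (by omega)]
      have hW : W X x = stepCount (M - X) (x - z) k := by
        simp only [W]
        split_ifs at hx ⊢ with h1 h2 h3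
        · obtain rfl : a = 0 := by omega
          rw [hx, Nat.zero_sub]
          exact stepCount_zero _ _ _
        · congr 1; omega
        · rw [show l + a - X = 0 by omega, show x - z = 0 by omega]
          exact stepCount_zero _ _ _
        · rfl
      rcases Nat.lt_or_ge X M with hXM | hXM
      · by_cases hxz : z < x
        · refine ⟨{x, x - 1}, fun x' => ?_, ?_⟩
          · simp only [Finset.mem_insert, Finset.mem_singleton]
            omega
          · rw [Finset.sum_pair (by omega), hW, hW1, hW1,
              show x - z = x - 1 - z + 1 by omega, show M - (X + 1) = M - X - 1 by omega,
              hpair _ _ (by omega)]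
        · refine ⟨{z}, fun x' => ?_, ?_⟩
          · simp only [Finset.mem_singleton]
            omega
          · rw [Finset.sum_singleton, hW, hW1, Nat.sub_self, show x - z = 0 by omega]
            exact stepCount_zero _ _ _
      · obtain rfl : X = M := by omega
        rw [if_neg (by omega), if_neg (by omega)] at hx
        refine ⟨{x}, fun x' => ?_, ?_⟩
        · simp only [Finset.mem_singleton]
          omega
        · rw [Finset.sum_singleton, hW, hW1]
          congr 1; omega

end OneRun

/-! ### The right boundary words -/

theorem length_eq_count_add_count (w : List (Fin 2)) : w.length = w.count 0 + w.count 1 := by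
  induction w with
  | nil => simp
  | cons a w ih =>
    have h2 : ∀ x : Fin 2, x = 0 ∨ x = 1 := by decide
    rcases h2 a with rfl | rfl <;> simp [ih] <;> omega

theorem zerosBefore_letterFun (w : List (Fin 2)) {k : ℕ} (hk : k ≤ w.length) :
    zerosBefore (letterFun w) k = (w.take k).count 0 := by
  have h1 := wordHeight_letterFun w hk
  have h2 := length_eq_count_add_count (w.take k)
  have h3 := wordHeight_eq (letterFun w) k
  rw [List.length_take, min_eq_left hk] at h2
  omega

theorem zerosBefore_last {n M : ℕ} {w : List (Fin 2)} (hM : M + 1 = 2 * n) (hw : w ∈ dyckWords n) :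
    zerosBefore (letterFun w) M = n := by
  obtain ⟨h1, h2, -⟩ := dyckWords_count hw
  have h3 := (hM ▸ dyckWords_isBallot hw).last
  have h4 := zerosBefore_letterFun w (k := M + 1) (by omega)
  rw [zerosBefore_succ_of_one h3, List.take_of_length_le (by omega), h2] at h4
  exact h4

/-- Words of the same length are equal if they have the same letters `0`. -/
theorem eq_of_letterFun {w w' : List (Fin 2)} (hlen : w.length = w'.length)
    (h : ∀ i < w.length, letterFun w i = false ↔ letterFun w' i = false) : w = w' := by
  refine List.ext_getElem? fun i => ?_
  by_cases hi : i < w.length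
  · have h1 := h i hi
    rw [letterFun_eq_false hi, letterFun_eq_false (by omega)] at h1
    rw [List.getElem?_eq_getElem hi, List.getElem?_eq_getElem (by omega)] at h1 ⊢
    have h2 : ∀ x y : Fin 2, (some x = some 0 ↔ some y = some 0) → some x = some y := by decide
    exact h2 _ _ h1
  · rw [List.getElem?_eq_none (by omega), List.getElem?_eq_none (by omega)]

theorem letterFun_oneRun_right {n k i : ℕ} (hk : k ≤ n) (hi : i < 2 * n) :
    letterFun (List.replicate (n - 1) 0 ++ List.replicate k 1 ++ [0] ++ List.replicate (n - k) 1) i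
      = false ↔ i + 1 < n ∨ i + 1 = n + k := by
  rw [letterFun_eq_false (by
    simp only [List.length_append, List.length_replicate, List.length_singleton]; omega)]
  simp only [List.getElem?_append, List.getElem?_replicate, List.length_append,
    List.length_replicate, List.length_singleton, List.getElem?_singleton]
  split_ifs <;> simp only [Option.some_inj, one_ne_zero, true_iff,
    false_iff] <;> omega

theorem letterFun_zeroRun_right {n k i : ℕ} (hk : k ≤ n) (hi : i < 2 * n) :
    letterFun (List.replicate (n - k) 0 ++ [1] ++ List.replicate k 0 ++ List.replicate (n - 1) 1) i
      = false ↔ i ≤ n ∧ i + k ≠ n := by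
  rw [letterFun_eq_false (by
    simp only [List.length_append, List.length_replicate, List.length_singleton]; omega)]
  simp only [List.getElem?_append, List.getElem?_replicate, List.length_append,
    List.length_replicate, List.length_singleton, List.getElem?_singleton]
  split_ifs <;> simp only [Option.some_inj, one_ne_zero, true_iff,
    false_iff] <;> omega

/-- The condition `l + a < M` holds since `p` ends with a letter `1`. -/
theorem OneRun.of_words {n M a : ℕ} {u v σ π : List (Fin 2)} (hM : M + 1 = 2 * n)
    (hσ : σ ∈ dyckWords n) (hπ : π ∈ dyckWords n)
    (hσu : σ = u ++ [0] ++ List.replicate a 1 ++ v)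
    (hπu : π = u ++ List.replicate a 1 ++ [0] ++ v) :
    OneRun M u.length a (u.count 0) (letterFun σ) (letterFun π) := by
  have hlσ := (dyckWords_count hσ).1
  have hlπ := (dyckWords_count hπ).1
  have hb : IsBallot (letterFun π) (M + 1) := hM ▸ dyckWords_isBallot hπ
  have hlen : u.length + a + 1 + v.length = 2 * n := by
    rw [← hlπ, hπu]; simp; omega
  have hp : letterFun π (u.length + a) = false := by
    rw [letterFun_eq_false (by omega), hπu]
    simp
  refine ⟨?_, ?_, hp, ?_, ?_, ?_, hb.first, hb.last, ?_⟩
  · rw [zerosBefore_letterFun π (by omega), hπu]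
    simp
  · intro X h1 h2
    rw [letterFun_eq_true, hπu]
    simp only [List.getElem?_append, List.getElem?_replicate, List.length_append,
      List.length_replicate, List.length_singleton]
    rw [if_pos (by omega), if_pos (by omega), if_neg (by omega), if_pos (by omega)]
  · rw [letterFun_eq_false (by omega), hσu]
    simp
  · intro X h1 h2
    rw [letterFun_eq_true, hσu]
    simp only [List.getElem?_append, List.getElem?_replicate, List.length_append,
      List.length_replicate, List.length_singleton]
    rw [if_pos (by omega), if_neg (by omega), if_pos (by omega)]
  · intro X hX
    have h1 : σ[X]? = π[X]? := by
      rw [hσu, hπu]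
      simp only [List.getElem?_append, List.getElem?_replicate, List.length_append,
        List.length_replicate, List.length_singleton]
      rcases hX with hX | hX
      · rw [if_pos (by omega), if_pos (by omega), if_pos hX, if_pos (by omega), if_pos (by omega),
          if_pos hX]
      · rw [if_neg (by omega), if_neg (by omega)]
        congr 1; omega
    simp only [letterFun, h1]
  · by_contra hcon
    obtain hM' : u.length + a = M := by omega
    rw [hM', hb.last] at hp
    cases hp

/-- The configurations for words `u 0 1^a v` and `u 1^a 0 v` are counted by sequences of states. -/
theorem OneRun.tfplNumber_eq {n M l a z : ℕ} {σ τ π : List (Fin 2)} (hM : M + 1 = 2 * n)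
    (hσ : σ ∈ dyckWords n) (hτ : τ ∈ dyckWords n) (hπ : π ∈ dyckWords n)
    (h : OneRun M l a z (letterFun σ) (letterFun π)) :
    tfplNumber n σ τ π = {g | (oneRunModel M l a z (letterFun π)).IsChain M g ∧
      ∀ Y ≤ M, letterFun τ Y = false ↔ Y + 1 < n ∨ Y + 1 + z = n + g (M + 1)}.ncard := by
  rw [ColumnModel.tfplNumber_eq _ hM hσ hτ hπ h.isValid
    (fun d e _ hmono X hX g hg hinv hf => h.continues hmono hX hg hinv hf)
    (fun g hg _ => h.noReturn hg) h.eq_of_columns]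
  congr 1
  ext g
  refine and_congr_right fun hg => forall₂_congr fun Y hY => ?_
  have hlt := h.lt
  have h1 := hg.step M le_rfl
  have h2 := hg.inv h.isValid (X := M) (by omega)
  simp only [oneRunModel, zerosBefore_last hM hπ] at h1 h2 ⊢
  rw [if_neg (by omega), if_neg (by omega)] at h1 h2
  rw [if_neg (by omega), show g (M + 1) = g M by omega]

theorem tfplNumber_oneRun (n : ℕ) (u v σ τ π : List (Fin 2)) (hσ : σ ∈ dyckWords n)
    (hτ : τ ∈ dyckWords n) (hπ : π ∈ dyckWords n) (a : ℕ)
    (hσu : σ = u ++ [0] ++ List.replicate a 1 ++ v)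
    (hπu : π = u ++ List.replicate a 1 ++ [0] ++ v) :
    (tfplNumber n σ τ π ≠ 0 → ∃ k ≤ a, τ =
      List.replicate (n - 1) 0 ++ List.replicate k 1 ++ [0] ++ List.replicate (n - k) 1) ∧
    (∀ k ≤ a, τ =
      List.replicate (n - 1) 0 ++ List.replicate k 1 ++ [0] ++ List.replicate (n - k) 1 →
      tfplNumber n σ τ π = (2 * n - u.count 1 - 2).choose (a - k)) := by
  obtain ⟨hl, h0, h1⟩ := dyckWords_count hσ
  have hn : 1 ≤ n := by rw [hσu] at h0; simp at h0; omega
  have han : a ≤ n := by rw [hσu] at h1; simp at h1; omega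
  obtain ⟨M, hM⟩ : ∃ M, M + 1 = 2 * n := ⟨2 * n - 1, by omega⟩
  have hrun := OneRun.of_words hM hσ hπ hσu hπu
  have hlt := hrun.lt
  have hlast : ∀ g, (oneRunModel M u.length a (u.count 0) (letterFun π)).IsChain M g →
      u.count 0 ≤ g (M + 1) ∧ g (M + 1) ≤ u.count 0 + a := by
    intro g hg
    have := hg.inv hrun.isValid le_rfl
    simp only [oneRunModel] at this
    rw [if_neg (by omega), if_neg (by omega)] at this
    omega
  rw [hrun.tfplNumber_eq hM hσ hτ hπ]
  constructor
  · intro hne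
    obtain ⟨g, hg, hgt⟩ := Set.nonempty_of_ncard_ne_zero hne
    obtain ⟨h2, h3⟩ := hlast g hg
    refine ⟨g (M + 1) - u.count 0, by omega, eq_of_letterFun ?_ fun i hi => ?_⟩
    · rw [(dyckWords_count hτ).1]
      simp; omega
    · rw [(dyckWords_count hτ).1] at hi
      rw [letterFun_oneRun_right (by omega) hi, hgt i (by omega)]
      omega
  · intro k hk hτk
    have hset : {g | (oneRunModel M u.length a (u.count 0) (letterFun π)).IsChain M g ∧
        ∀ Y ≤ M, letterFun τ Y = false ↔ Y + 1 < n ∨ Y + 1 + u.count 0 = n + g (M + 1)} =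
        {g | (oneRunModel M u.length a (u.count 0) (letterFun π)).IsChain M g ∧
          g (M + 1) = u.count 0 + k} := by
      ext g
      refine and_congr_right fun hg => ?_
      obtain ⟨h2, h3⟩ := hlast g hg
      constructor
      · intro h4
        have h5 := h4 (n - 1 + k) (by omega)
        rw [hτk, letterFun_oneRun_right (by omega) (by omega)] at h5
        omega
      · intro h4 Y hY
        rw [hτk, letterFun_oneRun_right (by omega) (by omega)]
        omega
    rw [hset, hrun.ncard_isChain, stepCount, if_pos hk]
    have := length_eq_count_add_count u
    congr 1
    omega

/-! ### The words `u 0^b 1 v` and `u 1 0^b v` -/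

/-- The words `s = u 0^b 1 v` and `p = u 1 0^b v`, where `u` has `l` letters, `z` of them `0`. -/
structure ZeroRun (M l b z : ℕ) (s p : ℕ → Bool) : Prop where
  zeros : zerosBefore p l = z
  p_one : p l = true
  p_zero : ∀ X, l < X → X ≤ l + b → p X = false
  s_zero : ∀ X, l ≤ X → X < l + b → s X = false
  s_one : s (l + b) = true
  s_eq : ∀ X, X < l ∨ l + b < X → s X = p X
  p_first : p 0 = false
  p_last : p M = true
  le_last : l + b ≤ M

/-- The column model for the words `u 0^b 1 v` and `u 1 0^b v`. In the columns from `l` to `l + b`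
a strand runs back to the left; the first component of the state is the row above the cell in which
it enters a column, and `0` outside these columns. The outgoing edges use the lowest cells of a
strip with the exception of one cell; the second component is the distance by which this cell lies
below the highest position. -/
def zeroRunModel (M l b z : ℕ) (p : ℕ → Bool) : ColumnModel (ℕ × ℕ) where
  start := (0, 0)
  step X x x' :=
    if X < l then x'.1 = 0 ∧ x'.2 = 0
    else if X < l + b then
      1 ≤ x'.1 ∧ (if X = l then x'.1 ≤ z + 1 ∧ x'.2 = 0
        else (x.1 = z + 1 ∧ x'.1 = z + 1 ∧ x'.2 = x.2 + 1) ∨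
          (x.1 = z + 1 ∧ x'.1 ≤ z ∧ x'.2 ≤ x.2 + 1) ∨ (x.1 ≤ z ∧ x'.1 < x.1 ∧ x'.2 ≤ x.2))
    else x'.1 = 0 ∧ (x'.2 = x.2 ∨ (X < M ∧ (x'.2 ≤ x.2 ∨ (x.1 = z + 1 ∧ x'.2 = x.2 + 1))))
  inv X x :=
    if X ≤ l then x.1 = 0 ∧ x.2 = 0
    else if X ≤ l + b then 1 ≤ x.1 ∧ x.1 ≤ z + 1 ∧ x.2 + l + 1 ≤ X ∧ (x.1 = z + 1 → x.2 + l + 1 = X)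
    else x.1 = 0 ∧ x.2 ≤ b
  usedOut X x y := y ≤ zerosBefore p X ∧ y + x.2 ≠ zerosBefore p X
  usedIn _ x y := y + 1 = x.1
  colOut X x x' y :=
    if p X ∨ x.1 = z + 1 then
      if y + x.2 < zerosBefore p X then ne
      else if y + x.2 = zerosBefore p X then nw
      else if y + x'.2 ≤ zerosBefore p (X + 1) then se
      else if y ≤ zerosBefore p (X + 1) then ne
      else if p X then nw else sw
    else
      if y + x.2 ≤ zerosBefore p X then ne
      else if y + x.2 = zerosBefore p X + 1 then sw
      else if y + x'.2 ≤ zerosBefore p (X + 1) then se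
      else if y ≤ zerosBefore p (X + 1) then ne
      else sw
  colIn X x x' y :=
    if l ≤ X ∧ X < l + b then
      if y < min x'.1 z then nw
      else if y = min x'.1 z then (if x'.1 = z + 1 then ne else se)
      else if X = l ∨ y < x.1 then sw else nw
    else if p X then sw
    else if y < x.1 then sw else nw

namespace ZeroRun

variable {M l b z : ℕ} {s t p : ℕ → Bool}

theorem zeros_succ (h : ZeroRun M l b z s p) : zerosBefore p (l + 1) = z := by
  rw [zerosBefore_succ_of_one h.p_one, h.zeros]

theorem zeros_mid (h : ZeroRun M l b z s p) {X : ℕ} (h1 : l < X) (h2 : X ≤ l + b + 1) :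
    zerosBefore p X + l + 1 = z + X := by
  obtain ⟨k, rfl⟩ : ∃ k, X = l + 1 + k := ⟨X - l - 1, by omega⟩
  induction k with
  | zero => rw [Nat.add_zero, h.zeros_succ]; omega
  | succ k ih =>
    rw [← Nat.add_assoc, zerosBefore_succ_of_zero (h.p_zero (l + 1 + k) (by omega) (by omega))]
    have := ih (by omega) (by omega)
    omega

theorem zeros_gt (h : ZeroRun M l b z s p) {X : ℕ} (hX : l + b < X) : z + b ≤ zerosBefore p X := by
  have h1 := h.zeros_mid (X := l + b + 1) (by omega) le_rfl
  have h2 := zerosBefore_mono p hX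
  simp only [Nat.succ_eq_add_one] at h2
  omega

theorem zeros_lt (h : ZeroRun M l b z s p) {X : ℕ} (hX : l < X) : zerosBefore p X < X :=
  zerosBefore_lt h.p_one hX

theorem le (h : ZeroRun M l b z s p) : z ≤ l := by
  rw [← h.zeros]; exact zerosBefore_le p l

theorem pos (h : ZeroRun M l b z s p) : 1 ≤ z := by
  have hl : l ≠ 0 := by
    rintro rfl
    have := h.p_one
    rw [h.p_first] at this
    cases this
  have h1 := zerosBefore_mono p (show 1 ≤ l by omega)
  rw [zerosBefore_succ_of_zero h.p_first, h.zeros] at h1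
  omega

theorem lt_last (h : ZeroRun M l b z s p) (hb : 1 ≤ b) : l + b < M := by
  refine lt_of_le_of_ne h.le_last fun h1 => ?_
  have h2 := h.p_zero (l + b) (by omega) le_rfl
  rw [h1, h.p_last] at h2
  cases h2

theorem inv_step (h : ZeroRun M l b z s p) : ∀ X ≤ M, ∀ x x', (zeroRunModel M l b z p).inv X x →
    (zeroRunModel M l b z p).step X x x' → (zeroRunModel M l b z p).inv (X + 1) x' := by
  rintro X hX ⟨f, e⟩ ⟨f', e'⟩ hx hs
  have hz := h.pos
  simp only [zeroRunModel] at hx hs ⊢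
  split_ifs at hx hs ⊢ <;> omega

/-- The possible transitions, together with the letter of `p` and the number of letters `0` before
the two strips. -/
theorem state_cases (h : ZeroRun M l b z s p) {X : ℕ} (hX : X ≤ M) {f e f' e' : ℕ}
    (hx : (zeroRunModel M l b z p).inv X (f, e))
    (hs : (zeroRunModel M l b z p).step X (f, e) (f', e')) :
    (X < l ∧ f = 0 ∧ e = 0 ∧ f' = 0 ∧ e' = 0) ∨
    (X = l ∧ X < l + b ∧ p X = true ∧ zerosBefore p X = z ∧ zerosBefore p (X + 1) = z ∧
      f = 0 ∧ e = 0 ∧ 1 ≤ f' ∧ f' ≤ z + 1 ∧ e' = 0) ∨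
    (l < X ∧ X < l + b ∧ p X = false ∧ zerosBefore p X + l + 1 = z + X ∧
      zerosBefore p (X + 1) + l = z + X ∧ e + l + 1 = X ∧ f = z + 1 ∧
      ((f' = z + 1 ∧ e' = e + 1) ∨ (1 ≤ f' ∧ f' ≤ z ∧ e' ≤ e + 1))) ∨
    (l < X ∧ X < l + b ∧ p X = false ∧ zerosBefore p X + l + 1 = z + X ∧
      zerosBefore p (X + 1) + l = z + X ∧ e + l + 1 ≤ X ∧ 1 ≤ f' ∧ f' < f ∧ f ≤ z ∧ e' ≤ e) ∨
    (X = l ∧ b = 0 ∧ p X = true ∧ zerosBefore p X = z ∧ zerosBefore p (X + 1) = z ∧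
      f = 0 ∧ e = 0 ∧ f' = 0 ∧ e' = 0) ∨
    (l < X ∧ X = l + b ∧ X < M ∧ p X = false ∧ zerosBefore p X + l + 1 = z + X ∧
      zerosBefore p (X + 1) + l = z + X ∧ e + l + 1 = X ∧ f = z + 1 ∧ f' = 0 ∧ e' ≤ e + 1) ∨
    (l < X ∧ X = l + b ∧ X < M ∧ p X = false ∧ zerosBefore p X + l + 1 = z + X ∧
      zerosBefore p (X + 1) + l = z + X ∧ e + l + 1 ≤ X ∧ 1 ≤ f ∧ f ≤ z ∧ f' = 0 ∧ e' ≤ e) ∨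
    (l + b < X ∧ z + b ≤ zerosBefore p X ∧ zerosBefore p X < X ∧ zerosBefore p (X + 1) ≤ X ∧
      e ≤ b ∧ f = 0 ∧ f' = 0 ∧ (e' = e ∨ (X < M ∧ e' < e))) := by
  have hz := h.pos
  simp only [zeroRunModel] at hx hs
  have hcases : X < l ∨ (X = l ∧ X < l + b) ∨ (l < X ∧ X < l + b) ∨ (X = l ∧ b = 0) ∨
    (l < X ∧ X = l + b) ∨ l + b < X := by omega
  rcases hcases with hc | hc | hc | hc | hc | hc
  · left
    rw [if_pos (by omega)] at hx hs
    omega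
  · right; left
    obtain ⟨rfl, hc⟩ := hc
    rw [if_pos le_rfl] at hx
    rw [if_neg (by omega), if_pos (by omega), if_pos rfl] at hs
    exact ⟨rfl, hc, h.p_one, h.zeros, h.zeros_succ, by omega⟩
  · rw [if_neg (by omega), if_pos (by omega)] at hx
    rw [if_neg (by omega), if_pos (by omega), if_neg (by omega)] at hs
    have h1 := h.p_zero X (by omega) (by omega)
    have h2 := h.zeros_mid (X := X) (by omega) (by omega)
    have h3 := h.zeros_mid (X := X + 1) (by omega) (by omega)
    by_cases hf : f = z + 1
    · right; right; left
      exact ⟨hc.1, hc.2, h1, h2, by omega⟩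
    · right; right; right; left
      exact ⟨hc.1, hc.2, h1, h2, by omega⟩
  · obtain ⟨rfl, rfl⟩ := hc
    rw [if_pos le_rfl] at hx
    rw [if_neg (by omega), if_neg (by omega)] at hs
    right; right; right; right; left
    exact ⟨rfl, rfl, h.p_one, h.zeros, h.zeros_succ, by omega⟩
  · rw [if_neg (by omega), if_pos (by omega)] at hx
    rw [if_neg (by omega), if_neg (by omega)] at hs
    have h1 := h.p_zero X (by omega) (by omega)
    have h2 := h.zeros_mid (X := X) (by omega) (by omega)
    have h3 := h.zeros_mid (X := X + 1) (by omega) (by omega)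
    have h4 := h.lt_last (by omega)
    by_cases hf : f = z + 1
    · right; right; right; right; right; left
      exact ⟨hc.1, hc.2, by omega, h1, h2, by omega⟩
    · right; right; right; right; right; right; left
      exact ⟨hc.1, hc.2, by omega, h1, h2, by omega⟩
  · rw [if_neg (by omega), if_neg (by omega)] at hx hs
    have h2 := h.zeros_gt hc
    have h3 := h.zeros_lt (X := X) (by omega)
    have h4 := h.zeros_lt (X := X + 1) (by omega)
    right; right; right; right; right; right; right
    omega

set_option maxHeartbeats 800000 in
theorem out_column (h : ZeroRun M l b z s p) : ∀ X ≤ M, ∀ x x', (zeroRunModel M l b z p).inv X x →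
    (zeroRunModel M l b z p).step X x x' → IsColumn M X ((zeroRunModel M l b z p).usedOut X x)
      ((zeroRunModel M l b z p).usedOut (X + 1) x') ((zeroRunModel M l b z p).colOut X x x') := by
  rintro X hX ⟨f, e⟩ ⟨f', e'⟩ hx hs
  have hZ := zerosBefore_le p X
  have hZ1 := zerosBefore_succ_cases p X
  have hcases := h.state_cases hX hx hs
  have hz := h.pos
  have hle := h.le
  simp only [zeroRunModel]
  clear hx hs
  generalize zerosBefore p X = Z at *
  generalize zerosBefore p (X + 1) = Z' at *
  rcases hZ1 with ⟨hp, rfl⟩ | ⟨hp, rfl⟩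
  · simp only [hp, true_or, if_true, Bool.true_eq_false, false_and, and_false, false_or] at hcases ⊢
    have h1 : (e = 0 ∧ e' = 0) ∨ (Z' < X ∧ e ≤ Z' ∧ e' ≤ e) := by omega
    clear hcases
    constructor <;> intros <;> split_ifs <;> simp <;> omega
  · by_cases hf : f = z + 1
    · have h1 : Z < X ∧ e ≤ Z ∧ e' ≤ e + 1 := by omega
      clear hcases
      simp only [hp, hf, or_true, if_true, Bool.false_eq_true, if_false]
      constructor <;> intros <;> split_ifs <;> simp <;> omega
    · have h1 : (e = 0 ∧ e' = 0) ∨ (Z < X ∧ e ≤ Z ∧ e' ≤ e) := by omega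
      clear hcases
      simp only [hp, hf, or_self, Bool.false_eq_true, if_false]
      constructor <;> intros <;> split_ifs <;> simp <;> omega

theorem in_column (h : ZeroRun M l b z s p) : ∀ X ≤ M, ∀ x x', (zeroRunModel M l b z p).inv X x →
    (zeroRunModel M l b z p).step X x x' → IsColumn M X ((zeroRunModel M l b z p).usedIn X x)
      ((zeroRunModel M l b z p).usedIn (X + 1) x') ((zeroRunModel M l b z p).colIn X x x') := by
  rintro X hX ⟨f, e⟩ ⟨f', e'⟩ hx hs
  have hcases := h.state_cases hX hx hs
  have hz := h.pos
  have hle := h.le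
  simp only [zeroRunModel]
  clear hx hs
  by_cases hc : l ≤ X ∧ X < l + b
  · have h1 : (X = l ∧ f = 0 ∧ 1 ≤ f' ∧ f' ≤ z + 1) ∨ (X ≠ l ∧ f = z + 1 ∧ 1 ≤ f' ∧ f' ≤ z + 1) ∨
      (X ≠ l ∧ 1 ≤ f' ∧ f' < f ∧ f ≤ z) := by omega
    clear hcases
    simp only [hc, and_self, if_true]
    constructor <;> intros <;> split_ifs <;> simp <;> omega
  · have h1 : f ≤ X ∧ f' = 0 ∧ (p X = true → f = 0) := by
      cases hp : p X <;>
        simp only [hp, Bool.true_eq_false, Bool.false_eq_true, false_and, and_false,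
          false_or] at hcases <;> refine ⟨?_, ?_, ?_⟩ <;> first | omega | simp
    clear hcases
    simp only [hc, if_false]
    cases hp : p X
    · simp only [Bool.false_eq_true, if_false]
      constructor <;> intros <;> split_ifs <;> simp <;> omega
    · simp only [h1.2.2 hp, if_true]
      constructor <;> intros <;> simp
      omega

theorem disjoint (h : ZeroRun M l b z s p) : ∀ X ≤ M, ∀ x x', (zeroRunModel M l b z p).inv X x →
    (zeroRunModel M l b z p).step X x x' → ∀ y ≤ X,
      (zeroRunModel M l b z p).colOut X x x' y ≠ (zeroRunModel M l b z p).colIn X x x' y := by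
  rintro X hX ⟨f, e⟩ ⟨f', e'⟩ hx hs y hy
  have hcases := h.state_cases hX hx hs
  have hz := h.pos
  simp only [zeroRunModel]
  clear hx hs
  by_cases hc : l ≤ X ∧ X < l + b
  · rw [if_pos hc]
    rcases hc.1.eq_or_lt with rfl | hc'
    · simp only [h.p_one, true_or, if_true]
      rw [h.zeros, h.zeros_succ]
      split_ifs <;> simp <;> omega
    · have hp := h.p_zero X hc' hc.2.le
      by_cases hf : f = z + 1
      · simp only [hp, hf, or_true, if_true, Bool.false_eq_true, if_false]
        split_ifs <;> simp <;> omega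
      · simp only [hp, hf, or_self, Bool.false_eq_true, if_false]
        split_ifs <;> simp <;> omega
  · rw [if_neg hc]
    cases hp : p X
    · by_cases hf : f = z + 1
      · simp only [hf, or_true, if_true, Bool.false_eq_true, if_false]
        split_ifs <;> simp <;> omega
      · simp only [hf, or_self, Bool.false_eq_true, if_false]
        split_ifs <;> simp <;> omega
    · simp only [true_or, if_true]
      split_ifs <;> simp

theorem diag (h : ZeroRun M l b z s p) : ∀ X ≤ M, ∀ x x', (zeroRunModel M l b z p).inv X x →
    (zeroRunModel M l b z p).step X x x' →
    ((zeroRunModel M l b z p).colOut X x x' X = nw ↔ p X = true) ∧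
      ((zeroRunModel M l b z p).colIn X x x' X = nw ↔ p X = false) := by
  rintro X hX ⟨f, e⟩ ⟨f', e'⟩ hx hs
  have hcases := h.state_cases hX hx hs
  have hZ := zerosBefore_le p X
  have hZ1 := zerosBefore_succ_cases p X
  have hz := h.pos
  have hle := h.le
  simp only [zeroRunModel]
  clear hx hs
  constructor
  · rcases hZ1 with ⟨hp, hZ1⟩ | ⟨hp, hZ1⟩
    · simp only [hp, true_or, if_true, iff_true]
      split_ifs <;> (try simp) <;> omega
    · by_cases hf : f = z + 1
      · simp only [hp, hf, or_true, if_true, Bool.false_eq_true, if_false, iff_false]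
        split_ifs <;> simp
        omega
      · simp only [hp, hf, or_self, Bool.false_eq_true, if_false, iff_false]
        split_ifs <;> simp
  · cases hp : p X
    · simp only [Bool.false_eq_true, if_false, iff_true]
      have : X ≠ l := by rintro rfl; rw [h.p_one] at hp; cases hp
      split_ifs <;> (try simp) <;> omega
    · simp only [if_true, Bool.true_eq_false, iff_false]
      have : l ≤ X ∧ X < l + b → X = l := fun h' => by
        by_contra hcon
        rw [h.p_zero X (by omega) (by omega)] at hp
        cases hp
      split_ifs <;> simp <;> omega

theorem row (h : ZeroRun M l b z s p) : ∀ X ≤ M, ∀ x x', (zeroRunModel M l b z p).inv X x →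
    (zeroRunModel M l b z p).step X x x' → ((zeroRunModel M l b z p).colOut X x x' 0 ≠ sw ∧
      (zeroRunModel M l b z p).colOut X x x' 0 ≠ se ∧
      (s X = true → (zeroRunModel M l b z p).colOut X x x' 0 = ne)) ∧
      (zeroRunModel M l b z p).colIn X x x' 0 ≠ se ∧
      ((zeroRunModel M l b z p).colIn X x x' 0 = sw ↔ s X = true) := by
  rintro X hX ⟨f, e⟩ ⟨f', e'⟩ hx hs
  have hcases := h.state_cases hX hx hs
  have hz := h.pos
  have h0 : zerosBefore p X = 0 → X = 0 := fun h1 => by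
    by_contra hcon
    have h2 := zerosBefore_mono p (show 1 ≤ X by omega)
    rw [zerosBefore_succ_of_zero h.p_first] at h2
    omega
  have h00 : X = 0 → p X = false := by rintro rfl; exact h.p_first
  simp only [zeroRunModel]
  clear hx hs
  have hreg : X < l ∨ (l ≤ X ∧ X < l + b) ∨ X = l + b ∨ l + b < X := by omega
  have hout : (p X = true ∨ f = z + 1) ∧ 0 + e < zerosBefore p X ∨
      ¬ (p X = true ∨ f = z + 1) ∧ 0 + e ≤ zerosBefore p X := by
    by_cases h1 : p X = true ∨ f = z + 1
    · refine Or.inl ⟨h1, ?_⟩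
      by_contra hcon
      have h2 : X = 0 := h0 (by omega)
      rw [h00 h2] at h1
      simp at h1
      omega
    · refine Or.inr ⟨h1, ?_⟩
      omega
  have hcol : (if p X = true ∨ f = z + 1 then
        if 0 + e < zerosBefore p X then ne
        else if 0 + e = zerosBefore p X then nw
        else if 0 + e' ≤ zerosBefore p (X + 1) then se
        else if 0 ≤ zerosBefore p (X + 1) then ne
        else if p X = true then nw else sw
      else
        if 0 + e ≤ zerosBefore p X then ne
        else if 0 + e = zerosBefore p X + 1 then sw
        else if 0 + e' ≤ zerosBefore p (X + 1) then se
        else if 0 ≤ zerosBefore p (X + 1) then ne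
        else sw) = ne := by
    rcases hout with ⟨h1, h2⟩ | ⟨h1, h2⟩
    · rw [if_pos h1, if_pos h2]
    · rw [if_neg h1, if_pos h2]
  rw [hcol]
  refine ⟨by simp, ?_⟩
  rcases hreg with hc | hc | hc | hc
  · rw [if_neg (by omega), h.s_eq X (Or.inl hc)]
    rw [if_neg (show ¬ 0 < f by omega)]
    cases hp : p X <;> simp
  · rw [if_pos hc, h.s_zero X hc.1 hc.2]
    split_ifs <;> simp <;> omega
  · rw [if_neg (by omega), hc, h.s_one]
    rcases Nat.eq_zero_or_pos b with rfl | hb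
    · rw [Nat.add_zero, h.p_one]
      simp
    · rw [h.p_zero _ (by omega) le_rfl]
      simp only [Bool.false_eq_true, if_false]
      split_ifs <;> simp
      omega
  · rw [if_neg (by omega), h.s_eq X (Or.inr hc)]
    rw [if_neg (show ¬ 0 < f by omega)]
    cases hp : p X <;> simp

theorem last (h : ZeroRun M l b z s p) : ∀ x x', (zeroRunModel M l b z p).inv M x →
    (zeroRunModel M l b z p).step M x x' → ∀ y ≤ M,
      ((zeroRunModel M l b z p).colOut M x x' y ≠ se ∧
      ((zeroRunModel M l b z p).colOut M x x' y = ne ↔ (zeroRunModel M l b z p).usedOut M x y)) ∧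
      (zeroRunModel M l b z p).colIn M x x' y = sw := by
  rintro ⟨f, e⟩ ⟨f', e'⟩ hx hs y hy
  have hcases := h.state_cases le_rfl hx hs
  have hlast := h.le_last
  have hlt := h.lt_last
  simp only [zeroRunModel]
  clear hx hs
  rw [if_neg (show ¬ (l ≤ M ∧ M < l + b) by omega)]
  simp only [h.p_last, true_or, if_true, zerosBefore_succ_of_one h.p_last, and_true]
  split_ifs <;> simp <;> omega

/-- The model is consistent. -/
theorem isValid (h : ZeroRun M l b z s p) : (zeroRunModel M l b z p).IsValid M s p :=
  ⟨by simp [zeroRunModel], h.inv_step, h.out_column, h.in_column, h.disjoint, h.diag, h.row, h.last⟩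

end ZeroRun

/-! ### Tangles for the words `u 0^b 1 v` and `u 1 0^b v` follow the model -/

section Column

variable {c : ℕ → Dir} {X Z e : ℕ}

/-- A column at a letter `1` whose left cells are used from the hole at distance `e` below the
highest possible position, and above all occupied cells. -/
theorem column_of_one (hle : e ≤ Z) (hZ : Z < X ∨ (e = 0 ∧ Z ≤ X))
    (hleft : ∀ y < X, (c y = nw ∨ c (y + 1) = sw) ↔ ¬ (y ≤ Z ∧ y + e ≠ Z))
    (hright : ∀ y < X, ¬ (c y = ne ∧ c (y + 1) = se)) (h0 : c 0 ≠ sw ∧ c 0 ≠ se)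
    (hX : c X = nw) (hsw : ∀ y ≤ X, c y ≠ sw) :
    ∃ e' ≤ e, ((∀ y ≤ X, c y ≠ se) → e' = e) ∧ ∀ y ≤ X, c y =
      if y + e < Z then ne else if y + e = Z then nw else if y + e' ≤ Z then se
      else if y ≤ Z then ne else nw := by
  obtain ⟨Q, rfl⟩ : ∃ Q, Z = Q + e := ⟨Z - e, by omega⟩
  obtain ⟨h1, h2, h3⟩ := column_bottom (c := c) (Q := Q)
    (fun y hy h' => (hleft y (by omega)).1 h' (by omega)) (fun y hy => hright y (by omega)) h0
  have hnw : ∀ y ≤ X, (y < X → ¬ (y ≤ Q + e ∧ y + e ≠ Q + e)) → c y = nw := by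
    intro y hy hy'
    rcases hy.lt_or_eq with h | rfl
    · exact ((hleft y h).2 (hy' h)).resolve_right (hsw (y + 1) h)
    · exact hX
  obtain ⟨r, hr1, hr2, hr3, hr4⟩ := column_run (c := c) (A := Q + 1) (B := Q + e + 1) (by omega)
    (fun y hy hy' => by
      have h4 : c y ≠ nw := fun h' => (hleft y (by omega)).1 (Or.inl h') (by omega)
      have h5 := hsw y (by omega)
      rcases hc : c y with _ | _ | _ | _ <;> simp_all)
    (fun y _ hy => hright y (by omega))
  refine ⟨Q + e + 1 - r, by omega, fun hse => ?_, fun y hy => ?_⟩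
  · by_contra hcon
    exact hse (Q + 1) (by omega) (hr3 (Q + 1) le_rfl (by omega))
  · split_ifs with h4 h5 h6 h7
    · exact h1 y (by omega)
    · exact hnw y hy (by omega)
    · exact hr3 y (by omega) (by omega)
    · exact hr4 y (by omega) (by omega)
    · exact hnw y hy (by omega)

/-- A column at a letter `0` without direction `nw` from the hole on. -/
theorem column_of_zero (hle : e ≤ Z) (hZ : Z < X ∨ (e = 0 ∧ Z ≤ X))
    (hleft : ∀ y < X, (c y = nw ∨ c (y + 1) = sw) ↔ ¬ (y ≤ Z ∧ y + e ≠ Z))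
    (hright : ∀ y < X, ¬ (c y = ne ∧ c (y + 1) = se)) (h0 : c 0 ≠ sw ∧ c 0 ≠ se)
    (hnw : ∀ y ≤ X, Z ≤ y + e → c y ≠ nw) :
    ∃ e' ≤ e, ∀ y ≤ X, c y =
      if y + e ≤ Z then ne else if y + e = Z + 1 then sw else if y + e' ≤ Z + 1 then se
      else if y ≤ Z + 1 then ne else sw := by
  obtain ⟨Q, rfl⟩ : ∃ Q, Z = Q + e := ⟨Z - e, by omega⟩
  obtain ⟨h1, h2, h3⟩ := column_bottom (c := c) (Q := Q)
    (fun y hy h' => (hleft y (by omega)).1 h' (by omega)) (fun y hy => hright y (by omega)) h0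
  have hQ := Dir.eq_ne h2 (hnw Q (by omega) (by omega)) h3
  have hsw : ∀ y ≤ X, (y = Q + 1 ∨ Q + e + 1 < y) → c y = sw := by
    intro y hy hy'
    obtain ⟨q, rfl⟩ : ∃ q, y = q + 1 := ⟨y - 1, by omega⟩
    exact ((hleft q hy).2 (by omega)).resolve_left (hnw q (by omega) (by omega))
  obtain ⟨r, hr1, hr2, hr3, hr4⟩ := column_run (c := c) (A := Q + 2) (B := Q + e + 2) (by omega)
    (fun y hy hy' => by
      obtain ⟨q, rfl⟩ : ∃ q, y = q + 1 := ⟨y - 1, by omega⟩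
      have h4 : c (q + 1) ≠ sw := fun h' => (hleft q (by omega)).1 (Or.inr h') (by omega)
      have h5 := hnw (q + 1) (by omega) (by omega)
      rcases hc : c (q + 1) with _ | _ | _ | _ <;> simp_all)
    (fun y _ hy => hright y (by omega))
  refine ⟨Q + e + 2 - r, by omega, fun y hy => ?_⟩
  split_ifs with h4 h5 h6 h7
  · rcases Nat.lt_or_ge y Q with h | h
    · exact h1 y h
    · obtain rfl : y = Q := by omega
      exact hQ
  · exact hsw y hy (by omega)
  · exact hr3 y (by omega) (by omega)
  · exact hr4 y (by omega) (by omega)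
  · exact hsw y hy (by omega)

/-- A column at a letter `0` with direction `nw` at the hole, but not above it. -/
theorem column_of_zero_nw (hle : e ≤ Z) (hZ : Z < X)
    (hleft : ∀ y < X, (c y = nw ∨ c (y + 1) = sw) ↔ ¬ (y ≤ Z ∧ y + e ≠ Z))
    (hex : ∀ y < X, ¬ (c y = nw ∧ c (y + 1) = sw))
    (hright : ∀ y < X, ¬ (c y = ne ∧ c (y + 1) = se)) (h0 : c 0 ≠ sw ∧ c 0 ≠ se)
    (hhole : ∀ y, y + e = Z → c y = nw) (hnw : ∀ y ≤ X, Z < y + e → c y ≠ nw) :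
    ∃ e' ≤ e + 1, ∀ y ≤ X, c y =
      if y + e < Z then ne else if y + e = Z then nw else if y + e' ≤ Z + 1 then se
      else if y ≤ Z + 1 then ne else sw := by
  obtain ⟨Q, rfl⟩ : ∃ Q, Z = Q + e := ⟨Z - e, by omega⟩
  obtain ⟨h1, h2, h3⟩ := column_bottom (c := c) (Q := Q)
    (fun y hy h' => (hleft y (by omega)).1 h' (by omega)) (fun y hy => hright y (by omega)) h0
  have hQ := hhole Q rfl
  obtain ⟨r, hr1, hr2, hr3, hr4⟩ := column_run (c := c) (A := Q + 1) (B := Q + e + 2) (by omega)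
    (fun y hy hy' => by
      obtain ⟨q, rfl⟩ : ∃ q, y = q + 1 := ⟨y - 1, by omega⟩
      have h4 : c (q + 1) ≠ sw := fun h' => by
        rcases Nat.lt_or_ge Q q with h | h
        · exact (hleft q (by omega)).1 (Or.inr h') (by omega)
        · obtain rfl : q = Q := by omega
          exact hex q (by omega) ⟨hQ, h'⟩
      have h5 := hnw (q + 1) (by omega) (by omega)
      rcases hc : c (q + 1) with _ | _ | _ | _ <;> simp_all)
    (fun y _ hy => hright y (by omega))
  refine ⟨Q + e + 2 - r, by omega, fun y hy => ?_⟩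
  split_ifs with h4 h5 h6 h7
  · exact h1 y (by omega)
  · exact hhole y h5
  · exact hr3 y (by omega) (by omega)
  · exact hr4 y (by omega) (by omega)
  · obtain ⟨q, rfl⟩ : ∃ q, y = q + 1 := ⟨y - 1, by omega⟩
    exact ((hleft q hy).2 (by omega)).resolve_left (hnw q (by omega) (by omega))

end Column

namespace ZeroRun

variable {M l b z : ℕ} {s t p : ℕ → Bool} {d e : ℕ → ℕ → Dir}

/-- The columns passed by the strand that runs back in row `z`. -/
theorem run_states (h : ZeroRun M l b z s p) {g : ℕ → ℕ × ℕ} {X : ℕ}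
    (hg : (zeroRunModel M l b z p).Follows X g d e) (hX : X ≤ l + b)
    (hf : (g X).1 = z + 1) {j : ℕ} (hj : l < j) (hjX : j ≤ X) : g j = (z + 1, j - l - 1) := by
  have hM := h.le_last
  obtain ⟨k, hk⟩ : ∃ k, X = j + k := ⟨X - j, by omega⟩
  have hinv : ∀ j, l < j → j ≤ X → (g j).1 = z + 1 → g j = (z + 1, j - l - 1) := by
    intro j hj hjX hfj
    have := hg.inv h.isValid (by omega) hjX
    simp only [zeroRunModel] at this
    rw [if_neg (by omega), if_pos (by omega)] at this
    exact Prod.ext hfj (by simp only; omega)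
  induction k generalizing j with
  | zero => exact hinv j hj hjX (by rw [show j = X by omega]; exact hf)
  | succ k ih =>
    have h1 := ih (j := j + 1) (by omega) (by omega) (by omega)
    have h2 := hg.step j (by omega)
    simp only [zeroRunModel, h1] at h2
    rw [if_neg (by omega), if_pos (by omega), if_neg (by omega)] at h2
    exact hinv j hj hjX (by omega)

/-- The strand along row `z + 1` to column `X`, starting at the external edge `l + 1`, must not be
continued by the strand that runs back in row `z` from some column `Q`. -/
theorem not_return (h : ZeroRun M l b z s p) {g : ℕ → ℕ × ℕ} {X : ℕ}
    (hmono : NoReturn M p d e) (hg : (zeroRunModel M l b z p).Follows X g d e) (hlX : l < X)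
    (hX : X ≤ l + b) (hf : (g X).1 = z + 1) (hin : ∀ y, z < y → y ≤ X → e X y = nw)
    (hout : ∀ y, z + 1 < y → y ≤ X → X = l + 1 → d X y = sw) :
    ¬ TangleStep M d e (X, z + 1) (X - 1, z) ∧
      (d X z = nw → ¬ TangleStep M d e (X, z + 1) (X, z)) := by
  have hM := h.lt_last (by omega)
  have hz := h.pos
  have hzl := h.le
  have hst : ∀ j, l < j → j ≤ X → g j = (z + 1, j - l - 1) := fun j => h.run_states hg hX hf
  -- the directions in the columns before `X`
  have hcolIn : ∀ j, l ≤ j → j < X → ∀ y ≤ j, e j y =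
      if y < z then nw else if y = z then ne else if j = l then sw else nw := by
    intro j hj hjX y hy
    rw [hg.inn j hjX y hy, hst (j + 1) (by omega) (by omega)]
    simp only [zeroRunModel]
    rw [if_pos (by omega), show min (z + 1) z = z by omega, if_pos trivial]
    split_ifs with h1 h2 h3 h4 h4
    · rfl
    · rfl
    · rfl
    · rw [hst j (by omega) hjX.le] at h3
      simp only at h3
      omega
    · omega
    · rfl
  have hcolOut : ∀ j, l < j → j < X → ∀ y ≤ j, d j y =
      if y < z then ne else if y = z then nw else if y + l ≤ z + j then ne else sw := by
    intro j hj hjX y hy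
    rw [hg.out j hjX y hy, hst (j + 1) (by omega) (by omega), hst j hj hjX.le]
    have h1 := h.zeros_mid (X := j) (by omega) (by omega)
    have h2 := h.zeros_mid (X := j + 1) (by omega) (by omega)
    simp only [zeroRunModel, h.p_zero j (by omega) (by omega), Bool.false_eq_true, if_false,
      or_true, if_true]
    split_ifs <;> first | rfl | omega
  have hcolOut' : ∀ y, z ≤ y → y ≤ l → d l y = nw := by
    intro y hy hy'
    rw [hg.out l hlX y hy', hst (l + 1) (by omega) (by omega)]
    have h3 := hg.inv h.isValid (by omega) hlX.le
    simp only [zeroRunModel, le_refl, if_true] at h3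
    simp only [zeroRunModel, h.p_one, true_or, if_true, h.zeros, h.zeros_succ, h3.2]
    split_ifs <;> first | rfl | omega
  have hforward : ∀ j, l < j → j ≤ X →
      ReflTransGen (TangleStep M d e) (l + 1, l + 1) (j, z + 1) := by
    intro j hj hjX
    obtain ⟨k, rfl⟩ : ∃ k, j = l + 1 + k := ⟨j - (l + 1), by omega⟩
    induction k with
    | zero =>
      rcases hjX.lt_or_eq with hjX | hjX
      · refine reflTransGen_descend (by omega) le_rfl (by omega) (fun y hy hy' => ?_)
          (fun y hy hy' => ?_)
        · rw [hcolOut (l + 1) (by omega) hjX y hy', if_neg (by omega), if_neg (by omega),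
            if_neg (by omega)]
        · rw [hcolIn (l + 1) (by omega) hjX y (by omega), if_neg (by omega), if_neg (by omega),
            if_neg (by omega)]
      · refine reflTransGen_descend (by omega) le_rfl (by omega) (fun y hy hy' => ?_)
          (fun y hy hy' => ?_)
        · rw [show l + 1 = X by omega]
          exact hout y hy (by omega) (by omega)
        · rw [show l + 1 = X by omega]
          exact hin y (by omega) (by omega)
    | succ k ih =>
      refine .tail (ih (by omega) (by omega)) ?_
      have h1 : d (l + 1 + k) (z + 1) = ne := by
        rw [hcolOut _ (by omega) (by omega) _ (by omega), if_neg (by omega), if_neg (by omega),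
          if_pos (by omega)]
      have h2 : e (l + 1 + (k + 1)) (z + 1) = nw := by
        rcases hjX.lt_or_eq with hjX | hjX
        · rw [hcolIn _ (by omega) hjX _ (by omega), if_neg (by omega), if_neg (by omega),
            if_neg (by omega)]
        · rw [hjX]
          exact hin _ (by omega) (by omega)
      refine ⟨?_, ?_, ?_⟩
      · simp only [h1]; exact isReal_ne (by omega) (by omega)
      · simp only [h2]; exact isReal_nw (by omega) (by omega)
      · simp only [h1, h2]
        rw [latticePoint_add_ne, ← Nat.add_assoc, latticePoint_add_nw]
  have hback : ∀ k, l + k < X → ReflTransGen (TangleStep M d e) (l + k, z) (l, l) := by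
    intro k hk
    induction k with
    | zero =>
      refine reflTransGen_ascend hzl le_rfl (by omega) (fun y hy hy' => hcolOut' y hy hy'.le)
        (fun y hy hy' => ?_)
      rw [Nat.add_zero, hcolIn l le_rfl hlX y hy', if_neg (by omega), if_neg (by omega), if_pos rfl]
    | succ k ih =>
      refine .head ?_ (ih (by omega))
      have h1 : d (l + (k + 1)) z = nw := by
        rw [hcolOut _ (by omega) (by omega) _ (by omega), if_neg (by omega), if_pos rfl]
      have h2 : e (l + k) z = ne := by
        rw [hcolIn _ (by omega) (by omega) _ (by omega), if_neg (by omega), if_pos rfl]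
      refine ⟨?_, ?_, ?_⟩
      · simp only [h1]; exact isReal_nw (by omega) (by omega)
      · simp only [h2]; exact isReal_ne (by omega) (by omega)
      · simp only [h1, h2]
        rw [latticePoint_add_ne, ← Nat.add_assoc, latticePoint_add_nw]
  have hX' : X - 1 = l + (X - 1 - l) := by omega
  have hend : ReflTransGen (TangleStep M d e) (X - 1, z) (l, l) := by
    rw [hX']
    exact hback _ (by omega)
  have hno : ¬ ReflTransGen (TangleStep M d e) (X, z + 1) (l, l) := fun h1 => by
    have := hmono (l + 1) l (by omega) (by omega) (h.p_zero _ (by omega) (by omega)) h.p_one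
      ((hforward X hlX le_rfl).trans h1)
    omega
  refine ⟨fun h1 => hno (.head h1 hend), fun hd h1 => hno (.head h1 (.head ?_ hend))⟩
  have h2 : e (X - 1) z = ne := by
    rw [hcolIn _ (by omega) (by omega) _ (by omega), if_neg (by omega), if_pos rfl]
  refine ⟨?_, ?_, ?_⟩
  · simp only [hd]; exact isReal_nw (by omega) (by omega)
  · simp only [h2]; exact isReal_ne (by omega) (by omega)
  · simp only [hd, h2]
    rw [latticePoint_add_ne, Nat.sub_add_cancel (by omega), latticePoint_add_nw]

/-- Outside the run the incoming edges are forced, and the outgoing edges are described by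
`column_of_one` and `column_of_zero`. -/
theorem continues_std (h : ZeroRun M l b z s p) {X : ℕ} (hX : X ≤ M) {g : ℕ → ℕ × ℕ}
    (hinv : (zeroRunModel M l b z p).inv X (g X))
    (hf : (zeroRunModel M l b z p).Fits M s p X (g X) (d X) (e X))
    (hc : X < l ∨ (X = l ∧ b = 0) ∨ l + b < X) :
    (zeroRunModel M l b z p).Continues X (g X) (d X) (e X) := by
  obtain ⟨hol, hil, hoe, hie, hore, hire, hdis, hod, hid, hor, hir, hlast⟩ := hf
  have hz := h.pos
  have hs : s X = p X := by
    by_cases hXl : X = l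
    · obtain rfl : b = 0 := by omega
      rw [hXl, h.p_one, ← h.s_one, Nat.add_zero]
    · exact h.s_eq X (by omega)
  have hZX := zerosBefore_le p X
  have hgX : (g X).1 = 0 ∧ (g X).2 ≤ zerosBefore p X ∧
      (zerosBefore p X < X ∨ ((g X).2 = 0 ∧ zerosBefore p X ≤ X)) := by
    rcases Nat.lt_or_ge l X with h1 | h1
    · have h2 := h.zeros_gt (X := X) (by omega)
      have h3 := h.zeros_lt h1
      simp only [zeroRunModel] at hinv
      rw [if_neg (by omega), if_neg (by omega)] at hinv
      omega
    · simp only [zeroRunModel, if_pos h1] at hinv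
      omega
  have hstep : ∀ e', (e' = (g X).2 ∨ (X < M ∧ e' ≤ (g X).2)) →
      (zeroRunModel M l b z p).step X (g X) (0, e') := by
    intro e' he'
    simp only [zeroRunModel, true_and] at hinv ⊢
    split_ifs at hinv ⊢ <;> omega
  simp only [zeroRunModel, hgX.1] at hol hil
  have hil : ∀ y < X, e X y = nw ∨ e X (y + 1) = sw := fun y hy => (hil y hy).2 (by omega)
  cases hp : p X
  · have he := column_all_nw hil (hid.2 hp)
    obtain ⟨e', he', hcol⟩ := column_of_zero hgX.2.1 hgX.2.2 hol hore hor
      (fun y hy _ => by rw [← he y hy]; exact hdis y hy)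
    have hXM : X ≠ M := by
      rintro rfl
      rw [h.p_last] at hp
      cases hp
    refine ⟨(0, e'), hstep e' (by omega), fun y hy => ⟨?_, ?_⟩⟩
    · rw [hcol y hy]
      simp only [zeroRunModel, hp, zerosBefore_succ_of_zero hp, Bool.false_eq_true, false_or]
      rw [if_neg (show ¬ (g X).1 = z + 1 by omega)]
    · simp only [zeroRunModel, hp]
      rw [if_neg (by omega), if_neg (by simp), if_neg (by omega)]
      exact he y hy
  · have he := column_all_sw hil (hir.2.2 (hs.trans hp))
    obtain ⟨e', he', hse, hcol⟩ := column_of_one hgX.2.1 hgX.2.2 hol hore hor (hod.2 hp)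
      (fun y hy => by rw [← he y hy]; exact hdis y hy)
    refine ⟨(0, e'), hstep e' ?_, fun y hy => ⟨?_, ?_⟩⟩
    · rcases hX.lt_or_eq with hX | rfl
      · exact Or.inr ⟨hX, he'⟩
      · exact Or.inl (hse (hlast rfl))
    · rw [hcol y hy]
      simp only [zeroRunModel, hp, zerosBefore_succ_of_one hp, true_or, if_true]
    · simp only [zeroRunModel, hp]
      rw [if_neg (by omega), if_pos trivial]
      exact he y hy

theorem continues_first (h : ZeroRun M l b z s p) {g : ℕ → ℕ × ℕ}
    (hinv : (zeroRunModel M l b z p).inv l (g l))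
    (hf : (zeroRunModel M l b z p).Fits M s p l (g l) (d l) (e l)) (hb : 1 ≤ b) :
    (zeroRunModel M l b z p).Continues l (g l) (d l) (e l) := by
  obtain ⟨hol, hil, hoe, hie, hore, hire, hdis, hod, hid, hor, hir, hlast⟩ := hf
  have hz := h.pos
  have hzl := h.le
  have hp := h.p_one
  simp only [zeroRunModel, le_refl, if_true] at hinv
  simp only [zeroRunModel, hinv.1, hinv.2, h.zeros] at hol hil
  obtain ⟨hb1, hb2, hb3⟩ := column_bottom (c := d l) (Q := z)
    (fun y hy h' => (hol y (by omega)).1 h' (by omega)) (fun y hy => hore y (by omega)) hor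
  have hdl : ∀ y, z ≤ y → y ≤ l → d l y = nw := by
    intro y hy hy'
    rcases hy'.lt_or_eq with hy' | rfl
    · exact column_nw (A := z) (B := l) (fun x hx hx' => (hol x hx').2 (by omega))
        (by rw [hod.2 hp]; simp) hy hy'
    · exact hod.2 hp
  obtain ⟨r, -, hr2, hr3, hr4, hr5⟩ := column_exists_right (c := e l) (A := 0) (B := l)
    (fun y _ hy => (hil y hy).2 (by omega)) (fun y _ hy => hie y hy) (Nat.zero_le _)
    (fun h' => by
      have := hir.2.1 h'
      rw [h.s_zero l le_rfl (by omega)] at this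
      cases this)
    (fun h' => by rw [hid.1 h'] at hp; cases hp)
  have hrz : r ≤ z := by
    by_contra hcon
    exact hdis z hzl ((hdl z le_rfl hzl).trans (hr4 z (Nat.zero_le _) (by omega)).symm)
  have hout : ∀ f', ∀ y ≤ l, d l y = (zeroRunModel M l b z p).colOut l (g l) (f', 0) y := by
    intro f' y hy
    simp only [zeroRunModel, hp, true_or, if_true, hinv.2, h.zeros, h.zeros_succ]
    split_ifs with h1 h2 h3
    · exact hb1 y (by omega)
    · exact hdl y (by omega) hy
    · omega
    · omega
    · exact hdl y (by omega) hy
  have hin : ∀ f', (f' = r ∧ e l r = se) ∨ (f' = z + 1 ∧ r = z ∧ e l r = ne) →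
      ∀ y ≤ l, e l y = (zeroRunModel M l b z p).colIn l (g l) (f', 0) y := by
    intro f' hf' y hy
    simp only [zeroRunModel, le_refl, true_or, if_true, true_and]
    rw [if_pos (show l < l + b by omega), show min f' z = r by omega]
    split_ifs with h1 h2 h3
    · exact hr4 y (Nat.zero_le _) h1
    · rw [h2]; exact (hf'.resolve_left (by omega)).2.2
    · rw [h2]; exact (hf'.resolve_right (by omega)).2
    · exact hr5 y (by omega) hy
  rcases hr3 with hr3 | hr3
  · have hrz' : r = z := by
      by_contra hcon
      exact hdis r hr2 ((hb1 r (by omega)).trans hr3.symm)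
    refine ⟨(z + 1, 0), ?_, fun y hy => ⟨hout _ y hy, hin _ (Or.inr ⟨rfl, hrz', hr3⟩) y hy⟩⟩
    simp only [zeroRunModel, and_true, if_true]
    rw [if_neg (by omega), if_pos (by omega)]
    omega
  · have hr0 : r ≠ 0 := by
      rintro rfl
      exact hir.1 hr3
    refine ⟨(r, 0), ?_, fun y hy => ⟨hout _ y hy, hin _ (Or.inl ⟨rfl, hr3⟩) y hy⟩⟩
    simp only [zeroRunModel, and_true, if_true]
    rw [if_neg (by omega), if_pos (by omega)]
    omega

/-- The incoming directions in the columns after the first one of the run. -/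
theorem in_run (h : ZeroRun M l b z s p) {X f k : ℕ} {c' : ℕ → Dir} (hlX : l < X) (hX : X ≤ l + b)
    (hf : 1 ≤ f ∧ f ≤ z + 1)
    (hleft : ∀ y < X, (c' y = nw ∨ c' (y + 1) = sw) ↔ ¬ y + 1 = f)
    (hex : ∀ y < X, ¬ (c' y = nw ∧ c' (y + 1) = sw))
    (hrow : c' 0 ≠ se ∧ (c' 0 = sw ↔ s X = true)) (hdiag : c' X = nw)
    (hne : ∀ y ≤ X, y < z → c' y ≠ ne) :
    (∀ y, f ≤ y → y ≤ X → c' y = nw) ∧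
      (X < l + b → ∃ f', 1 ≤ f' ∧ ((f' ≤ z ∧ f' < f ∧ c' f' = se) ∨
        (f' = z + 1 ∧ f = z + 1 ∧ c' z = ne)) ∧
        ∀ y ≤ X, c' y = (zeroRunModel M l b z p).colIn X (f, k) (f', k) y) ∧
      (X = l + b → ∀ y ≤ X, c' y = (zeroRunModel M l b z p).colIn X (f, k) (0, k) y) := by
  have hz := h.pos
  have hzl := h.le
  have hup : ∀ y, f ≤ y → y ≤ X → c' y = nw := by
    intro y hy hy'
    rcases hy'.lt_or_eq with hy' | rfl
    · exact column_nw (A := f) (B := X) (fun x hx hx' => (hleft x hx').2 (by omega))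
        (by rw [hdiag]; simp) hy hy'
    · exact hdiag
  have hp := h.p_zero X hlX hX
  refine ⟨hup, fun hXb => ?_, fun hXb y hy => ?_⟩
  · have hs := h.s_zero X hlX.le hXb
    obtain ⟨r, -, hr2, hr3, hr4, hr5⟩ := column_exists_right (c := c') (A := 0) (B := f - 1)
      (fun y _ hy => (hleft y (by omega)).2 (by omega)) (fun y _ hy => hex y (by omega))
      (Nat.zero_le _) (fun h' => by rw [hrow.2.1 h'] at hs; cases hs)
      (fun h' => (hleft (f - 1) (by omega)).1 (Or.inl h') (by omega))
    have hin : ∀ f', (f' = r ∧ c' r = se) ∨ (f' = z + 1 ∧ r = z ∧ c' r = ne) →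
        ∀ y ≤ X, c' y = (zeroRunModel M l b z p).colIn X (f, k) (f', k) y := by
      intro f' hf' y hy
      simp only [zeroRunModel]
      rw [if_pos (by omega), show min f' z = r by omega]
      split_ifs with h1 h2 h3 h4
      · exact hr4 y (Nat.zero_le _) h1
      · rw [h2]; exact (hf'.resolve_left (by omega)).2.2
      · rw [h2]; exact (hf'.resolve_right (by omega)).2
      · exact hr5 y (by omega) (by omega)
      · exact hup y (by omega) hy
    rcases hr3 with hr3 | hr3
    · have hrz : r = z := by
        by_contra hcon
        exact hne r (by omega) (by omega) hr3
      exact ⟨z + 1, by omega, Or.inr ⟨rfl, by omega, hrz ▸ hr3⟩, hin _ (Or.inr ⟨rfl, hrz, hr3⟩)⟩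
    · have hr0 : r ≠ 0 := by
        rintro rfl
        exact hrow.1 hr3
      exact ⟨r, by omega, Or.inl ⟨by omega, by omega, hr3⟩, hin _ (Or.inl ⟨rfl, hr3⟩)⟩
  · have h0 := hrow.2.2 (by rw [hXb]; exact h.s_one)
    simp only [zeroRunModel, hp]
    rw [if_neg (by omega), if_neg (by simp)]
    split_ifs with h1
    · exact column_all_sw (X := f - 1) (fun x hx => (hleft x (by omega)).2 (by omega)) h0 y
        (by omega)
    · exact hup y (by omega) hy

/-- If the state is at most `z`, then the incoming edges above it have direction `nw`. So the
outgoing edges from the hole on do not have this direction, and `column_of_zero` applies. -/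
theorem continues_low (h : ZeroRun M l b z s p) {X : ℕ} {g : ℕ → ℕ × ℕ}
    (hinv : (zeroRunModel M l b z p).inv X (g X))
    (hf : (zeroRunModel M l b z p).Fits M s p X (g X) (d X) (e X)) (hlX : l < X) (hX : X ≤ l + b)
    (hfz : (g X).1 ≤ z) :
    (zeroRunModel M l b z p).Continues X (g X) (d X) (e X) := by
  obtain ⟨hol, hil, hoe, hie, hore, hire, hdis, hod, hid, hor, hir, hlast⟩ := hf
  have hz := h.pos
  have hM := h.lt_last (by omega)
  have hp := h.p_zero X hlX hX
  have hZ := h.zeros_mid hlX (by omega)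
  have hZX := h.zeros_lt hlX
  simp only [zeroRunModel] at hinv hol hil
  rw [if_neg (by omega), if_pos hX] at hinv
  have hup : ∀ y, (g X).1 ≤ y → y ≤ X → e X y = nw := by
    intro y hy hy'
    rcases hy'.lt_or_eq with hy' | rfl
    · exact column_nw (A := (g X).1) (B := X) (fun x hx hx' => (hil x hx').2 (by omega))
        (by rw [hid.2 hp]; simp) hy hy'
    · exact hid.2 hp
  obtain ⟨e', he', hcol⟩ := column_of_zero (c := d X) (by omega) (Or.inl hZX) hol hore hor
    (fun y hy hy' => by rw [← hup y (by omega) hy]; exact hdis y hy)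
  obtain ⟨-, hin1, hin2⟩ := h.in_run (k := (g X).2) hlX hX (by omega) hil hie hir (hid.2 hp)
    (fun y hy hy' h1 => hdis y hy (by rw [hcol y hy, if_pos (by omega), h1]))
  have hout : ∀ f', ∀ y ≤ X, d X y = (zeroRunModel M l b z p).colOut X (g X) (f', e') y := by
    intro f' y hy
    simp only [zeroRunModel, hp, zerosBefore_succ_of_zero hp, Bool.false_eq_true, false_or]
    rw [if_neg (show ¬ (g X).1 = z + 1 by omega)]
    exact hcol y hy
  rcases hX.lt_or_eq with hX' | hX'
  · obtain ⟨f', hf1, hf2, hin⟩ := hin1 hX'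
    clear hin1
    refine ⟨(f', e'), ?_, fun y hy => ⟨hout f' y hy, hin y hy⟩⟩
    simp only [zeroRunModel]
    rw [if_neg (by omega), if_pos hX', if_neg (by omega)]
    omega
  · refine ⟨(0, e'), ?_, fun y hy => ⟨hout 0 y hy, hin2 hX' y hy⟩⟩
    simp only [zeroRunModel, true_and]
    rw [if_neg (by omega), if_neg (by omega)]
    omega

/-- If the state is `z + 1`, then the hole is in row `z`. By `not_return` its cell is not used from
row `z + 1`, and if the strand that runs back in row `z` enters this column from the right, then it
does not come from the outgoing edge of row `z + 1`. -/
theorem continues_high (h : ZeroRun M l b z s p) {X : ℕ} {g : ℕ → ℕ × ℕ} (hmono : NoReturn M p d e)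
    (hg : (zeroRunModel M l b z p).Follows X g d e)
    (hinv : (zeroRunModel M l b z p).inv X (g X))
    (hf : (zeroRunModel M l b z p).Fits M s p X (g X) (d X) (e X)) (hlX : l < X) (hX : X ≤ l + b)
    (hfz : (g X).1 = z + 1) :
    (zeroRunModel M l b z p).Continues X (g X) (d X) (e X) := by
  obtain ⟨hol, hil, hoe, hie, hore, hire, hdis, hod, hid, hor, hir, hlast⟩ := hf
  have hz := h.pos
  have hzl := h.le
  have hM := h.lt_last (by omega)
  have hp := h.p_zero X hlX hX
  have hZ := h.zeros_mid hlX (by omega)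
  have hZX := h.zeros_lt hlX
  have hgX := h.run_states hg hX hfz hlX le_rfl
  simp only [zeroRunModel] at hinv hol hil
  rw [if_neg (by omega), if_pos hX] at hinv
  have hup : ∀ y, z < y → y ≤ X → e X y = nw := by
    intro y hy hy'
    rcases hy'.lt_or_eq with hy' | rfl
    · exact column_nw (A := (g X).1) (B := X) (fun x hx hx' => (hil x hx').2 (by omega))
        (by rw [hid.2 hp]; simp) (by omega) hy'
    · exact hid.2 hp
  have hnw : ∀ y ≤ X, z < y → d X y ≠ nw := fun y hy hy' => by
    rw [← hup y hy' hy]; exact hdis y hy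
  obtain ⟨hno1, hno2⟩ := h.not_return hmono hg hlX hX hfz hup (fun y hy hy' hX1 => by
    obtain ⟨q, rfl⟩ : ∃ q, y = q + 1 := ⟨y - 1, by omega⟩
    exact ((hol q (by omega)).2 (by omega)).resolve_left (hnw q (by omega) (by omega)))
  have hreal : (e X (z + 1)).IsReal M X (z + 1) := by
    rw [hup (z + 1) (by omega) (by omega)]
    exact isReal_nw (by omega) (by omega)
  -- the cell of the hole cannot be used from above
  have hhole : d X z = nw := by
    refine ((hol z (by omega)).2 (by omega)).resolve_right fun h1 => hno1 ?_
    have h2 : e (X - 1) z = ne := by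
      rw [hg.inn (X - 1) (by omega) z (by omega), Nat.sub_add_cancel (by omega)]
      simp only [zeroRunModel]
      rw [if_pos (by omega), hfz, if_neg (by omega), if_pos (by omega), if_pos rfl]
    refine ⟨?_, ?_, ?_⟩
    · simp only [h1]; exact isReal_sw (by omega) (by omega)
    · simp only [h2]; exact isReal_ne (by omega) (by omega)
    · simp only [h1, h2]
      rw [latticePoint_add_ne, Nat.sub_add_cancel (by omega), latticePoint_add_sw]
  obtain ⟨e', he', hcol⟩ := column_of_zero_nw (c := d X) (by omega) hZX hol hoe hore hor
    (fun y hy => by rw [show y = z by omega]; exact hhole)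
    (fun y hy hy' => hnw y hy (by omega))
  obtain ⟨-, hin1, hin2⟩ := h.in_run (k := (g X).2) hlX hX (by omega) hil hie hir (hid.2 hp)
    (fun y hy hy' h1 => hdis y hy (by rw [hcol y hy, if_pos (by omega), h1]))
  have hout : ∀ f', ∀ y ≤ X, d X y = (zeroRunModel M l b z p).colOut X (g X) (f', e') y := by
    intro f' y hy
    simp only [zeroRunModel, hp, zerosBefore_succ_of_zero hp, Bool.false_eq_true, false_or, hfz,
      if_true, if_false]
    exact hcol y hy
  rcases hX.lt_or_eq with hX' | hX'
  · obtain ⟨f', hf1, hf2, hin⟩ := hin1 hX'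
    clear hin1
    refine ⟨(f', e'), ?_, fun y hy => ⟨hout f' y hy, hin y hy⟩⟩
    simp only [zeroRunModel]
    rw [if_neg (by omega), if_pos hX', if_neg (by omega)]
    refine ⟨hf1, ?_⟩
    rcases hf2 with hf2 | hf2
    · right; left
      omega
    · left
      refine ⟨hfz, hf2.1, ?_⟩
      by_contra hcon
      have h1 : d X (z + 1) = se := by
        rw [hcol (z + 1) (by omega), if_neg (show ¬ z + 1 + (g X).2 < zerosBefore p X by omega),
          if_neg (show z + 1 + (g X).2 ≠ zerosBefore p X by omega),
          if_pos (show z + 1 + e' ≤ zerosBefore p X + 1 by omega)]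
      refine hno2 hhole ⟨?_, ?_, ?_⟩
      · simp only [h1]; exact isReal_se (by omega) (by omega)
      · simp only [hf2.2.2]; exact isReal_ne (by omega) (by omega)
      · simp only [h1, hf2.2.2]
        rw [latticePoint_add_ne, latticePoint_add_se]
  · refine ⟨(0, e'), ?_, fun y hy => ⟨hout 0 y hy, hin2 hX' y hy⟩⟩
    simp only [zeroRunModel, true_and]
    rw [if_neg (by omega), if_neg (by omega)]
    omega

theorem continues (h : ZeroRun M l b z s p) (hmono : NoReturn M p d e) {X : ℕ} (hX : X ≤ M)
    {g : ℕ → ℕ × ℕ} (hg : (zeroRunModel M l b z p).Follows X g d e)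
    (hinv : (zeroRunModel M l b z p).inv X (g X))
    (hf : (zeroRunModel M l b z p).Fits M s p X (g X) (d X) (e X)) :
    (zeroRunModel M l b z p).Continues X (g X) (d X) (e X) := by
  have hcases : (X < l ∨ (X = l ∧ b = 0) ∨ l + b < X) ∨ (X = l ∧ 1 ≤ b) ∨ (l < X ∧ X ≤ l + b) := by
    omega
  rcases hcases with hc | ⟨rfl, hc⟩ | hc
  · exact h.continues_std hX hinv hf hc
  · exact h.continues_first hinv hf hc
  · by_cases hfz : (g X).1 = z + 1
    · exact h.continues_high hmono hg hinv hf hc.1 hc.2 hfz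
    · refine h.continues_low hinv hf hc.1 hc.2 ?_
      simp only [zeroRunModel] at hinv
      rw [if_neg (by omega), if_pos (by omega)] at hinv
      omega

end ZeroRun

/-! ### Sequences of states for the words `u 0^b 1 v` and `u 1 0^b v` -/

namespace ZeroRun

variable {M l b z : ℕ} {s t p : ℕ → Bool} {g : ℕ → ℕ × ℕ}

/-- The invariant of the model in the columns after the first one of the run. -/
theorem state_run (h : ZeroRun M l b z s p) (hg : (zeroRunModel M l b z p).IsChain M g) {X : ℕ}
    (hlX : l < X) (hX : X ≤ l + b) :
    1 ≤ (g X).1 ∧ (g X).1 ≤ z + 1 ∧ (g X).2 + l + 1 ≤ X ∧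
      ((g X).1 = z + 1 → (g X).2 + l + 1 = X) := by
  have hM := h.le_last
  have := hg.inv h.isValid (X := X) (by omega)
  simp only [zeroRunModel] at this
  rwa [if_neg (by omega), if_pos hX] at this

/-- The value `z + 1` of the first component occurs only in the run. -/
theorem le_of_high (h : ZeroRun M l b z s p) (hg : (zeroRunModel M l b z p).IsChain M g) {X : ℕ}
    (hX : X ≤ M + 1) (hf : (g X).1 = z + 1) : l < X ∧ X ≤ l + b := by
  have := hg.inv h.isValid hX
  simp only [zeroRunModel] at this
  split_ifs at this <;> omega

/-- The value `z + 1` of the first component is never taken again once it has been left. -/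
theorem high_of_le (h : ZeroRun M l b z s p) (hg : (zeroRunModel M l b z p).IsChain M g) {X X' : ℕ}
    (hlX : l < X) (hXX' : X ≤ X') (hX' : X' ≤ M + 1) (hf : (g X').1 = z + 1) :
    (g X).1 = z + 1 := by
  obtain ⟨k, rfl⟩ : ∃ k, X' = X + k := ⟨X' - X, by omega⟩
  induction k with
  | zero => exact hf
  | succ k ih =>
    refine ih (by omega) (by omega) ?_
    have h1 := h.le_of_high hg hX' hf
    have h2 := hg.step (X + k) (by omega)
    simp only [zeroRunModel] at h2
    rw [if_neg (by omega), if_pos (by omega), if_neg (by omega), Nat.add_assoc] at h2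
    omega

/-- A strand leaves a column to the left only in row `z` of the run. -/
theorem backward (h : ZeroRun M l b z s p) (hg : (zeroRunModel M l b z p).IsChain M g)
    {P Q : ℕ × ℕ} (hPQ : TangleStep M ((zeroRunModel M l b z p).outDir M g)
      ((zeroRunModel M l b z p).inDir M g) P Q) :
    P.1 ≤ Q.1 ∨ (P.1 = Q.1 + 1 ∧ l ≤ Q.1 ∧ Q.1 < l + b ∧ (g P.1).1 = z + 1 ∧ P.2 = z) := by
  have hM := h.le_last
  rcases hPQ.fst_le with h1 | ⟨h1, h2, h3⟩
  · exact Or.inl h1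
  · right
    obtain ⟨⟨hP1, hP2, -, -⟩, ⟨hQ1, hQ2, -, -⟩, heq⟩ := hPQ
    obtain ⟨X, Y⟩ := P
    obtain ⟨X', Y'⟩ := Q
    simp only at *
    subst h1
    have hX' : l ≤ X' ∧ X' < l + b := by
      by_contra hcon
      rw [ColumnModel.inDir_eq hQ1 hQ2] at h2
      simp only [zeroRunModel, if_neg hcon] at h2
      split_ifs at h2 <;> simp at h2
    have hst := h.state_run hg (X := X' + 1) (by omega) (by omega)
    have hZ := h.zeros_mid (X := X' + 1) (by omega) (by omega)
    -- the cell through which the strand passes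
    have hcell : ((zeroRunModel M l b z p).outDir M g (X' + 1) Y = nw ∧ Y + 1 = (g (X' + 1)).1) ∨
        ((zeroRunModel M l b z p).outDir M g (X' + 1) Y = sw ∧ Y = (g (X' + 1)).1) := by
      have h4 : ((zeroRunModel M l b z p).inDir M g X' Y' = ne ∧ Y' + 1 = (g (X' + 1)).1) ∨
          ((zeroRunModel M l b z p).inDir M g X' Y' = se ∧ Y' = (g (X' + 1)).1) := by
        rw [ColumnModel.inDir_eq hQ1 hQ2] at h2 ⊢
        simp only [zeroRunModel, if_pos hX'] at h2 ⊢
        split_ifs at h2 ⊢ <;> simp at h2 ⊢ <;> omega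
      rcases h4 with ⟨h4, h5⟩ | ⟨h4, h5⟩ <;> rcases h3 with h3 | h3 <;>
        simp only [h3, h4, latticePoint, Dir.offset, Prod.ext_iff, Prod.fst_add, Prod.snd_add,
          true_and, reduceCtorEq, false_and, or_false, false_or] at heq ⊢ <;> omega
    have hp := h.p_zero (X' + 1) (by omega) (by omega)
    refine ⟨rfl, hX'.1, hX'.2, ?_⟩
    rw [ColumnModel.outDir_eq hP1 hP2] at hcell
    by_cases hf : (g (X' + 1)).1 = z + 1
    · refine ⟨hf, ?_⟩
      rcases hcell with hcell | ⟨h5, h6⟩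
      · omega
      · simp only [zeroRunModel, hf, or_true, if_true, zerosBefore_succ_of_zero hp] at h5
        rw [if_neg (by omega), if_neg (by omega)] at h5
        split_ifs at h5; omega
    · simp only [zeroRunModel, hp, hf, Bool.false_eq_true, or_self, if_false] at hcell
      rw [if_pos (by omega)] at hcell
      simp at hcell

theorem inDir_high (h : ZeroRun M l b z s p) (hg : (zeroRunModel M l b z p).IsChain M g) {X y : ℕ}
    (hX : X ≤ M) (hf : (g X).1 = z + 1) (hy : z < y) (hyX : y ≤ X) :
    (zeroRunModel M l b z p).inDir M g X y = nw := by
  have h1 := h.le_of_high hg (by omega) hf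
  rw [ColumnModel.inDir_eq hyX hX]
  simp only [zeroRunModel, h.p_zero X h1.1 h1.2, hf, Bool.false_eq_true, if_false]
  split_ifs <;> first | rfl | omega

theorem outDir_high (h : ZeroRun M l b z s p) (hg : (zeroRunModel M l b z p).IsChain M g) {X y : ℕ}
    (hX : X ≤ M) (hf : (g X).1 = z + 1) (hy : z < y) (hyX : y ≤ X) :
    (zeroRunModel M l b z p).outDir M g X y = if y + (g (X + 1)).2 + l ≤ z + X then se
      else if y + l ≤ z + X then ne else sw := by
  have h1 := h.le_of_high hg (by omega) hf
  have h2 := h.state_run hg h1.1 h1.2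
  have hZ := h.zeros_mid h1.1 (by omega)
  have hp := h.p_zero X h1.1 h1.2
  rw [ColumnModel.outDir_eq hyX hX]
  simp only [zeroRunModel, hp, hf, Bool.false_eq_true, or_true, if_true, if_false,
    zerosBefore_succ_of_zero hp]
  split_ifs <;> first | rfl | omega

/-- By levels, only the strand from the external edge `l + 1` could lead to one on its left, namely
to the edge `l`. But this strand stays above the row in which the strand runs back to column `l`. -/
theorem noReturn (h : ZeroRun M l b z s p) (hg : (zeroRunModel M l b z p).IsChain M g)
    (ht : IsTangle M s t p ((zeroRunModel M l b z p).outDir M g)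
      ((zeroRunModel M l b z p).inDir M g)) :
    NoReturn M p ((zeroRunModel M l b z p).outDir M g) ((zeroRunModel M l b z p).inDir M g) := by
  intro i j hi hj hpi hpj hij
  have hM := h.le_last
  have hz := h.pos
  have hzl := h.le
  have hne : i ≠ j := by rintro rfl; rw [hpi] at hpj; cases hpj
  have hil : i ≠ l := by rintro rfl; rw [h.p_one] at hpi; cases hpi
  by_contra hcon
  by_cases hc : l < i ∧ i ≤ l + b
  · have h1 := reflTransGen_invariant (fun Q => l ≤ Q.1) hij hc.1.le (fun A B hA hAB => by
      have := h.backward hg hAB; omega)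
    simp only at h1
    obtain rfl : j = l := by
      by_contra hjl
      rw [h.p_zero j (by omega) (by omega)] at hpj
      cases hpj
    have hlev := ht.inLevel_eq hij
    simp only at hlev
    rw [ht.inLevel_start hi hpi, ht.inLevel_end hj hpj, wordHeight_eq, wordHeight_eq,
      h.zeros] at hlev
    have h2 := h.zeros_mid (X := i + 1) (by omega) (by omega)
    obtain rfl : i = j + 1 := by omega
    have h3 := reflTransGen_invariant (fun Q => j < Q.1 ∧ ((g Q.1).1 ≠ z + 1 ∨
      (z + 1 ≤ Q.2 ∧ (Q.2 = z + 1 ∨ Q.1 = j + 1)))) hij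
      (by simp only [or_true, and_true]; omega) ?_
    · simp only at h3
      omega
    rintro ⟨X, y⟩ ⟨X', y'⟩ ⟨hA1, hA2⟩ hAB
    have hback := h.backward hg hAB
    obtain ⟨hr1, hr2, heq⟩ := hAB
    have hr1' := hr1.1
    have hr2' := hr2.1
    have hr1'' := hr1.2.1
    have hr2'' := hr2.2.1
    simp only at *
    have hXX' : X ≤ X' := by omega
    refine ⟨by omega, ?_⟩
    by_cases hF : (g X).1 = z + 1
    · have h4 := hA2.resolve_left (by omega)
      have h5 := h.le_of_high hg (by omega) hF
      have hout := h.outDir_high hg hr1'' hF (y := y) (by omega) hr1'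
      rcases Nat.lt_or_ge (z + X) (y + j) with h6 | h6
      · -- the strand goes down column `l + 1`
        rw [if_neg (by omega), if_neg (by omega)] at hout
        obtain ⟨q, rfl⟩ : ∃ q, y = q + 1 := ⟨y - 1, by omega⟩
        have hin := h.inDir_high hg hr1'' hF (y := q) (by omega) (by omega)
        obtain ⟨h7, h8⟩ := ht.in_dimer.injective (X := X) (Y := q) (X' := X') (Y' := y')
          (by rw [hin]; exact isReal_nw (by omega) (by omega)) hr2
          (by rw [hin, ← heq, hout, latticePoint_add_sw, latticePoint_add_nw])
        right
        omega
      · obtain rfl : y = z + 1 := by omega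
        by_cases hF' : (g (X + 1)).1 = z + 1
        · -- the strand continues along row `z + 1`
          have h9 := h.le_of_high hg (by omega) hF'
          have h10 := h.state_run hg h9.1 h9.2
          rw [if_neg (by omega), if_pos (by omega)] at hout
          have hin := h.inDir_high hg (X := X + 1) (by omega) hF' (y := z + 1) (by omega) (by omega)
          obtain ⟨h7, h8⟩ := ht.in_dimer.injective (X := X + 1) (Y := z + 1) (X' := X') (Y' := y')
            (by rw [hin]; exact isReal_nw (by omega) (by omega)) hr2
            (by rw [hin, ← heq, hout, latticePoint_add_ne, latticePoint_add_nw])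
          right
          omega
        · left
          intro hF''
          refine hF' (h.high_of_le hg (by omega) ?_ (by omega) hF'')
          refine lt_of_le_of_ne hXX' ?_
          rintro rfl
          have hdir : (zeroRunModel M j b z p).outDir M g X (z + 1) = se ∨
              (zeroRunModel M j b z p).outDir M g X (z + 1) = ne := by
            rw [hout, if_pos h6]
            split_ifs <;> simp
          have hin : (zeroRunModel M j b z p).inDir M g X y' = nw ∨
              (zeroRunModel M j b z p).inDir M g X y' = sw ∨
              ((zeroRunModel M j b z p).inDir M g X y' = se ∧ y' ≤ z) := by
            rw [ColumnModel.inDir_eq hr2' hr2'']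
            simp only [zeroRunModel]
            split_ifs <;> simp
            omega
          rcases hdir with hdir | hdir <;> rcases hin with hin | hin | ⟨hin, hy'⟩ <;>
            simp only [hdir, hin, latticePoint, Dir.offset, Prod.ext_iff, Prod.fst_add,
              Prod.snd_add] at heq <;> omega
    · left
      exact fun hF' => hF (h.high_of_le hg (by omega) hXX' (by omega) hF')
  · have := reflTransGen_invariant (fun Q => i ≤ Q.1) hij le_rfl (fun A B hA hAB => by
      have := h.backward hg hAB; omega)
    simp only at this
    omega

/-- The second component of the next state is read off the outgoing edges. By symmetry it suffices
to exclude one strict inequality. -/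
theorem snd_eq_of_colOut (h : ZeroRun M l b z s p) {X : ℕ} (hX : X ≤ M) {x x' x'' : ℕ × ℕ}
    (hx : (zeroRunModel M l b z p).inv X x) (h1 : (zeroRunModel M l b z p).step X x x')
    (h2 : (zeroRunModel M l b z p).step X x x'')
    (hout : ∀ y ≤ X, (zeroRunModel M l b z p).colOut X x x' y =
      (zeroRunModel M l b z p).colOut X x x'' y) : ¬ x'.2 < x''.2 := by
  intro hlt
  obtain ⟨f, e⟩ := x
  obtain ⟨f', e'⟩ := x'
  obtain ⟨f'', e''⟩ := x''
  have hc1 := h.state_cases hX hx h1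
  have hc2 := h.state_cases hX hx h2
  have hz := h.pos
  have hzl := h.le
  have hZX := zerosBefore_succ_cases p X
  have hout := hout (zerosBefore p (X + 1) - e')
  simp only [zeroRunModel] at hout hlt
  clear hx h1 h2
  generalize zerosBefore p X = Z at *
  generalize zerosBefore p (X + 1) = Z' at *
  cases hp : p X <;> simp only [hp, Bool.true_eq_false, Bool.false_eq_true, true_and, false_and,
    and_false, false_or, or_false, if_true, if_false] at hc1 hc2 hout hZX
  · by_cases hf : f = z + 1
    · have h4 : Z < X ∧ e ≤ Z ∧ e'' ≤ e + 1 := by omega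
      have h3 := hout (by omega)
      simp only [hf, if_true] at h3
      clear hc1 hc2 hout
      split_ifs at h3 <;> omega
    · have h4 : Z < X ∧ e ≤ Z ∧ e'' ≤ e := by omega
      have h3 := hout (by omega)
      simp only [hf, if_false] at h3
      clear hc1 hc2 hout
      split_ifs at h3 <;> omega
  · have h4 : Z < X ∧ e ≤ Z ∧ e'' ≤ e := by omega
    have h3 := hout (by omega)
    simp only [true_or, if_true] at h3
    clear hc1 hc2 hout
    split_ifs at h3 <;> omega

theorem eq_of_columns (h : ZeroRun M l b z s p) (X : ℕ) (hX : X ≤ M) (x x' x'' : ℕ × ℕ)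
    (hx : (zeroRunModel M l b z p).inv X x) (h1 : (zeroRunModel M l b z p).step X x x')
    (h2 : (zeroRunModel M l b z p).step X x x'')
    (hpair : ∀ y ≤ X, ((zeroRunModel M l b z p).colOut X x x' y =
        (zeroRunModel M l b z p).colOut X x x'' y ∧
        (zeroRunModel M l b z p).colIn X x x' y = (zeroRunModel M l b z p).colIn X x x'' y) ∨
      ((zeroRunModel M l b z p).colOut X x x' y = (zeroRunModel M l b z p).colIn X x x'' y ∧
        (zeroRunModel M l b z p).colIn X x x' y = (zeroRunModel M l b z p).colOut X x x'' y)) :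
    x' = x'' := by
  have hz := h.pos
  have hzl := h.le
  have hdis := h.disjoint X hX x x'' hx h2
  have hc1 := h.state_cases hX hx h1
  have hc2 := h.state_cases hX hx h2
  -- if the incoming columns agree, then so do the outgoing ones
  have hsnd : x'.1 = x''.1 → x'.2 = x''.2 := by
    intro hfst
    have hin : ∀ y, (zeroRunModel M l b z p).colIn X x x' y =
        (zeroRunModel M l b z p).colIn X x x'' y := by
      intro y
      simp only [zeroRunModel, hfst]
    have hout : ∀ y ≤ X, (zeroRunModel M l b z p).colOut X x x' y =
        (zeroRunModel M l b z p).colOut X x x'' y := by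
      intro y hy
      refine (hpair y hy).elim (fun h => h.1) fun h' => absurd (h'.1.trans (hin y).symm) ?_
      exact h.disjoint X hX x x' hx h1 y hy
    have h3 := h.snd_eq_of_colOut hX hx h1 h2 hout
    have h4 := h.snd_eq_of_colOut hX hx h2 h1 fun y hy => (hout y hy).symm
    omega
  suffices hfst : x'.1 = x''.1 from Prod.ext hfst (hsnd hfst)
  by_cases hc : l ≤ X ∧ X < l + b
  · -- up to row `z` the outgoing directions depend only on the state on the left
    have hin : ∀ y ≤ z, (zeroRunModel M l b z p).colIn X x x' y =
        (zeroRunModel M l b z p).colIn X x x'' y := by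
      intro y hy
      refine (hpair y (by omega)).elim (fun h => h.2) fun h' => absurd h'.1 ?_
      have h3 : (zeroRunModel M l b z p).colOut X x x' y =
          (zeroRunModel M l b z p).colOut X x x'' y := by
        simp only [zeroRunModel]
        by_cases h4 : p X = true ∨ x.1 = z + 1
        · rw [if_pos h4, if_pos h4]
          by_cases h5 : y + x.2 < zerosBefore p X
          · rw [if_pos h5, if_pos h5]
          · rw [if_neg h5, if_neg h5, if_pos (by omega), if_pos (by omega)]
        · have h5 : y + x.2 ≤ zerosBefore p X := by
            rw [not_or, Bool.not_eq_true] at h4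
            omega
          rw [if_neg h4, if_neg h4, if_pos h5, if_pos h5]
      rw [h3]
      exact hdis y (by omega)
    have h5 := hin (min x'.1 z) (by omega)
    have h6 := hin (min x''.1 z) (by omega)
    clear hpair hdis hsnd hin
    simp only [zeroRunModel, if_pos hc] at h5 h6
    have h7 : 1 ≤ x'.1 ∧ x'.1 ≤ z + 1 ∧ 1 ≤ x''.1 ∧ x''.1 ≤ z + 1 := by omega
    clear hc1 hc2
    split_ifs at h5 h6 <;> omega
  · omega

end ZeroRun

/-! ### Counting for the words `u 0^b 1 v` and `u 1 0^b v` -/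

/-- The number of sequences of natural numbers that decrease weakly from `i` to `k` in `T`
steps. -/
def decreasingCount (T i k : ℕ) : ℕ := if k ≤ i then (T + i - k - 1).choose (i - k) else 0

theorem decreasingCount_succ_succ (T i k : ℕ) : decreasingCount (T + 1) (i + 1) k =
    decreasingCount (T + 1) i k + decreasingCount T (i + 1) k := by
  unfold decreasingCount
  rcases lt_trichotomy k (i + 1) with h | rfl | h
  · rw [if_pos h.le, if_pos (by omega), if_pos h.le, show i + 1 - k = i - k + 1 by omega,
      show T + 1 + (i + 1) - k - 1 = T + i - k + 1 by omega,
      show T + 1 + i - k - 1 = T + i - k by omega, show T + (i + 1) - k - 1 = T + i - k by omega,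
      Nat.choose_succ_succ]
  · simp
  · rw [if_neg (by omega), if_neg (by omega), if_neg (by omega)]

theorem decreasingCount_from_zero (T T' k : ℕ) :
    decreasingCount T 0 k = decreasingCount T' 0 k := by
  unfold decreasingCount
  split_ifs with h
  · obtain rfl : k = 0 := by omega
    simp
  · rfl

theorem decreasingCount_zero (i k : ℕ) : decreasingCount 0 i k = if i = k then 1 else 0 := by
  unfold decreasingCount
  split_ifs with h1 h2 h2
  · simp [h2]
  · exact Nat.choose_eq_zero_of_lt (by omega)
  · omega
  · rfl

theorem sum_decreasingCount {T : ℕ} (hT : 1 ≤ T) (i k : ℕ) :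
    ∑ i' ∈ Finset.range (i + 1), decreasingCount (T - 1) i' k = decreasingCount T i k := by
  induction i with
  | zero => simpa using decreasingCount_from_zero _ _ _
  | succ i ih =>
    obtain ⟨T, rfl⟩ : ∃ T', T = T' + 1 := ⟨T - 1, by omega⟩
    rw [Finset.sum_range_succ, ih, decreasingCount_succ_succ, Nat.add_sub_cancel]

theorem sum_choose_pred (f j : ℕ) :
    ∑ i ∈ Finset.Ico 1 (f + 1), (i - 1).choose j = f.choose (j + 1) := by
  induction f with
  | zero => simp
  | succ f ih =>
    rw [Finset.sum_Ico_succ_top (by omega), ih, Nat.add_sub_cancel, Nat.choose_succ_succ, add_comm]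

namespace ZeroRun

variable {M l b z : ℕ} {s t p : ℕ → Bool}

/-- The transfer matrix count. The sequences are sorted by the number `m` of strips in state
`z + 1`; afterwards the first component decreases strictly, which gives `z.choose (b - m)`, and the
second one decreases weakly from `m` to `k`. The sum over `m` is evaluated by the identity of
Vandermonde. -/
theorem ncard_isChain (h : ZeroRun M l b z s p) {k : ℕ} (hk : k ≤ b) :
    {g | (zeroRunModel M l b z p).IsChain M g ∧ (g (M + 1)).2 = k}.ncard =
      (M - l - 1 - k + z).choose (b - k) := by
  have hzl := h.le
  have hz := h.pos
  have hM := h.le_last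
  have hlt := h.lt_last
  rw [ColumnModel.setOf_isChain _ _ (fun x : ℕ × ℕ => x.2 = k)]
  -- `m` is the number of strips in state `z + 1`, of which there are at least `j - l`
  let F : ℕ → ℕ := fun j =>
    ∑ m ∈ Finset.Ico (j - l) (b + 1), z.choose (b - m) * decreasingCount (M - l - m) m k
  let W : ℕ → ℕ × ℕ → ℕ := fun X x =>
    if X ≤ l then F l
    else if X ≤ l + b then
      if x.1 = z + 1 then F X else (x.1 - 1).choose (l + b - X) * decreasingCount (M - X) x.2 k
    else decreasingCount (M - X) x.2 k
  have hW1 : ∀ X ≤ l, ∀ x, W X x = F l := fun X hX x => if_pos hX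
  have hW2 : ∀ X, l < X → X ≤ l + b → ∀ e, W X (z + 1, e) = F X := fun X h1 h2 e => by
    simp only [W]
    rw [if_neg (by omega), if_pos h2, if_pos trivial]
  have hW3 : ∀ X, l < X → X ≤ l + b → ∀ f e, f ≤ z →
      W X (f, e) = (f - 1).choose (l + b - X) * decreasingCount (M - X) e k :=
      fun X h1 h2 f e h3 => by
    simp only [W]
    rw [if_neg (by omega), if_pos h2, if_neg (by omega)]
  have hW4 : ∀ X, l + b < X → ∀ x, W X x = decreasingCount (M - X) x.2 k := fun X h1 x => by
    simp only [W]
    rw [if_neg (by omega), if_neg (by omega)]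
  have hF : ∀ X, l ≤ X → X ≤ l + b →
      F X = z.choose (l + b - X) * decreasingCount (M - X) (X - l) k + F (X + 1) := by
    intro X h1 h2
    simp only [F]
    rw [Finset.sum_eq_sum_Ico_succ_bot (by omega), show b - (X - l) = l + b - X by omega,
      show M - l - (X - l) = M - X by omega, show X + 1 - l = X - l + 1 by omega]
  have hF' : F (l + b + 1) = 0 := by
    simp only [F]
    rw [Finset.Ico_eq_empty (by omega), Finset.sum_empty]
  -- the sum over the states that are reached when the strand leaves row `z`
  have hleave : ∀ X, l ≤ X → X < l + b → ∀ f ≤ z, ∀ e,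
      ∑ x' ∈ Finset.Ico 1 (f + 1) ×ˢ Finset.range (e + 1), W (X + 1) x' =
        f.choose (l + b - X) * decreasingCount (M - X) e k := by
    intro X h1 h2 f hf e
    rw [Finset.sum_product, show l + b - X = l + b - (X + 1) + 1 by omega, ← sum_choose_pred,
      Finset.sum_mul]
    refine Finset.sum_congr rfl fun f' hf' => ?_
    have := Finset.mem_Ico.1 hf'
    rw [← sum_decreasingCount (T := M - X) (by omega), Finset.mul_sum]
    refine Finset.sum_congr rfl fun e' _ => ?_
    rw [hW3 (X + 1) (by omega) (by omega) f' e' (by omega), Nat.sub_sub]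
  have htail : ∀ X, l + b ≤ X → X < M → ∀ e,
      ∑ x' ∈ {0} ×ˢ Finset.range (e + 1), W (X + 1) x' = decreasingCount (M - X) e k := by
    intro X h1 h2 e
    rw [Finset.sum_product, Finset.sum_singleton, ← sum_decreasingCount (T := M - X) (by omega)]
    refine Finset.sum_congr rfl fun e' _ => ?_
    rw [hW4 (X + 1) (by omega), Nat.sub_sub]
  have key := ncard_pathSet (P := fun x : ℕ × ℕ => x.2 = k) (o := (0, 0))
    (step := (zeroRunModel M l b z p).step) (zeroRunModel M l b z p).inv W (N := M + 1)
    (fun X hX => h.inv_step X (by omega)) ?_ ?_ (Nat.zero_le _) h.isValid.inv_start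
  · change (pathSet (zeroRunModel M l b z p).step (fun x => x.2 = k) (0, 0) (M + 1) 0 (0, 0)).ncard
      = _
    rw [show (zeroRunModel M l b z p).start = (0, 0) from rfl] at key
    rw [key, hW1 0 (Nat.zero_le _)]
    simp only [F]
    rw [Nat.sub_self, ← Finset.sum_Ico_consecutive _ (Nat.zero_le k) (show k ≤ b + 1 by omega),
      Finset.sum_eq_zero, zero_add, Finset.sum_Ico_eq_sum_range, Nat.add_choose_eq,
      Finset.Nat.sum_antidiagonal_eq_sum_range_succ (fun i j =>
        (M - l - 1 - k).choose i * z.choose j), show b + 1 - k = b - k + 1 by omega]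
    · refine Finset.sum_congr rfl fun j hj => ?_
      have := Finset.mem_range.1 hj
      rw [decreasingCount, if_pos (by omega), mul_comm, show b - (k + j) = b - k - j by omega,
        show M - l - (k + j) + (k + j) - k - 1 = M - l - 1 - k by omega, Nat.add_sub_cancel_left]
    · intro m hm
      have := Finset.mem_Ico.1 hm
      rw [decreasingCount, if_neg (by omega), mul_zero]
  · intro x _
    rw [hW4 _ (by omega), show M - (M + 1) = 0 by omega, decreasingCount_zero]
    exact ⟨fun h1 => if_pos h1, fun h1 => if_neg h1⟩
  · rintro X hX ⟨f, e⟩ hx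
    simp only [zeroRunModel] at hx ⊢
    have hcases : X < l ∨ (X = l ∧ X < l + b) ∨ (l < X ∧ X < l + b ∧ f = z + 1) ∨
      (l < X ∧ X < l + b ∧ f ≠ z + 1) ∨ (l < X ∧ X = l + b ∧ f = z + 1) ∨
      (l < X ∧ X = l + b ∧ f ≠ z + 1) ∨ (X = l ∧ b = 0) ∨ (l + b < X ∧ X < M) ∨
      (l + b < X ∧ X = M) := by omega
    rcases hcases with hc | hc | hc | hc | hc | hc | hc | hc | hc
    · refine ⟨{(0, 0)}, fun x' => ?_, ?_⟩
      · simp [hc, Prod.ext_iff]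
      · rw [Finset.sum_singleton, hW1 X hc.le, hW1 (X + 1) hc]
    · obtain ⟨rfl, hc⟩ := hc
      refine ⟨insert (z + 1, 0) (Finset.Ico 1 (z + 1) ×ˢ Finset.range 1), fun x' => ?_, ?_⟩
      · simp only [Finset.mem_insert, Finset.mem_product, Finset.mem_Ico, Finset.mem_range,
          Prod.ext_iff, lt_irrefl, if_false, hc, if_true]
        omega
      · rw [Finset.sum_insert (by simp), hW1 X le_rfl, hF X le_rfl hc.le, Nat.sub_self,
          hleave X le_rfl hc z le_rfl, hW2 (X + 1) (by omega) hc, add_comm]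
    · obtain ⟨h1, h2, rfl⟩ := hc
      rw [if_neg (by omega), if_pos h2.le] at hx
      refine ⟨insert (z + 1, e + 1) (Finset.Ico 1 (z + 1) ×ˢ Finset.range (e + 1 + 1)),
        fun x' => ?_, ?_⟩
      · simp only [Finset.mem_insert, Finset.mem_product, Finset.mem_Ico, Finset.mem_range,
          Prod.ext_iff, true_and]
        rw [if_neg (by omega), if_pos h2, if_neg (by omega)]
        omega
      · rw [Finset.sum_insert (by simp), hW2 X h1 h2.le, hF X h1.le h2.le,
          hleave X h1.le h2 z le_rfl, hW2 (X + 1) (by omega) h2, add_comm,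
          show X - l = e + 1 by omega]
    · obtain ⟨h1, h2, h3⟩ := hc
      rw [if_neg (by omega), if_pos h2.le] at hx
      obtain ⟨q, rfl⟩ : ∃ q, f = q + 1 := ⟨f - 1, by omega⟩
      refine ⟨Finset.Ico 1 (q + 1) ×ˢ Finset.range (e + 1), fun x' => ?_, ?_⟩
      · simp only [Finset.mem_product, Finset.mem_Ico, Finset.mem_range]
        rw [if_neg (by omega), if_pos h2, if_neg (by omega)]
        omega
      · rw [hW3 X h1 h2.le _ _ (by omega), hleave X h1.le h2 q (by omega), Nat.add_sub_cancel]
    · obtain ⟨h1, h2, rfl⟩ := hc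
      rw [if_neg (by omega), if_pos h2.le] at hx
      refine ⟨{0} ×ˢ Finset.range (e + 1 + 1), fun x' => ?_, ?_⟩
      · simp only [Finset.mem_product, Finset.mem_singleton, Finset.mem_range, true_and]
        rw [if_neg (by omega), if_neg (by omega)]
        omega
      · rw [hW2 X h1 h2.le, hF X h1.le h2.le, htail X h2.ge (by omega), h2, hF',
          Nat.sub_self, Nat.choose_zero_right, one_mul, add_zero, show l + b - l = e + 1 by omega]
    · obtain ⟨h1, h2, h3⟩ := hc
      rw [if_neg (by omega), if_pos h2.le] at hx
      refine ⟨{0} ×ˢ Finset.range (e + 1), fun x' => ?_, ?_⟩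
      · simp only [Finset.mem_product, Finset.mem_singleton, Finset.mem_range]
        rw [if_neg (by omega), if_neg (by omega)]
        omega
      · rw [hW3 X h1 h2.le _ _ (by omega), htail X h2.ge (by omega), h2, Nat.sub_self,
          Nat.choose_zero_right, one_mul]
    · obtain ⟨rfl, rfl⟩ := hc
      rw [if_pos le_rfl] at hx
      refine ⟨{(0, 0)}, fun x' => ?_, ?_⟩
      · simp only [Finset.mem_singleton, Prod.ext_iff]
        rw [if_neg (by omega), if_neg (by omega)]
        omega
      · rw [Finset.sum_singleton, hW1 X le_rfl, hF X le_rfl le_rfl, hW4 _ (by omega),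
          show F (X + 1) = 0 from hF', add_zero, Nat.add_sub_cancel_left, Nat.choose_zero_right,
          one_mul, Nat.sub_self]
        exact decreasingCount_from_zero _ _ _
    · refine ⟨{0} ×ˢ Finset.range (e + 1), fun x' => ?_, ?_⟩
      · rw [if_neg (by omega), if_neg (by omega)] at hx
        simp only [Finset.mem_product, Finset.mem_singleton, Finset.mem_range]
        rw [if_neg (by omega), if_neg (by omega)]
        omega
      · rw [hW4 X hc.1, htail X hc.1.le hc.2]
    · refine ⟨{(0, e)}, fun x' => ?_, ?_⟩
      · simp only [Finset.mem_singleton, Prod.ext_iff]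
        rw [if_neg (by omega), if_neg (by omega)]
        omega
      · rw [Finset.sum_singleton, hW4 X hc.1, hW4 (X + 1) (by omega),
          show M - (X + 1) = M - X by omega]

theorem of_words {n b : ℕ} {u v σ π : List (Fin 2)} (hM : M + 1 = 2 * n)
    (hσ : σ ∈ dyckWords n) (hπ : π ∈ dyckWords n)
    (hσu : σ = u ++ List.replicate b 0 ++ [1] ++ v)
    (hπu : π = u ++ [1] ++ List.replicate b 0 ++ v) :
    ZeroRun M u.length b (u.count 0) (letterFun σ) (letterFun π) := by
  have hlσ := (dyckWords_count hσ).1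
  have hlπ := (dyckWords_count hπ).1
  have hb : IsBallot (letterFun π) (M + 1) := hM ▸ dyckWords_isBallot hπ
  have hlen : u.length + b + 1 + v.length = 2 * n := by
    rw [← hlπ, hπu]; simp; omega
  refine ⟨?_, ?_, ?_, ?_, ?_, ?_, hb.first, hb.last, by omega⟩
  · rw [zerosBefore_letterFun π (by omega), hπu]
    simp
  · rw [letterFun_eq_true, hπu]
    simp
  · intro X h1 h2
    rw [letterFun_eq_false (by omega), hπu]
    simp only [List.getElem?_append, List.getElem?_replicate, List.length_append,
      List.length_replicate, List.length_singleton]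
    rw [if_pos (by omega), if_neg (by omega), if_pos (by omega)]
  · intro X h1 h2
    rw [letterFun_eq_false (by omega), hσu]
    simp only [List.getElem?_append, List.getElem?_replicate, List.length_append,
      List.length_replicate, List.length_singleton]
    rw [if_pos (by omega), if_pos (by omega), if_neg (by omega), if_pos (by omega)]
  · rw [letterFun_eq_true, hσu]
    simp
  · intro X hX
    have h1 : σ[X]? = π[X]? := by
      rw [hσu, hπu]
      simp only [List.getElem?_append, List.getElem?_replicate, List.length_append,
        List.length_replicate, List.length_singleton]
      rcases hX with hX | hX
      · rw [if_pos (by omega), if_pos (by omega), if_pos hX, if_pos (by omega), if_pos (by omega),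
          if_pos hX]
      · rw [if_neg (by omega), if_neg (by omega)]
        congr 1; omega
    simp only [letterFun, h1]

/-- The configurations for words `u 0^b 1 v` and `u 1 0^b v` are counted by sequences of states. -/
theorem tfplNumber_eq {n : ℕ} {σ τ π : List (Fin 2)} (hM : M + 1 = 2 * n)
    (hσ : σ ∈ dyckWords n) (hτ : τ ∈ dyckWords n) (hπ : π ∈ dyckWords n)
    (h : ZeroRun M l b z (letterFun σ) (letterFun π)) :
    tfplNumber n σ τ π = {g | (zeroRunModel M l b z (letterFun π)).IsChain M g ∧
      ∀ Y ≤ M, letterFun τ Y = false ↔ Y ≤ n ∧ Y + (g (M + 1)).2 ≠ n}.ncard := by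
  rw [ColumnModel.tfplNumber_eq _ hM hσ hτ hπ h.isValid
    (fun d e _ hmono X hX g hg hinv hf => h.continues hmono hX hg hinv hf)
    (fun g hg ht => h.noReturn hg ht) h.eq_of_columns]
  congr 1
  ext g
  refine and_congr_right fun hg => forall₂_congr fun Y hY => ?_
  have hM := h.le_last
  have h1 := hg.step M le_rfl
  simp only [zeroRunModel, zerosBefore_last ‹_› hπ] at h1 ⊢
  have hlt := h.lt_last
  rw [if_neg (by omega), if_neg (by omega)] at h1
  rw [show (g (M + 1)).2 = (g M).2 by omega]

end ZeroRun

theorem tfplNumber_zeroRun (n : ℕ) (u v σ τ π : List (Fin 2)) (hσ : σ ∈ dyckWords n)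
    (hτ : τ ∈ dyckWords n) (hπ : π ∈ dyckWords n) (b : ℕ)
    (hσu : σ = u ++ List.replicate b 0 ++ [1] ++ v)
    (hπu : π = u ++ [1] ++ List.replicate b 0 ++ v) :
    (tfplNumber n σ τ π ≠ 0 → ∃ k ≤ b, τ =
      List.replicate (n - k) 0 ++ [1] ++ List.replicate k 0 ++ List.replicate (n - 1) 1) ∧
    (∀ k ≤ b, τ =
      List.replicate (n - k) 0 ++ [1] ++ List.replicate k 0 ++ List.replicate (n - 1) 1 →
      tfplNumber n σ τ π = (2 * n - u.count 1 - 2 - k).choose (b - k)) := by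
  obtain ⟨hl, h0, h1⟩ := dyckWords_count hσ
  have hn : 1 ≤ n := by rw [hσu] at h1; simp at h1; omega
  have hbn : b ≤ n := by rw [hσu] at h0; simp at h0; omega
  obtain ⟨M, hM⟩ : ∃ M, M + 1 = 2 * n := ⟨2 * n - 1, by omega⟩
  have hrun := ZeroRun.of_words hM hσ hπ hσu hπu
  have hlast : ∀ g, (zeroRunModel M u.length b (u.count 0) (letterFun π)).IsChain M g →
      (g (M + 1)).2 ≤ b := by
    intro g hg
    have h2 := hrun.le_last
    have := hg.inv hrun.isValid le_rfl
    simp only [zeroRunModel] at this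
    rw [if_neg (by omega), if_neg (by omega)] at this
    omega
  rw [hrun.tfplNumber_eq hM hσ hτ hπ]
  constructor
  · intro hne
    obtain ⟨g, hg, hgt⟩ := Set.nonempty_of_ncard_ne_zero hne
    have h2 := hlast g hg
    refine ⟨(g (M + 1)).2, h2, eq_of_letterFun ?_ fun i hi => ?_⟩
    · rw [(dyckWords_count hτ).1]
      simp; omega
    · rw [(dyckWords_count hτ).1] at hi
      rw [letterFun_zeroRun_right (by omega) hi, hgt i (by omega)]
  · intro k hk hτk
    have hset : {g | (zeroRunModel M u.length b (u.count 0) (letterFun π)).IsChain M g ∧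
        ∀ Y ≤ M, letterFun τ Y = false ↔ Y ≤ n ∧ Y + (g (M + 1)).2 ≠ n} =
        {g | (zeroRunModel M u.length b (u.count 0) (letterFun π)).IsChain M g ∧
          (g (M + 1)).2 = k} := by
      ext g
      refine and_congr_right fun hg => ?_
      have h2 := hlast g hg
      constructor
      · intro h3
        have h4 := h3 (n - k) (by omega)
        rw [hτk, letterFun_zeroRun_right (by omega) (by omega)] at h4
        omega
      · intro h3 Y hY
        rw [hτk, letterFun_zeroRun_right (by omega) (by omega), h3]
    rw [hset, hrun.ncard_isChain hk]
    have h2 := length_eq_count_add_count u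
    have h3 := hrun.lt_last
    rcases Nat.eq_zero_or_pos b with rfl | hb
    · simp
    · congr 1
      omega

theorem mainTheorem7 (n : ℕ) (u v σ τ π : List (Fin 2))
    (hσ : σ ∈ dyckWords n) (hτ : τ ∈ dyckWords n) (hπ : π ∈ dyckWords n) :
    (∀ b : ℕ, σ = u ++ List.replicate b 0 ++ [1] ++ v → π = u ++ [1] ++ List.replicate b 0 ++ v →
      (tfplNumber n σ τ π ≠ 0 → ∃ k ≤ b, τ =
        List.replicate (n - k) 0 ++ [1] ++ List.replicate k 0 ++ List.replicate (n - 1) 1) ∧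
      (∀ k ≤ b, τ =
        List.replicate (n - k) 0 ++ [1] ++ List.replicate k 0 ++ List.replicate (n - 1) 1 →
        tfplNumber n σ τ π = (2 * n - u.count 1 - 2 - k).choose (b - k))) ∧
    (∀ a : ℕ, σ = u ++ [0] ++ List.replicate a 1 ++ v → π = u ++ List.replicate a 1 ++ [0] ++ v →
      (tfplNumber n σ τ π ≠ 0 → ∃ k ≤ a, τ =
        List.replicate (n - 1) 0 ++ List.replicate k 1 ++ [0] ++ List.replicate (n - k) 1) ∧
      (∀ k ≤ a, τ =
        List.replicate (n - 1) 0 ++ List.replicate k 1 ++ [0] ++ List.replicate (n - k) 1 →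
        tfplNumber n σ τ π = (2 * n - u.count 1 - 2).choose (a - k))) := by
  exact ⟨fun b hσu hπu => tfplNumber_zeroRun n u v σ τ π hσ hτ hπ b hσu hπu,
    fun a hσu hπu => tfplNumber_oneRun n u v σ τ π hσ hτ hπ a hσu hπu⟩
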